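/- **Setting.** Let $d\in\mathbb N$ and write $\cos_{\pi/2}(r):=\cos(\min\{r,\pi/2\})$. For $t\in(0,1]$ and $\xi:\mathbb R^d\to[-\tfrac1{2t},+\infty]$ put $$(\mathscr P_t\xi)(x):=\inf_{|y-x|<\pi/2}\frac1{2t}\Big(1-\frac{\cos^2_{\pi/2}(|x-y|)}{1+2t\xi(y)}\Big),\qquad \tfrac a0:=+\infty,\ \tfrac a{+\infty}:=0\ \ (0<a<\infty),$$ let $\mathsf M_t\xi(x)\subset\{y:|y-x|<\pi/2\}$ be the set of minimizers in this infimum, and set $\mathscr P_0\xi:=\xi$, $\mathsf M_0\xi(x):=\{x\}$. Let $\xi_0:\mathbb R^d\to[-\tfrac12,+\infty]$ be lower semicontinuous and $\bar\xi_1:\mathbb R^d\to[-\infty,\tfrac12]$ upper semicontinuous with $\mathscr P_1\xi_0\ge\bar\xi_1$. For $t\in[0,1]$ set $$\xi_t:=\mathscr P_t\xi_0,\qquad \bar\xi_t:=-\mathscr P_{1-t}(-\bar\xi_1),\qquad \Xi_t:=\{x\in\mathbb R^d:\ \bar\xi_t(x)=\xi_t(x)\}.$$ For $s,t\in(0,1)$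 let $\mathsf M_{s\to t}(x):=\mathsf M_{s-t}\xi_t(x)$ if $t\le s$ and $\mathsf M_{s\to t}(x):=\mathsf M_{t-s}(-\bar\xi_t)(x)$ if $s<t$. For $x\in\Xi_s$ let $T_{s\to t}(x)$ be the unique element of $\mathsf M_{s\to t}(x)$ and let $$q_{s\to t}(x):=\Big(\frac{1+2(t-s)\xi_s(x)}{1-2(t-s)\xi_t(T_{s\to t}(x))}\Big)^{1/2}.$$ A map $F$ is differentiable along $\Xi_t$ at a point $z$ of Lebesgue density one of $\Xi_t$, with differential $\mathrm DF(z)\in\mathbb R^{d\times d}$, if $F(w)-F(z)-\mathrm DF(z)(w-z)=o(|w-z|)$ as $w\to z$, $w\in\Xi_t$. Let $\mathfrak D_t$ be the set of density points $z$ of $\Xi_t$ at which $\nabla\xi_t$ is differentiable along $\Xi_t$, and write $\mathrm D^2\xi_t(z):=\mathrm D(\nabla\xi_t)(z)$, $\Delta\xi_t(z):=\operatorname{tr}\mathrm D^2\xi_t(z)$, $|\mathrm D^2\xi_t(z)|^2:=\sum_{i,j}(\mathrm D^2\xi_t(z))_{ij}^2$ for $z\in\mathfrak D_t$. **Theorem.**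 For every $t\in(0,1)$ the function $\xi_t$ is finite on $\mathbb R^d$. Fix $s\in(0,1)$. (i) Let $x\in\Xi_s$. For every $t\in(0,1)$ the set $\mathsf M_{s\to t}(x)$ has exactly one element, so that $T(t):=T_{s\to t}(x)$ and $q(t):=q_{s\to t}(x)$ are defined; moreover $T(t)\in\Xi_t$, $\xi_t$ is differentiable at $T(t)$, and $q(t)>0$. One has $T(s)=x$, $q(s)=1$, and for all $t\in(0,1)$ $$\dot T(t)=\nabla\xi_t(T(t)),\qquad \ddot T(t)=-4\,\xi_t(T(t))\,\nabla\xi_t(T(t)),$$ $$\dot q(t)=2\,\xi_t(T(t))\,q(t),\qquad \ddot q(t)=|\nabla\xi_t(T(t))|^2\,q(t).$$ (ii) Let $y\in\mathfrak D_s$ and $T(t):=T_{s\to t}(y)$. For every $t\in(0,1)$ one has $T(t)\in\mathfrak D_t$, the map $T_{s\to t}$ is differentiable along $\Xi_s$ at $y$, and with $B(t):=\mathrm DT_{s\to t}(y)$, $\delta(t):=\det B(t)$ one has $\delta(t)>0$. Moreover $B(s)=I$, $\delta(s)=1$, and for all $t\in(0,1)$ $$\dot B(t)=\mathrm D^2\xi_t(T(t))\,B(t),\qquad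 \ddot B(t)=-4\big(\nabla\xi_t\otimes\nabla\xi_t+\xi_t\,\mathrm D^2\xi_t\big)(T(t))\,B(t),$$ $$\dot\delta(t)=\Delta\xi_t(T(t))\,\delta(t),\qquad \frac{\ddot\delta(t)}{\delta(t)}=\Big((\Delta\xi_t)^2-|\mathrm D^2\xi_t|^2-4|\nabla\xi_t|^2-4\,\xi_t\,\Delta\xi_t\Big)(T(t)).$$ -/

import Mathlib

open Set Filter Topology MeasureTheory
open scoped ENNReal

noncomputable section

namespace HK

variable {d : ℕ}

/-- The function under the infimum in the generalized Hopf--Lax formula,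
`(1 / (2t)) * (1 - cos²(min (|x - y|) (π/2)) / (1 + 2 t ξ(y)))`,
for `t > 0` and `ξ` with values in `[-1/(2t), +∞]`.
The quotient is taken in `[0, ∞]`, so that `a / 0 = ∞` and `a / ∞ = 0` for `0 < a < ∞`. -/
def cost (t : ℝ) (ξ : EuclideanSpace ℝ (Fin d) → EReal) (x y : EuclideanSpace ℝ (Fin d)) : EReal :=
  ((1 / (2 * t) : ℝ) : EReal) *
    (1 - ((ENNReal.ofReal (Real.cos (min (dist x y) (Real.pi / 2)) ^ 2) /
      (1 + ((2 * t : ℝ) : EReal) * ξ y).toENNReal : ℝ≥0∞) : EReal))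

/-- The generalized Hopf--Lax operator `𝒫_t` (the identity for `t = 0`). -/
def hopfLax (t : ℝ) (ξ : EuclideanSpace ℝ (Fin d) → EReal) (x : EuclideanSpace ℝ (Fin d)) : EReal :=
  if t = 0 then ξ x else ⨅ y ∈ Metric.ball x (Real.pi / 2), cost t ξ x y

/-- The backward operator `ξ ↦ -𝒫_t(-ξ)`. -/
def backHopfLax (t : ℝ) (ξ : EuclideanSpace ℝ (Fin d) → EReal) (x : EuclideanSpace ℝ (Fin d)) :
    EReal :=
  -hopfLax t (fun y => -ξ y) x

/-- The set of minimizers in the Hopf--Lax formula (`{x}` for `t = 0`). -/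
def minimizers (t : ℝ) (ξ : EuclideanSpace ℝ (Fin d) → EReal) (x : EuclideanSpace ℝ (Fin d)) :
    Set (EuclideanSpace ℝ (Fin d)) :=
  if t = 0 then {x} else
    {y | y ∈ Metric.ball x (Real.pi / 2) ∧ IsMinOn (cost t ξ x) (Metric.ball x (Real.pi / 2)) y}

/-- The forward solution `ξ_t = 𝒫_t ξ₀`, extended-valued. -/
def forward (ξ₀ : EuclideanSpace ℝ (Fin d) → EReal) (t : ℝ) : EuclideanSpace ℝ (Fin d) → EReal :=
  hopfLax t ξ₀

/-- The backward solution started from `η₁` at time `1`, extended-valued. -/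
def backward (η₁ : EuclideanSpace ℝ (Fin d) → EReal) (t : ℝ) : EuclideanSpace ℝ (Fin d) → EReal :=
  backHopfLax (1 - t) η₁

/-- The forward solution as a real-valued function (it is finite for `0 < t < 1`). -/
def pot (ξ₀ : EuclideanSpace ℝ (Fin d) → EReal) (t : ℝ) (x : EuclideanSpace ℝ (Fin d)) : ℝ :=
  (forward ξ₀ t x).toReal

/-- The contact set `Ξ_t` of the forward and the backward solution. -/
def contactSet (ξ₀ η₁ : EuclideanSpace ℝ (Fin d) → EReal) (t : ℝ) :
    Set (EuclideanSpace ℝ (Fin d)) :=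
  {x | backward η₁ t x = forward ξ₀ t x}

/-- `M_{s → t}(x)`: the minimizers in `ξ_s = 𝒫_{s-t} ξ_t` at `x` if `t < s`, the optimal points in
the backward formula representing the backward solution at time `s` through that at time `t`
if `s < t`, and `{x}` if `s = t`. -/
def transportSet (ξ₀ η₁ : EuclideanSpace ℝ (Fin d) → EReal) (s t : ℝ)
    (x : EuclideanSpace ℝ (Fin d)) : Set (EuclideanSpace ℝ (Fin d)) :=
  if t ≤ s then minimizers (s - t) (forward ξ₀ t) x
  else minimizers (t - s) (fun y => -backward η₁ t y) x

open Classical in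
/-- The transport map `T_{s → t}`: the element of `M_{s → t}(x)`
(which is unique for `s, t ∈ (0,1)` and `x ∈ Ξ_s`). -/
def transportMap (ξ₀ η₁ : EuclideanSpace ℝ (Fin d) → EReal) (s t : ℝ)
    (x : EuclideanSpace ℝ (Fin d)) : EuclideanSpace ℝ (Fin d) :=
  if h : (transportSet ξ₀ η₁ s t x).Nonempty then h.choose else x

/-- The dilation factor `q_{s → t}(x)`, the nonnegative number with
`q² = (1 + 2 (t - s) ξ_s(x)) / (1 - 2 (t - s) ξ_t(T_{s → t}(x)))`. -/
def dilation (ξ₀ η₁ : EuclideanSpace ℝ (Fin d) → EReal) (s t : ℝ)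
    (x : EuclideanSpace ℝ (Fin d)) : ℝ :=
  Real.sqrt ((1 + 2 * (t - s) * pot ξ₀ s x) /
    (1 - 2 * (t - s) * pot ξ₀ t (transportMap ξ₀ η₁ s t x)))

/-- `x` is a point of Lebesgue density one of `S`. -/
def IsDensityPoint (S : Set (EuclideanSpace ℝ (Fin d))) (x : EuclideanSpace ℝ (Fin d)) : Prop :=
  Tendsto (fun r : ℝ => volume (S ∩ Metric.ball x r) / volume (Metric.ball x r))
    (𝓝[>] (0 : ℝ)) (𝓝 1)

/-- `𝔇_t`: the density points of `Ξ_t` at which `∇ξ_t` is differentiable along `Ξ_t`. -/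
def regularSet (ξ₀ η₁ : EuclideanSpace ℝ (Fin d) → EReal) (t : ℝ) :
    Set (EuclideanSpace ℝ (Fin d)) :=
  {x | IsDensityPoint (contactSet ξ₀ η₁ t) x ∧
    DifferentiableWithinAt ℝ (gradient (pot ξ₀ t)) (contactSet ξ₀ η₁ t) x}

/-- `D²ξ_t(z)`: the differential along `Ξ_t` of `∇ξ_t`. -/
def hessian (ξ₀ η₁ : EuclideanSpace ℝ (Fin d) → EReal) (t : ℝ) (z : EuclideanSpace ℝ (Fin d)) :
    EuclideanSpace ℝ (Fin d) →L[ℝ] EuclideanSpace ℝ (Fin d) :=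
  fderivWithin ℝ (gradient (pot ξ₀ t)) (contactSet ξ₀ η₁ t) z

/-- `DT_{s → t}(y)`: the differential along `Ξ_s` of `T_{s → t}`. -/
def transportDeriv (ξ₀ η₁ : EuclideanSpace ℝ (Fin d) → EReal) (s t : ℝ)
    (y : EuclideanSpace ℝ (Fin d)) : EuclideanSpace ℝ (Fin d) →L[ℝ] EuclideanSpace ℝ (Fin d) :=
  fderivWithin ℝ (transportMap ξ₀ η₁ s t) (contactSet ξ₀ η₁ s) y

/-- The Laplacian `Δξ_t(z) = tr D²ξ_t(z)`. -/
def lap (ξ₀ η₁ : EuclideanSpace ℝ (Fin d) → EReal) (t : ℝ) (z : EuclideanSpace ℝ (Fin d)) : ℝ :=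
  LinearMap.trace ℝ (EuclideanSpace ℝ (Fin d))
    (hessian ξ₀ η₁ t z : EuclideanSpace ℝ (Fin d) →ₗ[ℝ] EuclideanSpace ℝ (Fin d))

/-- The sum of the squares of the matrix entries of `A` in the standard basis. -/
def normSqHS (A : EuclideanSpace ℝ (Fin d) →L[ℝ] EuclideanSpace ℝ (Fin d)) : ℝ :=
  ∑ i : Fin d, ∑ j : Fin d, (A (EuclideanSpace.single j (1 : ℝ)) i) ^ 2

/-- The operator `g ⊗ g : v ↦ ⟨g, v⟩ g`. -/
def tensorSq (g : EuclideanSpace ℝ (Fin d)) :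
    EuclideanSpace ℝ (Fin d) →L[ℝ] EuclideanSpace ℝ (Fin d) :=
  (innerSL ℝ g).smulRight g

end HK

end

noncomputable section

namespace HK

variable {d : ℕ}

/-! For `t < s` the Hopf–Lax relation between `ξ_t` and `ξ_s` can be put in product form: cos²|x-y|
≤ (1 - 2(s-t) ξ_s(x)) (1 + 2(s-t) ξ_t(y)) with the truncated cosine, where equality in the open ball
of radius π/2 singles out the minimizers. The semigroup law is exactly this inequality together with
attainment (`cosSq_le_pot_mul`, `exists_pot_mul_eq`); both follow from one trigonometric identity
whose defect is a square. The time-reversed backward solution obeys the same relations, and the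
assumption at time 1 propagates to `u t + v (1 - t) ≥ 0` (`pot_add_pot_nonneg`). Only these facts
are kept, as `IsFlow` and `IsPair`. They are symmetric under exchange of `u` and `v`, so each
statement about earlier times yields the one about later times.

The function cos² has quadratic minorants (`cosSq_ge`), so a flow is semiconcave. At a contact point
`u s` lies between a paraboloid from above and one from below, hence it is differentiable there,
with Lipschitz gradient along the contact set. The slope of the touching paraboloid expresses the
gradient through the displacement to an optimal point (`IsPair.gradient_eq`). Inverting this
relation (`eq_travel`) gives everything in closed form from the jet (p, g) = (ξ_s(x), ∇ξ_s(x)). With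
Q(τ) = (1+2τp)² + τ²|g|² and τ = t-s, one gets T = x + ∫₀^τ g/Q, q = √Q, ∇ξ_t(T) = g/Q and ξ_t(T) =
Q'/(4Q). In particular the optimal point is unique, and the equations of part (i) become calculus
with a quadratic polynomial of discriminant -4|g|².

For part (ii) the closed formula is differentiated along the contact set. The inverse transport is
Lipschitz there, so the differential B is invertible. For short times the transport is a small
Lipschitz perturbation of the identity and extends to a bi-Lipschitz bijection of the space, so
density points are carried to density points (`IsPair.isDensityPoint_trans`). The chain rule gives H
B = Ḃ for the Hessian H along the curve, and H satisfies the Riccati equation Ḣ = -4(g⊗g + ξH) - H²,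
with g and ξ now taken at time t. Jacobi's formula and the trace finish the argument. The term |H|²
replaces tr H² because H is symmetric, which a blow-up at a density point shows
(`IsDensityPoint.inner_symm`). -/

/-- The truncated squared cosine of the distance. -/
def cosSq (x y : EuclideanSpace ℝ (Fin d)) : ℝ :=
  Real.cos (min (dist x y) (Real.pi / 2)) ^ 2

/-- The inverse of `1 + 2 t ξ(y)`, with value `0` where `ξ(y) = ∞`. -/
def weight (t : ℝ) (ξ : EuclideanSpace ℝ (Fin d) → EReal) (y : EuclideanSpace ℝ (Fin d)) : ℝ :=
  if ξ y = ⊤ then 0 else (1 + 2 * t * (ξ y).toReal)⁻¹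

/-- The real form of `cost`. -/
def realCost (t : ℝ) (ξ : EuclideanSpace ℝ (Fin d) → EReal) (x y : EuclideanSpace ℝ (Fin d)) : ℝ :=
  1 / (2 * t) * (1 - cosSq x y * weight t ξ y)

/-! ### Truncated cosine and the cost as a real number -/

lemma cosSq_comm (x y : EuclideanSpace ℝ (Fin d)) : cosSq x y = cosSq y x := by
  simp [cosSq, dist_comm]

lemma cosSq_nonneg (x y : EuclideanSpace ℝ (Fin d)) : 0 ≤ cosSq x y := sq_nonneg _

lemma cosSq_le_one (x y : EuclideanSpace ℝ (Fin d)) : cosSq x y ≤ 1 := by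
  rw [cosSq, sq_le_one_iff_abs_le_one]; exact Real.abs_cos_le_one _

lemma cosSq_self (x : EuclideanSpace ℝ (Fin d)) : cosSq x x = 1 := by
  rw [cosSq, dist_self, min_eq_left (by positivity)]; simp

lemma cosSq_of_lt {x y : EuclideanSpace ℝ (Fin d)} (h : dist x y < Real.pi / 2) :
    cosSq x y = Real.cos (dist x y) ^ 2 := by
  rw [cosSq, min_eq_left h.le]

lemma cosSq_of_le {x y : EuclideanSpace ℝ (Fin d)} (h : Real.pi / 2 ≤ dist x y) :
    cosSq x y = 0 := by
  rw [cosSq, min_eq_right h]; simp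

lemma cosSq_pos {x y : EuclideanSpace ℝ (Fin d)} (h : dist x y < Real.pi / 2) :
    0 < cosSq x y := by
  rw [cosSq_of_lt h]
  have := Real.cos_pos_of_mem_Ioo ⟨by linarith [dist_nonneg (x := x) (y := y), Real.pi_pos], h⟩
  positivity

lemma dist_lt_of_cosSq_pos {x y : EuclideanSpace ℝ (Fin d)} (h : 0 < cosSq x y) :
    dist x y < Real.pi / 2 := by
  by_contra hc
  rw [cosSq_of_le (not_lt.mp hc)] at h
  exact lt_irrefl _ h

lemma abs_cosSq_sub_le (x y z : EuclideanSpace ℝ (Fin d)) :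
    |cosSq x z - cosSq y z| ≤ 2 * dist x y := by
  have h1 : |Real.cos (min (dist x z) (Real.pi / 2)) - Real.cos (min (dist y z) (Real.pi / 2))|
      ≤ dist x y := by
    refine (Real.abs_cos_sub_cos_le _ _).trans ?_
    refine (abs_min_sub_min_le_max _ _ _ _).trans ?_
    simpa using abs_dist_sub_le x y z
  have h2 : |Real.cos (min (dist x z) (Real.pi / 2)) + Real.cos (min (dist y z) (Real.pi / 2))|
      ≤ 2 := by
    refine (abs_add_le _ _).trans ?_
    linarith [Real.abs_cos_le_one (min (dist x z) (Real.pi / 2)),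
      Real.abs_cos_le_one (min (dist y z) (Real.pi / 2))]
  rw [cosSq, cosSq, sq_sub_sq, abs_mul]
  exact mul_le_mul h2 h1 (abs_nonneg _) (by norm_num)

lemma cost_eq_realCost {t : ℝ} (ht : 0 < t) {ξ : EuclideanSpace ℝ (Fin d) → EReal}
    {y : EuclideanSpace ℝ (Fin d)} (hbot : ξ y ≠ ⊥)
    (hpos : ξ y ≠ ⊤ → 0 < 1 + 2 * t * (ξ y).toReal) (x : EuclideanSpace ℝ (Fin d)) :
    cost t ξ x y = (realCost t ξ x y : EReal) := by
  unfold cost realCost weight cosSq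
  by_cases htop : ξ y = ⊤
  · rw [htop, EReal.coe_mul_top_of_pos (by positivity)]
    have : (1 : EReal) + ⊤ = ⊤ := rfl
    simp [this]
  · have hp := hpos htop
    lift ξ y to ℝ using ⟨htop, hbot⟩ with e he
    simp only [EReal.coe_ne_top, if_false, EReal.toReal_coe] at hp ⊢
    have h1 : (1 : EReal) + ((2 * t : ℝ) : EReal) * (e : EReal) = ((1 + 2 * t * e : ℝ) : EReal) := by
      push_cast; rfl
    rw [h1, EReal.toENNReal_of_ne_top (EReal.coe_ne_top _), EReal.toReal_coe,
      ← ENNReal.ofReal_div_of_pos hp, EReal.coe_ennreal_ofReal, max_eq_left (by positivity),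
      div_eq_mul_inv _ (1 + 2 * t * e)]
    push_cast; rfl

/-! ### Bounds and Lipschitz continuity at intermediate times -/

section Bounds

variable {ξ : EuclideanSpace ℝ (Fin d) → EReal} (hξ : ∀ x, ((-1 / 2 : ℝ) : EReal) ≤ ξ x)
include hξ

lemma ne_bot_of_ge (x : EuclideanSpace ℝ (Fin d)) : ξ x ≠ ⊥ := fun h => by
  have := hξ x
  rw [h] at this
  exact EReal.coe_ne_bot _ (le_bot_iff.mp this)

lemma toReal_ge {x : EuclideanSpace ℝ (Fin d)} (h : ξ x ≠ ⊤) : -1 / 2 ≤ (ξ x).toReal := by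
  have := hξ x
  rw [← EReal.coe_toReal h (ne_bot_of_ge hξ x)] at this
  exact EReal.coe_le_coe_iff.mp this

lemma weight_nonneg {t : ℝ} (ht : t ∈ Ioo (0 : ℝ) 1) (y : EuclideanSpace ℝ (Fin d)) :
    0 ≤ weight t ξ y := by
  unfold weight
  split_ifs with h
  · exact le_rfl
  · have := toReal_ge hξ h
    have : 0 ≤ 1 + 2 * t * (ξ y).toReal := by nlinarith [ht.1, ht.2]
    positivity

lemma weight_le {t : ℝ} (ht : t ∈ Ioo (0 : ℝ) 1) (y : EuclideanSpace ℝ (Fin d)) :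
    weight t ξ y ≤ (1 - t)⁻¹ := by
  have h1 : 0 < 1 - t := by linarith [ht.2]
  unfold weight
  split_ifs with h
  · positivity
  · have := toReal_ge hξ h
    exact inv_anti₀ h1 (by nlinarith [ht.1, ht.2])

lemma realCost_ge {t : ℝ} (ht : t ∈ Ioo (0 : ℝ) 1) (x y : EuclideanSpace ℝ (Fin d)) :
    -1 / (2 * (1 - t)) ≤ realCost t ξ x y := by
  have h1 : 0 < 1 - t := by linarith [ht.2]
  have h2 : cosSq x y * weight t ξ y ≤ (1 - t)⁻¹ :=
    (mul_le_of_le_one_left (weight_nonneg hξ ht y) (cosSq_le_one x y)).trans (weight_le hξ ht y)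
  have h3 : -1 / (2 * (1 - t)) = 1 / (2 * t) * (1 - (1 - t)⁻¹) := by
    have := ht.1.ne'
    field_simp; ring
  rw [h3]
  have := ht.1
  unfold realCost
  gcongr

lemma realCost_le {t : ℝ} (ht : t ∈ Ioo (0 : ℝ) 1) (x y : EuclideanSpace ℝ (Fin d)) :
    realCost t ξ x y ≤ 1 / (2 * t) := by
  have := ht.1
  have h2 := mul_nonneg (cosSq_nonneg x y) (weight_nonneg hξ ht y)
  unfold realCost
  exact mul_le_of_le_one_right (by positivity) (by linarith)

lemma cost_eq_of_ge {t : ℝ} (ht : t ∈ Ioo (0 : ℝ) 1) (x y : EuclideanSpace ℝ (Fin d)) :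
    cost t ξ x y = (realCost t ξ x y : EReal) := by
  refine cost_eq_realCost ht.1 (ne_bot_of_ge hξ y) (fun h => ?_) x
  have := toReal_ge hξ h
  nlinarith [ht.1, ht.2]

lemma forward_ne {t : ℝ} (ht : t ∈ Ioo (0 : ℝ) 1) (x : EuclideanSpace ℝ (Fin d)) :
    forward ξ t x ≠ ⊥ ∧ forward ξ t x ≠ ⊤ := by
  rw [forward, hopfLax, if_neg ht.1.ne']
  simp only [cost_eq_of_ge hξ ht]
  constructor
  · have : ((-1 / (2 * (1 - t)) : ℝ) : EReal) ≤
        ⨅ y ∈ Metric.ball x (Real.pi / 2), (realCost t ξ x y : EReal) :=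
      le_iInf₂ fun y _ => EReal.coe_le_coe_iff.mpr (realCost_ge hξ ht x y)
    exact ne_bot_of_le_ne_bot (EReal.coe_ne_bot _) this
  · have : ⨅ y ∈ Metric.ball x (Real.pi / 2), (realCost t ξ x y : EReal) ≤ realCost t ξ x x :=
      iInf₂_le x (Metric.mem_ball_self (by positivity))
    exact ne_top_of_le_ne_top (EReal.coe_ne_top _) this

lemma forward_eq_coe {t : ℝ} (ht : t ∈ Ioo (0 : ℝ) 1) (x : EuclideanSpace ℝ (Fin d)) :
    forward ξ t x = (pot ξ t x : EReal) :=
  (EReal.coe_toReal (forward_ne hξ ht x).2 (forward_ne hξ ht x).1).symm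

/-- Outside the ball the real cost has its maximal value 1/(2t), so the constraint on `y` can be
dropped. This is what lets the triangle inequality be used without case distinctions later. -/
lemma pot_le_realCost {t : ℝ} (ht : t ∈ Ioo (0 : ℝ) 1) (x y : EuclideanSpace ℝ (Fin d)) :
    pot ξ t x ≤ realCost t ξ x y := by
  have key : ∀ z ∈ Metric.ball x (Real.pi / 2), pot ξ t x ≤ realCost t ξ x z := fun z hz => by
    rw [← EReal.coe_le_coe_iff, ← forward_eq_coe hξ ht, ← cost_eq_of_ge hξ ht, forward, hopfLax,
      if_neg ht.1.ne']
    exact iInf₂_le z hz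
  by_cases hy : dist x y < Real.pi / 2
  · exact key y (by rwa [Metric.mem_ball, dist_comm])
  · refine (key x (Metric.mem_ball_self (by positivity))).trans ((realCost_le hξ ht x x).trans ?_)
    simp [realCost, cosSq_of_le (not_lt.mp hy)]

lemma le_pot {t : ℝ} (ht : t ∈ Ioo (0 : ℝ) 1) {x : EuclideanSpace ℝ (Fin d)} {c : ℝ}
    (h : ∀ y, c ≤ realCost t ξ x y) : c ≤ pot ξ t x := by
  rw [← EReal.coe_le_coe_iff, ← forward_eq_coe hξ ht, forward, hopfLax, if_neg ht.1.ne']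
  simp only [cost_eq_of_ge hξ ht]
  exact le_iInf₂ fun y _ => EReal.coe_le_coe_iff.mpr (h y)

lemma pot_ge {t : ℝ} (ht : t ∈ Ioo (0 : ℝ) 1) (x : EuclideanSpace ℝ (Fin d)) :
    -1 / (2 * (1 - t)) ≤ pot ξ t x :=
  le_pot hξ ht (realCost_ge hξ ht x)

lemma pot_le {t : ℝ} (ht : t ∈ Ioo (0 : ℝ) 1) (x : EuclideanSpace ℝ (Fin d)) :
    pot ξ t x ≤ 1 / (2 * t) :=
  (pot_le_realCost hξ ht x x).trans (realCost_le hξ ht x x)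

lemma pot_sub_le {t : ℝ} (ht : t ∈ Ioo (0 : ℝ) 1) (x x' : EuclideanSpace ℝ (Fin d)) :
    pot ξ t x - pot ξ t x' ≤ 1 / (t * (1 - t)) * dist x x' := by
  have h1 : 0 < 1 - t := by linarith [ht.2]
  have h0 := ht.1
  rw [sub_le_comm]
  refine le_pot hξ ht fun y => ?_
  rw [sub_le_iff_le_add]
  refine (pot_le_realCost hξ ht x y).trans ?_
  have h2 : (cosSq x' y - cosSq x y) * weight t ξ y ≤ 2 * dist x x' * (1 - t)⁻¹ := by
    refine mul_le_mul ?_ (weight_le hξ ht y) (weight_nonneg hξ ht y) (by positivity)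
    rw [dist_comm]
    exact (le_abs_self _).trans (abs_cosSq_sub_le x' x y)
  have h3 : 1 / (t * (1 - t)) * dist x x' = 1 / (2 * t) * (2 * dist x x' * (1 - t)⁻¹) := by
    field_simp
  rw [h3, realCost, realCost, ← mul_add]
  gcongr
  linarith

lemma continuous_pot {t : ℝ} (ht : t ∈ Ioo (0 : ℝ) 1) : Continuous (pot ξ t) := by
  have h1 : 0 < 1 - t := by linarith [ht.2]
  have h0 := ht.1
  refine (LipschitzWith.of_dist_le_mul (K := ⟨1 / (t * (1 - t)), by positivity⟩)
    fun x y => ?_).continuous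
  rw [Real.dist_eq, abs_sub_le_iff]
  have h2 := pot_sub_le hξ ht y x
  rw [dist_comm] at h2
  exact ⟨pot_sub_le hξ ht x y, h2⟩

end Bounds

/-! ### The semigroup law in product form -/

lemma sq_sin_sub_identity (m a b : ℝ) :
    (m + Real.cos a ^ 2) * (m + 1 - Real.cos b ^ 2) - m * (m + 1) * Real.cos (a - b) ^ 2 =
      (m * Real.sin (a - b) - Real.cos a * Real.sin b) ^ 2 := by
  have ha := Real.sin_sq_add_cos_sq a
  have hb := Real.sin_sq_add_cos_sq b
  rw [Real.cos_sub, Real.sin_sub]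
  grind

/-- The factor is affine in `c`, and at the extreme value 1/(2s) it equals t/s. The companion below
has extreme value (1-s)/(1-t). -/
lemma one_sub_realCost_pos {s t c : ℝ} (ht : t ∈ Ioo (0 : ℝ) 1) (hs : s ∈ Ioo (0 : ℝ) 1)
    (hts : t < s) (hc : c ≤ 1 / (2 * s)) :
    0 < 1 - 2 * (s - t) * c := by
  have h0 := hs.1
  have h1 : 2 * (s - t) * c ≤ 2 * (s - t) * (1 / (2 * s)) := by gcongr
  have h2 : 1 - 2 * (s - t) * (1 / (2 * s)) = t / s := by field_simp; ring
  have : 0 < t / s := div_pos ht.1 hs.1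
  linarith

lemma one_add_realCost_pos {s t c : ℝ} (ht : t ∈ Ioo (0 : ℝ) 1) (hs : s ∈ Ioo (0 : ℝ) 1)
    (hts : t < s) (hc : -1 / (2 * (1 - t)) ≤ c) :
    0 < 1 + 2 * (s - t) * c := by
  have h0 : 0 < 1 - t := by linarith [ht.2]
  have h1 : 2 * (s - t) * (-1 / (2 * (1 - t))) ≤ 2 * (s - t) * c := by gcongr
  have h2 : 1 + 2 * (s - t) * (-1 / (2 * (1 - t))) = (1 - s) / (1 - t) := by field_simp; ring
  have : 0 < (1 - s) / (1 - t) := div_pos (by linarith [hs.2]) h0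
  linarith

lemma realCost_of_top {ξ : EuclideanSpace ℝ (Fin d) → EReal} {s t : ℝ} (ht : 0 < t) (hs : 0 < s)
    {z : EuclideanSpace ℝ (Fin d)} (hz : ξ z = ⊤) (x y : EuclideanSpace ℝ (Fin d)) :
    (1 - 2 * (s - t) * realCost s ξ x z) * (1 + 2 * (s - t) * realCost t ξ y z) = 1 := by
  simp only [realCost, weight, hz, if_true]
  field_simp
  ring

section Semigroup

variable {ξ : EuclideanSpace ℝ (Fin d) → EReal} (hξ : ∀ x, ((-1 / 2 : ℝ) : EReal) ≤ ξ x)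
  {s t : ℝ} (ht : t ∈ Ioo (0 : ℝ) 1) (hs : s ∈ Ioo (0 : ℝ) 1) (hts : t < s)
include ht hs hts hξ

/-- Normal form to which `sq_sin_sub_identity` applies: clearing the denominators 1+2sξ(z) and
1+2tξ(z) leaves a single parameter `m`. -/
lemma realCost_mul_realCost {z : EuclideanSpace ℝ (Fin d)} (hz : ξ z ≠ ⊤)
    (x : EuclideanSpace ℝ (Fin d)) :
    ∃ m, 0 < m ∧ ∀ y,
      (1 - 2 * (s - t) * realCost s ξ x z) * (1 + 2 * (s - t) * realCost t ξ y z) =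
        (m + cosSq x z) * (m + 1 - cosSq y z) / (m * (m + 1)) := by
  have he := toReal_ge hξ hz
  have h0s := hs.1
  have h0t := ht.1
  have h1 : 0 < 1 + 2 * s * (ξ z).toReal := by nlinarith [hs.2]
  have h2 : 0 < 1 + 2 * t * (ξ z).toReal := by nlinarith [ht.2]
  have h3 : 0 < s - t := by linarith
  refine ⟨t * (1 + 2 * s * (ξ z).toReal) / (s - t), by positivity, fun y => ?_⟩
  have h4 : t * (1 + 2 * s * (ξ z).toReal) / (s - t) + 1
      = s * (1 + 2 * t * (ξ z).toReal) / (s - t) := by field_simp; ring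
  rw [h4]
  simp only [realCost, weight, hz, if_false]
  generalize cosSq x z = c
  generalize cosSq y z = c'
  generalize (ξ z).toReal = e at *
  field_simp
  ring

/-- By `sq_sin_sub_identity` the right side is at least cos² of the difference of the truncated
distances to `z`, and this difference is at most the truncated distance of `x` and `y`. -/
lemma cosSq_le_realCost_mul (x y z : EuclideanSpace ℝ (Fin d)) :
    cosSq x y ≤
      (1 - 2 * (s - t) * realCost s ξ x z) * (1 + 2 * (s - t) * realCost t ξ y z) := by
  by_cases hz : ξ z = ⊤
  · rw [realCost_of_top ht.1 hs.1 hz]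
    exact cosSq_le_one x y
  · obtain ⟨m, hm, h⟩ := realCost_mul_realCost hξ ht hs hts hz x
    rw [h, le_div_iff₀ (by positivity)]
    have key := sq_sin_sub_identity m (min (dist x z) (Real.pi / 2)) (min (dist y z) (Real.pi / 2))
    have h2 : cosSq x y ≤
        Real.cos (min (dist x z) (Real.pi / 2) - min (dist y z) (Real.pi / 2)) ^ 2 := by
      rw [← Real.cos_abs (_ - _), cosSq]
      have h3 : |min (dist x z) (Real.pi / 2) - min (dist y z) (Real.pi / 2)| ≤
          min (dist x y) (Real.pi / 2) := by
        refine le_min ?_ ?_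
        · refine (abs_min_sub_min_le_max _ _ _ _).trans ?_
          simpa using abs_dist_sub_le x y z
        · rw [abs_sub_le_iff]
          have := le_min (dist_nonneg (x := x) (y := z)) (by positivity : 0 ≤ Real.pi / 2)
          have := le_min (dist_nonneg (x := y) (y := z)) (by positivity : 0 ≤ Real.pi / 2)
          constructor <;> linarith [min_le_right (dist x z) (Real.pi / 2),
            min_le_right (dist y z) (Real.pi / 2)]
      have h4 : min (dist x y) (Real.pi / 2) ≤ Real.pi / 2 := min_le_right _ _
      have h5 := Real.cos_le_cos_of_nonneg_of_le_pi (abs_nonneg _) (by linarith [Real.pi_pos]) h3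
      have h6 : 0 ≤ Real.cos (min (dist x y) (Real.pi / 2)) :=
        Real.cos_nonneg_of_mem_Icc ⟨by linarith [(abs_nonneg _).trans h3, Real.pi_pos], h4⟩
      gcongr
    unfold cosSq at *
    nlinarith [sq_nonneg (m * Real.sin (min (dist x z) (Real.pi / 2) -
      min (dist y z) (Real.pi / 2)) - Real.cos (min (dist x z) (Real.pi / 2)) *
      Real.sin (min (dist y z) (Real.pi / 2))), mul_pos hm (by linarith : 0 < m + 1)]

lemma cosSq_le_pot_mul (x y : EuclideanSpace ℝ (Fin d)) :
    cosSq x y ≤ (1 - 2 * (s - t) * pot ξ s x) * (1 + 2 * (s - t) * pot ξ t y) := by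
  have hA := one_sub_realCost_pos ht hs hts (pot_le hξ hs x)
  have h3 : 0 < s - t := by linarith
  have h : (cosSq x y / (1 - 2 * (s - t) * pot ξ s x) - 1) / (2 * (s - t)) ≤ pot ξ t y := by
    refine le_pot hξ ht fun z => ?_
    rw [div_le_iff₀ (by positivity), sub_le_iff_le_add, div_le_iff₀ hA]
    refine (cosSq_le_realCost_mul hξ ht hs hts x y z).trans ?_
    have h1 := pot_le_realCost hξ hs x z
    have h2 := one_add_realCost_pos ht hs hts (realCost_ge hξ ht y z)
    rw [mul_comm, mul_comm _ (2 * (s - t)), add_comm (2 * (s - t) * _)]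
    gcongr
  rw [div_le_iff₀ (by positivity), sub_le_iff_le_add, div_le_iff₀ hA] at h
  linarith

/-- Sharpness: on the segment from `z` to `x` the triangle inequality is an equality, and a suitable
point of it makes the square in `sq_sin_sub_identity` vanish. -/
lemma exists_realCost_mul_le (x z : EuclideanSpace ℝ (Fin d)) :
    ∃ y, dist x y < Real.pi / 2 ∧
      (1 - 2 * (s - t) * realCost s ξ x z) * (1 + 2 * (s - t) * realCost t ξ y z) ≤
        cosSq x y := by
  by_cases hz : ξ z = ⊤
  · refine ⟨x, by simp [Real.pi_pos], ?_⟩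
    rw [realCost_of_top ht.1 hs.1 hz, cosSq_self]
  by_cases hd : Real.pi / 2 ≤ dist x z
  · refine ⟨x, by simp [Real.pi_pos], ?_⟩
    obtain ⟨m, hm, h⟩ := realCost_mul_realCost hξ ht hs hts hz x
    rw [h, cosSq_of_le hd, cosSq_self]
    apply le_of_eq
    field_simp; ring
  push Not at hd
  set a := dist x z with ha
  have ha0 : 0 ≤ a := dist_nonneg
  have hpos : ∀ b ∈ Icc 0 a, 0 ≤ Real.sin b ∧ 0 ≤ Real.cos a := fun b hb =>
    ⟨Real.sin_nonneg_of_nonneg_of_le_pi hb.1 (by linarith [hb.2, Real.pi_pos]),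
      Real.cos_nonneg_of_mem_Icc ⟨by linarith [Real.pi_pos], hd.le⟩⟩
  obtain ⟨m, hm, hmul⟩ := realCost_mul_realCost hξ ht hs hts hz x
  -- Here `b` is the distance from `z` to the intermediate point. The expression is nonnegative at
  -- `b = 0` and nonpositive at `b = a`.
  obtain ⟨b, hb, hb0⟩ : ∃ b ∈ Icc 0 a, m * Real.sin (a - b) - Real.cos a * Real.sin b = 0 := by
    have hc : ContinuousOn (fun b => m * Real.sin (a - b) - Real.cos a * Real.sin b) (Icc 0 a) := by
      fun_prop
    have := intermediate_value_Icc' ha0 hc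
    refine this ⟨?_, ?_⟩
    · simpa using mul_nonneg (hpos a ⟨ha0, le_rfl⟩).2 (hpos a ⟨ha0, le_rfl⟩).1
    · simpa using mul_nonneg hm.le (hpos a ⟨ha0, le_rfl⟩).1
  obtain ⟨y, hy1, hy2⟩ : ∃ y, dist y z = b ∧ dist x y = a - b := by
    rcases ha0.eq_or_lt with h0 | h0
    · refine ⟨x, ?_, ?_⟩
      · rw [← ha]; linarith [hb.1, hb.2]
      · rw [dist_self]; linarith [hb.1, hb.2]
    · refine ⟨AffineMap.lineMap z x (b / a), ?_, ?_⟩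
      · rw [dist_lineMap_left, dist_comm z x, ← ha, Real.norm_of_nonneg (div_nonneg hb.1 ha0)]
        field_simp
      · rw [dist_comm, dist_lineMap_right, dist_comm z x, ← ha, Real.norm_of_nonneg]
        · field_simp
        · rw [sub_nonneg, div_le_one h0]; exact hb.2
  refine ⟨y, by rw [hy2]; linarith [hb.1], le_of_eq ?_⟩
  rw [hmul y, cosSq_of_lt hd, cosSq_of_lt (by rw [hy1]; linarith [hb.2]),
    cosSq_of_lt (by rw [hy2]; linarith [hb.1]), hy1, hy2, div_eq_iff (by positivity)]
  have := sq_sin_sub_identity m a b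
  rw [hb0] at this
  linarith

/-- The solution at time `t` is continuous, so an optimal `y` exists by compactness of the closed
ball. No minimizer at time 0 is needed: every `z` is bounded separately by `exists_realCost_mul_le`,
and then the infimum is taken. -/
lemma exists_pot_mul_eq (x : EuclideanSpace ℝ (Fin d)) :
    ∃ y, dist x y < Real.pi / 2 ∧
      (1 - 2 * (s - t) * pot ξ s x) * (1 + 2 * (s - t) * pot ξ t y) = cosSq x y := by
  have h3 : 0 < s - t := by linarith
  have hB : ∀ y, 0 < 1 + 2 * (s - t) * pot ξ t y := fun y =>
    one_add_realCost_pos ht hs hts (pot_ge hξ ht y)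
  have hcont : Continuous fun y => cosSq x y / (1 + 2 * (s - t) * pot ξ t y) := by
    have := continuous_pot hξ ht
    unfold cosSq
    exact Continuous.div (by fun_prop) (by fun_prop) fun y => (hB y).ne'
  obtain ⟨y, -, hy⟩ := (isCompact_closedBall x (Real.pi / 2)).exists_isMaxOn
    ⟨x, Metric.mem_closedBall_self (by positivity)⟩ hcont.continuousOn
  -- The quotient is positive at `y = x` and vanishes on the boundary sphere, so its maximizer lies
  -- in the open ball.
  have hyx : 0 < cosSq x y / (1 + 2 * (s - t) * pot ξ t y) := by
    refine lt_of_lt_of_le ?_ (hy (Metric.mem_closedBall_self (by positivity)))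
    simpa [cosSq_self] using hB x
  have hy1 : dist x y < Real.pi / 2 := by
    refine dist_lt_of_cosSq_pos ?_
    have := mul_pos hyx (hB y)
    rwa [div_mul_cancel₀ _ (hB y).ne'] at this
  refine ⟨y, hy1, le_antisymm ?_ (cosSq_le_pot_mul hξ ht hs hts x y)⟩
  rw [← le_div_iff₀ (hB y)]
  suffices (1 - cosSq x y / (1 + 2 * (s - t) * pot ξ t y)) / (2 * (s - t)) ≤ pot ξ s x by
    rw [div_le_iff₀ (by positivity)] at this
    linarith
  refine le_pot hξ hs fun z => ?_
  obtain ⟨y', hd', hy'⟩ := exists_realCost_mul_le hξ ht hs hts x z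
  have h4 := hy (show y' ∈ Metric.closedBall x (Real.pi / 2) by
    rw [Metric.mem_closedBall, dist_comm]; exact hd'.le)
  simp only [mem_ofPred_eq] at h4
  have h5 : 1 - 2 * (s - t) * realCost s ξ x z ≤ cosSq x y' / (1 + 2 * (s - t) * pot ξ t y') := by
    rw [le_div_iff₀ (hB y')]
    refine le_trans ?_ hy'
    have := one_sub_realCost_pos ht hs hts (realCost_le hξ hs x z)
    have := pot_le_realCost hξ ht y' z
    gcongr
  rw [div_le_iff₀ (by positivity)]
  linarith

end Semigroup

/-! ### Ordering of the forward and the backward solution -/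

lemma cos_sq_mul_cos_sq_le {a b α β k : ℝ} (ha : a ∈ Icc 0 (Real.pi / 2))
    (hb : b ∈ Icc 0 (Real.pi / 2)) (hα : 0 ≤ α) (hβ : 0 ≤ β) (hk : k ^ 2 ≤ α * β)
    (hk' : Real.cos (a + b) ≤ k) :
    Real.cos a ^ 2 * Real.cos b ^ 2 ≤ (Real.sin a ^ 2 + α) * (Real.sin b ^ 2 + β) := by
  have h1 : 0 ≤ Real.sin a := Real.sin_nonneg_of_nonneg_of_le_pi ha.1 (by linarith [ha.2, Real.pi_pos])
  have h2 : 0 ≤ Real.sin b := Real.sin_nonneg_of_nonneg_of_le_pi hb.1 (by linarith [hb.2, Real.pi_pos])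
  have h3 : 0 ≤ Real.cos a := Real.cos_nonneg_of_mem_Icc ⟨by linarith [ha.1, Real.pi_pos], ha.2⟩
  have h4 : 0 ≤ Real.cos b := Real.cos_nonneg_of_mem_Icc ⟨by linarith [hb.1, Real.pi_pos], hb.2⟩
  have hk2 : k ≤ √α * √β := by
    rw [← Real.sqrt_mul hα]; exact Real.le_sqrt_of_sq_le hk
  have hαs := Real.sq_sqrt hα
  have hβs := Real.sq_sqrt hβ
  have h5 : Real.cos a * Real.cos b ≤ Real.sin a * Real.sin b + √α * √β := by
    rw [Real.cos_add] at hk'; linarith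
  have h6 : (Real.cos a * Real.cos b) ^ 2 ≤ (Real.sin a * Real.sin b + √α * √β) ^ 2 :=
    pow_le_pow_left₀ (mul_nonneg h3 h4) h5 2
  -- Cauchy–Schwarz for (sin a, √α) and (sin b, √β); the hint is its defect.
  nlinarith [sq_nonneg (Real.sin a * √β - √α * Real.sin b)]

section Order

variable {ξ η : EuclideanSpace ℝ (Fin d) → EReal} (hξ : ∀ x, ((-1 / 2 : ℝ) : EReal) ≤ ξ x)
  (hη : ∀ x, η x ≤ ((1 / 2 : ℝ) : EReal)) (hle : ∀ x, η x ≤ hopfLax 1 ξ x)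

lemma neg_ge_of_le_half (hη : ∀ x, η x ≤ ((1 / 2 : ℝ) : EReal)) (x : EuclideanSpace ℝ (Fin d)) :
    ((-1 / 2 : ℝ) : EReal) ≤ -η x := by
  rw [EReal.le_neg, ← EReal.coe_neg]
  convert hη x using 2
  norm_num

include hξ hη hle

/-- The ordering assumption at time 1, in product form and restricted to points where both data are
finite. -/
lemma cosSq_le_endpoint_mul {z w : EuclideanSpace ℝ (Fin d)} (hz : ξ z ≠ ⊤) (hw : -η w ≠ ⊤) :
    cosSq w z ≤ (1 + 2 * (ξ z).toReal) * (1 + 2 * (-η w).toReal) := by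
  have h1 := toReal_ge hξ hz
  have h2 := toReal_ge (neg_ge_of_le_half hη) hw
  by_cases hd : Real.pi / 2 ≤ dist w z
  · rw [cosSq_of_le hd]
    exact mul_nonneg (by linarith) (by linarith)
  push Not at hd
  have hbot : η w ≠ ⊥ := by simpa using hw
  have htop : η w ≠ ⊤ := ne_top_of_le_ne_top (EReal.coe_ne_top _) (hη w)
  have hc : η w ≤ cost 1 ξ w z := by
    refine (hle w).trans ?_
    rw [hopfLax, if_neg one_ne_zero]
    exact iInf₂_le z (by rwa [Metric.mem_ball, dist_comm])
  -- If 1 + 2ξ(z) = 0, the convention a/0 = ∞ makes the cost `⊥`, which would force `η w = ⊥`.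
  rcases h1.eq_or_lt with h0 | h0
  · exfalso
    have hze : ξ z = ((-1 / 2 : ℝ) : EReal) := by
      rw [h0, EReal.coe_toReal hz (ne_bot_of_ge hξ z)]
    have h3 : (1 : EReal) + ((2 * 1 : ℝ) : EReal) * ((-1 / 2 : ℝ) : EReal) = 0 := by
      rw [← EReal.coe_mul, ← EReal.coe_one, ← EReal.coe_add, ← EReal.coe_zero]
      norm_num
    have h4 : ENNReal.ofReal (cosSq w z) ≠ 0 := by
      simpa using cosSq_pos hd
    unfold cosSq at h4
    rw [cost, hze, h3, EReal.toENNReal_zero, ENNReal.div_zero h4, EReal.coe_ennreal_top,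
      EReal.sub_top, EReal.coe_mul_bot_of_pos (by norm_num)] at hc
    exact hbot (le_bot_iff.mp hc)
  · rw [cost_eq_realCost one_pos (ne_bot_of_ge hξ z) (fun _ => by linarith),
      ← EReal.coe_toReal htop hbot, EReal.coe_le_coe_iff, realCost, weight, if_neg hz] at hc
    rw [_root_.EReal.toReal_neg_eq]
    have h5 : 0 < 1 + 2 * (ξ z).toReal := by linarith
    have h6 : cosSq w z * (1 + 2 * 1 * (ξ z).toReal)⁻¹ ≤ 1 - 2 * (η w).toReal := by linarith
    rw [mul_one, ← div_eq_mul_inv, div_le_iff₀ h5] at h6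
    linarith

lemma realCost_add_nonneg {t : ℝ} (ht : t ∈ Ioo (0 : ℝ) 1) (x z w : EuclideanSpace ℝ (Fin d)) :
    0 ≤ realCost t ξ x z + realCost (1 - t) (fun y => -η y) x w := by
  have h0 := ht.1
  have h1 : 0 < 1 - t := by linarith [ht.2]
  have ht' : 1 - t ∈ Ioo (0 : ℝ) 1 := ⟨h1, by linarith⟩
  suffices (1 - t) * (cosSq x z * weight t ξ z) +
      t * (cosSq x w * weight (1 - t) (fun y => -η y) w) ≤ 1 by
    have h2 : realCost t ξ x z + realCost (1 - t) (fun y => -η y) x w =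
      1 / (2 * t * (1 - t)) * (1 - ((1 - t) * (cosSq x z * weight t ξ z) +
      t * (cosSq x w * weight (1 - t) (fun y => -η y) w))) := by
      unfold realCost; field_simp; ring
    rw [h2]
    exact mul_nonneg (by positivity) (by linarith)
  have hz := (mul_le_of_le_one_left (weight_nonneg hξ ht z) (cosSq_le_one x z)).trans
    (weight_le hξ ht z)
  have hw := (mul_le_of_le_one_left (weight_nonneg (neg_ge_of_le_half hη) ht' w)
    (cosSq_le_one x w)).trans (weight_le (neg_ge_of_le_half hη) ht' w)
  by_cases hzt : ξ z = ⊤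
  · simp only [weight, hzt, if_true, mul_zero, zero_add]
    rw [sub_sub_cancel] at hw
    calc _ ≤ t * t⁻¹ := by gcongr; exact hw
      _ = 1 := mul_inv_cancel₀ h0.ne'
  by_cases hwt : -η w = ⊤
  · simp only [weight, hwt, if_true, mul_zero, add_zero]
    calc _ ≤ (1 - t) * (1 - t)⁻¹ := by gcongr; exact hz
      _ = 1 := mul_inv_cancel₀ h1.ne'
  have key := cosSq_le_endpoint_mul hξ hη hle hzt hwt
  have hA := toReal_ge hξ hzt
  have hB := toReal_ge (neg_ge_of_le_half hη) hwt
  simp only [weight, hzt, hwt, if_false]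
  generalize (ξ z).toReal = e at *
  generalize (-η w).toReal = e' at *
  have ha : min (dist x z) (Real.pi / 2) ∈ Icc 0 (Real.pi / 2) :=
    ⟨le_min dist_nonneg (by positivity), min_le_right _ _⟩
  have hb : min (dist x w) (Real.pi / 2) ∈ Icc 0 (Real.pi / 2) :=
    ⟨le_min dist_nonneg (by positivity), min_le_right _ _⟩
  have hk' : Real.cos (min (dist x z) (Real.pi / 2) + min (dist x w) (Real.pi / 2)) ≤
      Real.cos (min (dist w z) (Real.pi / 2)) := by
    refine Real.cos_le_cos_of_nonneg_of_le_pi (le_min dist_nonneg (by positivity))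
      (by linarith [ha.2, hb.2]) ?_
    have h3 : dist w z ≤ dist x z + dist x w := by
      rw [add_comm, dist_comm x w]; exact dist_triangle w x z
    rcases le_total (dist x z) (Real.pi / 2) with h4 | h4
    · rcases le_total (dist x w) (Real.pi / 2) with h5 | h5
      · rw [min_eq_left h4, min_eq_left h5]
        exact (min_le_left _ _).trans h3
      · rw [min_eq_right h5]
        exact (min_le_right _ _).trans (by linarith [ha.1])
    · rw [min_eq_right h4]
      exact (min_le_right _ _).trans (by linarith [hb.1])
  -- With α = t(1+2e)/(1-t) and β = (1-t)(1+2e')/t, the product αβ is the right side of `key`, and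
  -- the two weights become 1/((1-t)(1+α)) and 1/(t(1+β)).
  have hα : 0 ≤ t * (1 + 2 * e) / (1 - t) := by
    have : 0 ≤ 1 + 2 * e := by linarith
    positivity
  have hβ : 0 ≤ (1 - t) * (1 + 2 * e') / t := by
    have : 0 ≤ 1 + 2 * e' := by linarith
    positivity
  have main := cos_sq_mul_cos_sq_le ha hb hα hβ (k := Real.cos (min (dist w z) (Real.pi / 2)))
    (by
      refine key.trans_eq ?_
      field_simp) hk'
  rw [Real.sin_sq, Real.sin_sq] at main
  change cosSq x z * cosSq x w ≤ (1 - cosSq x z + _) * (1 - cosSq x w + _) at main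
  have e1 : 1 + 2 * t * e = (1 - t) * (1 + t * (1 + 2 * e) / (1 - t)) := by field_simp; ring
  have e2 : 1 + 2 * (1 - t) * e' = t * (1 + (1 - t) * (1 + 2 * e') / t) := by field_simp; ring
  rw [e1, e2]
  generalize t * (1 + 2 * e) / (1 - t) = α at *
  generalize (1 - t) * (1 + 2 * e') / t = β at *
  have e3 : (1 - t) * (cosSq x z * ((1 - t) * (1 + α))⁻¹) + t * (cosSq x w * (t * (1 + β))⁻¹) =
      (cosSq x z * (1 + β) + cosSq x w * (1 + α)) / ((1 + α) * (1 + β)) := by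
    field_simp
  rw [e3, div_le_one (by positivity)]
  linarith

lemma pot_add_pot_nonneg {t : ℝ} (ht : t ∈ Ioo (0 : ℝ) 1) (x : EuclideanSpace ℝ (Fin d)) :
    0 ≤ pot ξ t x + pot (fun y => -η y) (1 - t) x := by
  have ht' : 1 - t ∈ Ioo (0 : ℝ) 1 := ⟨by linarith [ht.2], by linarith [ht.1]⟩
  rw [← neg_le_iff_add_nonneg']
  refine le_pot (neg_ge_of_le_half hη) ht' fun w => ?_
  rw [neg_le_iff_add_nonneg', ← neg_le_iff_add_nonneg]
  refine le_pot hξ ht fun z => ?_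
  rw [neg_le_iff_add_nonneg]
  exact realCost_add_nonneg hξ hη hle ht x z w

end Order

/-- The cost at `y` is at least `p`, with equality exactly when the product inequality is an
equality. Attainment makes `p` the minimum, so the minimizers are the equality cases. -/
lemma minimizers_eq {τ : ℝ} (hτ : 0 < τ) {f : EuclideanSpace ℝ (Fin d) → EReal}
    {w : EuclideanSpace ℝ (Fin d) → ℝ} (hf : ∀ y, f y = (w y : EReal))
    (hw : ∀ y, 0 < 1 + 2 * τ * w y) {x : EuclideanSpace ℝ (Fin d)} {p : ℝ}
    (hle : ∀ y, cosSq x y ≤ (1 - 2 * τ * p) * (1 + 2 * τ * w y))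
    (hex : ∃ y, dist x y < Real.pi / 2 ∧ (1 - 2 * τ * p) * (1 + 2 * τ * w y) = cosSq x y) :
    minimizers τ f x =
      {y | dist x y < Real.pi / 2 ∧ (1 - 2 * τ * p) * (1 + 2 * τ * w y) = cosSq x y} := by
  have hc : ∀ y, cost τ f x y = (((1 - cosSq x y / (1 + 2 * τ * w y)) / (2 * τ) : ℝ) : EReal) := by
    intro y
    rw [cost_eq_realCost hτ (by rw [hf]; exact EReal.coe_ne_bot _)
      (fun _ => by rw [hf, EReal.toReal_coe]; exact hw y), realCost, weight,
      if_neg (by rw [hf]; exact EReal.coe_ne_top _), hf, EReal.toReal_coe, ← div_eq_mul_inv]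
    congr 1; ring
  have hval : ∀ y, p ≤ (1 - cosSq x y / (1 + 2 * τ * w y)) / (2 * τ) := by
    intro y
    have := hle y
    rw [← div_le_iff₀ (hw y)] at this
    rw [le_div_iff₀ (by positivity)]
    linarith
  have heq : ∀ y, (1 - 2 * τ * p) * (1 + 2 * τ * w y) = cosSq x y ↔
      (1 - cosSq x y / (1 + 2 * τ * w y)) / (2 * τ) ≤ p := by
    intro y
    have h1 := hw y
    constructor
    · intro h
      rw [← h]; apply le_of_eq; field_simp; ring
    · intro h
      refine le_antisymm ?_ (hle y)
      rw [div_le_iff₀ (by positivity)] at h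
      rw [← le_div_iff₀ h1]
      linarith
  rw [minimizers, if_neg hτ.ne']
  ext y
  simp only [Set.mem_ofPred_eq, Metric.mem_ball, dist_comm y x]
  refine and_congr_right fun hy => ?_
  rw [heq]
  obtain ⟨y₀, hy₀, h₀⟩ := hex
  constructor
  · intro h
    have h1 := h (show y₀ ∈ Metric.ball x (Real.pi / 2) by rwa [Metric.mem_ball, dist_comm])
    simp only [Set.mem_ofPred_eq, hc, EReal.coe_le_coe_iff] at h1
    exact h1.trans ((heq y₀).mp h₀)
  · intro h y' hy'
    simp only [Set.mem_ofPred_eq, hc, EReal.coe_le_coe_iff]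
    exact h.trans (hval y')

/-! ### Quadratic minorants of the squared cosine -/

open scoped RealInnerProductSpace

/-- The slope of the chord from the origin to the graph of the concave function sin decreases. -/
lemma antitoneOn_sinc : AntitoneOn Real.sinc (Icc 0 Real.pi) := by
  intro a ha b hb hab
  rcases ha.1.eq_or_lt with h | h
  · rw [← h, Real.sinc_zero]; exact Real.sinc_le_one b
  · have hb0 : 0 < b := h.trans_le hab
    rw [Real.sinc_of_ne_zero hb0.ne', Real.sinc_of_ne_zero h.ne', div_le_div_iff₀ hb0 h]
    have h1 := strictConcaveOn_sin_Icc.concaveOn.2 hb ⟨le_rfl, Real.pi_pos.le⟩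
      (div_nonneg h.le hb0.le) (sub_nonneg.mpr ((div_le_one hb0).mpr hab)) (by ring)
    simp only [smul_eq_mul, mul_zero, add_zero, Real.sin_zero, div_mul_cancel₀ _ hb0.ne'] at h1
    rw [div_mul_eq_mul_div, div_le_iff₀ hb0] at h1
    linarith

lemma sinc_mul_self (x : ℝ) : Real.sinc x * x = Real.sin x := by
  by_cases h : x = 0
  · simp [h]
  · rw [Real.sinc_of_ne_zero h, div_mul_cancel₀ _ h]

lemma sinc_two_mul_nonneg {r : ℝ} (hr : r ∈ Icc 0 (Real.pi / 2)) : 0 ≤ Real.sinc (2 * r) := by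
  have := antitoneOn_sinc ⟨by linarith [hr.1], by linarith [hr.2]⟩ ⟨Real.pi_pos.le, le_rfl⟩
    (show 2 * r ≤ Real.pi by linarith [hr.2])
  rwa [Real.sinc_of_ne_zero Real.pi_ne_zero, Real.sin_pi, zero_div] at this

/-- The derivative at ρ is 2ρ(sinc 2r - sinc 2ρ), which changes from nonpositive to nonnegative at ρ
= r because sinc decreases on [0, π]. -/
lemma cos_sq_add_sinc_mul_sq_le {r r' : ℝ} (hr : r ∈ Icc 0 (Real.pi / 2))
    (hr' : r' ∈ Icc 0 (Real.pi / 2)) :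
    Real.cos r ^ 2 + Real.sinc (2 * r) * r ^ 2 ≤ Real.cos r' ^ 2 + Real.sinc (2 * r) * r' ^ 2 := by
  set c := Real.sinc (2 * r) with hc
  have hd : ∀ ρ : ℝ, HasDerivAt (fun ρ => Real.cos ρ ^ 2 + c * ρ ^ 2)
      (2 * ρ * (c - Real.sinc (2 * ρ))) ρ := by
    intro ρ
    have := ((Real.hasDerivAt_cos ρ).pow 2).add (((hasDerivAt_id ρ).pow 2).const_mul c)
    refine HasDerivAt.congr_deriv this ?_
    have h2 := sinc_mul_self (2 * ρ)
    rw [Real.sin_two_mul] at h2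
    norm_num
    linarith
  have hcont : Continuous fun ρ => Real.cos ρ ^ 2 + c * ρ ^ 2 := by fun_prop
  rcases le_total r' r with h | h
  · have : AntitoneOn (fun ρ => Real.cos ρ ^ 2 + c * ρ ^ 2) (Icc 0 r) := by
      refine antitoneOn_of_deriv_nonpos (convex_Icc _ _) hcont.continuousOn
        (fun ρ _ => (hd ρ).differentiableAt.differentiableWithinAt) fun ρ hρ => ?_
      rw [interior_Icc] at hρ
      rw [(hd ρ).deriv]
      have := antitoneOn_sinc (a := 2 * ρ) (b := 2 * r) ⟨by linarith [hρ.1], by linarith [hρ.2, hr.2]⟩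
        ⟨by linarith [hr.1], by linarith [hr.2]⟩ (by linarith [hρ.2])
      exact mul_nonpos_of_nonneg_of_nonpos (by linarith [hρ.1]) (by linarith)
    exact this ⟨hr'.1, h⟩ ⟨hr.1, le_rfl⟩ h
  · have : MonotoneOn (fun ρ => Real.cos ρ ^ 2 + c * ρ ^ 2) (Icc r (Real.pi / 2)) := by
      refine monotoneOn_of_deriv_nonneg (convex_Icc _ _) hcont.continuousOn
        (fun ρ _ => (hd ρ).differentiableAt.differentiableWithinAt) fun ρ hρ => ?_
      rw [interior_Icc] at hρ
      rw [(hd ρ).deriv]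
      have := antitoneOn_sinc (a := 2 * r) (b := 2 * ρ) ⟨by linarith [hr.1], by linarith [hr.2]⟩
        ⟨by linarith [hρ.1, hr.1], by linarith [hρ.2]⟩ (by linarith [hρ.1])
      exact mul_nonneg (by linarith [hρ.1, hr.1]) (by linarith)
    exact this ⟨le_rfl, hr.2⟩ ⟨h, hr'.2⟩ h

/-- As a function of the squared distance, cos² lies above its tangent, and the squared distance
expands exactly in `x' - x`. The quadratic coefficient is 1 because sinc ≤ 1. -/
lemma cosSq_ge {x y : EuclideanSpace ℝ (Fin d)} (h : dist x y < Real.pi / 2)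
    (x' : EuclideanSpace ℝ (Fin d)) :
    cosSq x y - 2 * Real.sinc (2 * dist x y) * ⟪x - y, x' - x⟫ - ‖x' - x‖ ^ 2 ≤ cosSq x' y := by
  have hr : dist x y ∈ Icc 0 (Real.pi / 2) := ⟨dist_nonneg, h.le⟩
  have hs := sinc_two_mul_nonneg hr
  have hm : min (dist x' y) (Real.pi / 2) ∈ Icc 0 (Real.pi / 2) :=
    ⟨le_min dist_nonneg (by positivity), min_le_right _ _⟩
  have h1 := cos_sq_add_sinc_mul_sq_le hr hm
  have h2 : min (dist x' y) (Real.pi / 2) ^ 2 ≤ dist x' y ^ 2 :=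
    pow_le_pow_left₀ hm.1 (min_le_left _ _) 2
  have h3 : dist x' y ^ 2 = dist x y ^ 2 + 2 * ⟪x - y, x' - x⟫ + ‖x' - x‖ ^ 2 := by
    rw [dist_eq_norm, dist_eq_norm, ← norm_add_sq_real]
    congr 2; abel
  rw [cosSq_of_lt h]
  have h4 : Real.sinc (2 * dist x y) * min (dist x' y) (Real.pi / 2) ^ 2 ≤
      Real.sinc (2 * dist x y) * dist x' y ^ 2 := by gcongr
  have h5 : Real.sinc (2 * dist x y) * ‖x' - x‖ ^ 2 ≤ 1 * ‖x' - x‖ ^ 2 := by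
    gcongr; exact Real.sinc_le_one _
  rw [h3] at h4
  unfold cosSq
  linarith

/-! ### Abstract pairs of evolutions and their contact points -/

/-- A family of functions with the properties of the Hopf--Lax evolution on the time
interval `(0, 1)`. -/
structure IsFlow (u : ℝ → EuclideanSpace ℝ (Fin d) → ℝ) : Prop where
  ge : ∀ t ∈ Ioo (0 : ℝ) 1, ∀ x, -1 / (2 * (1 - t)) ≤ u t x
  le : ∀ t ∈ Ioo (0 : ℝ) 1, ∀ x, u t x ≤ 1 / (2 * t)
  continuous : ∀ t ∈ Ioo (0 : ℝ) 1, Continuous (u t)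
  cosSq_le : ∀ t ∈ Ioo (0 : ℝ) 1, ∀ s ∈ Ioo (0 : ℝ) 1, t < s → ∀ x y,
    cosSq x y ≤ (1 - 2 * (s - t) * u s x) * (1 + 2 * (s - t) * u t y)
  exists_eq : ∀ t ∈ Ioo (0 : ℝ) 1, ∀ s ∈ Ioo (0 : ℝ) 1, t < s → ∀ x, ∃ y,
    dist x y < Real.pi / 2 ∧ (1 - 2 * (s - t) * u s x) * (1 + 2 * (s - t) * u t y) = cosSq x y

/-- A forward evolution `u` lying above the time reversal of `-v` for a second evolution `v`. -/
structure IsPair (u v : ℝ → EuclideanSpace ℝ (Fin d) → ℝ) : Prop where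
  left : IsFlow u
  right : IsFlow v
  nonneg : ∀ t ∈ Ioo (0 : ℝ) 1, ∀ x, 0 ≤ u t x + v (1 - t) x

/-- The points where the two evolutions of a pair touch. -/
def touch (u v : ℝ → EuclideanSpace ℝ (Fin d) → ℝ) (t : ℝ) : Set (EuclideanSpace ℝ (Fin d)) :=
  {x | u t x + v (1 - t) x = 0}

/-- `x` at time `s` and `y` at time `t` are joined by an optimal curve. -/
def Linked (u : ℝ → EuclideanSpace ℝ (Fin d) → ℝ) (s t : ℝ) (x y : EuclideanSpace ℝ (Fin d)) :
    Prop :=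
  dist x y < Real.pi / 2 ∧ (1 + 2 * (t - s) * u s x) * (1 - 2 * (t - s) * u t y) = cosSq x y

lemma one_sub_mem {t : ℝ} (ht : t ∈ Ioo (0 : ℝ) 1) : 1 - t ∈ Ioo (0 : ℝ) 1 :=
  ⟨by linarith [ht.2], by linarith [ht.1]⟩

lemma Linked.symm {u : ℝ → EuclideanSpace ℝ (Fin d) → ℝ} {s t : ℝ}
    {x y : EuclideanSpace ℝ (Fin d)} (h : Linked u s t x y) : Linked u t s y x := by
  refine ⟨by rw [dist_comm]; exact h.1, ?_⟩
  rw [cosSq_comm, ← h.2]; ring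

/-- Paraboloids touching `f` at `x` from both sides must have the same slope: at the test point x -
ε(g₁-g₂) the linear gap is of order ε and the quadratic errors are of order ε². -/
lemma eq_of_quadratic_bounds {f : EuclideanSpace ℝ (Fin d) → ℝ} {x g₁ g₂ : EuclideanSpace ℝ (Fin d)}
    {K : ℝ} (h₁ : ∀ x', f x' ≤ f x + ⟪g₁, x' - x⟫ + K * ‖x' - x‖ ^ 2)
    (h₂ : ∀ x', f x + ⟪g₂, x' - x⟫ - K * ‖x' - x‖ ^ 2 ≤ f x') : g₁ = g₂ := by
  by_contra hne
  have hpos : 0 < ‖g₁ - g₂‖ ^ 2 := by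
    have := norm_pos_iff.mpr (sub_ne_zero.mpr hne)
    positivity
  have key : ∀ ε : ℝ, 0 < ε → 1 ≤ 2 * K * ε := by
    intro ε hε
    have a := h₁ (x - ε • (g₁ - g₂))
    have b := h₂ (x - ε • (g₁ - g₂))
    rw [sub_sub_cancel_left, inner_neg_right, inner_smul_right, norm_neg, norm_smul,
      Real.norm_of_nonneg hε.le] at a b
    have h3 : ⟪g₁, g₁ - g₂⟫ - ⟪g₂, g₁ - g₂⟫ = ‖g₁ - g₂‖ ^ 2 := by
      rw [← inner_sub_left, real_inner_self_eq_norm_sq]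
    have h4 : ε * ‖g₁ - g₂‖ ^ 2 * 1 ≤ ε * ‖g₁ - g₂‖ ^ 2 * (2 * K * ε) := by
      have h5 : ε * ‖g₁ - g₂‖ ^ 2 = ε * ⟪g₁, g₁ - g₂⟫ - ε * ⟪g₂, g₁ - g₂⟫ := by
        rw [← h3]; ring
      have h6 : 2 * K * (ε * ‖g₁ - g₂‖) ^ 2 = ε * ‖g₁ - g₂‖ ^ 2 * (2 * K * ε) := by ring
      linarith
    exact le_of_mul_le_mul_left h4 (by positivity)
  -- The choice ε = 1 shows K > 0, and then ε = 1/(4K) gives 1 ≤ 1/2.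
  have h1 := key 1 one_pos
  have h2 := key (1 / (4 * K)) (by have : 0 < K := by linarith
                                   positivity)
  have : K ≠ 0 := by rintro rfl; linarith
  field_simp at h2
  linarith

lemma hasGradientAt_of_quadratic_bound {f : EuclideanSpace ℝ (Fin d) → ℝ}
    {x g : EuclideanSpace ℝ (Fin d)} {K : ℝ}
    (h : ∀ x', |f x' - f x - ⟪g, x' - x⟫| ≤ K * ‖x' - x‖ ^ 2) : HasGradientAt f g x := by
  rw [hasGradientAt_iff_isLittleO]
  have h1 : (fun x' => f x' - f x - ⟪g, x' - x⟫) =O[𝓝 x] fun x' => ‖x' - x‖ ^ 2 :=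
    Asymptotics.IsBigO.of_bound K (Eventually.of_forall fun x' => by
      simpa using h x')
  refine h1.trans_isLittleO ?_
  have h2 : Tendsto (fun x' => x' - x) (𝓝 x) (𝓝 0) := by
    have : Continuous fun x' => x' - x := by fun_prop
    simpa using this.tendsto x
  have := (Asymptotics.isLittleO_norm_pow_id (E' := EuclideanSpace ℝ (Fin d)) one_lt_two).comp_tendsto h2
  exact this

lemma IsFlow.one_add_pos {u : ℝ → EuclideanSpace ℝ (Fin d) → ℝ} (hu : IsFlow u) {s t : ℝ}
    (hs : s ∈ Ioo (0 : ℝ) 1) (ht : t ∈ Ioo (0 : ℝ) 1) (x : EuclideanSpace ℝ (Fin d)) :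
    0 < 1 + 2 * (t - s) * u s x := by
  rcases lt_trichotomy t s with h | h | h
  · have := one_sub_realCost_pos ht hs h (hu.le s hs x)
    linarith
  · simp [h]
  · exact one_add_realCost_pos hs ht h (hu.ge s hs x)

/-- The product inequality at `x'` and its equality case at `x` turn the quadratic minorant of cos²
into a majorant of `u s`. -/
lemma IsFlow.le_quadratic {u : ℝ → EuclideanSpace ℝ (Fin d) → ℝ} (hu : IsFlow u) {s t : ℝ}
    (hs : s ∈ Ioo (0 : ℝ) 1) (ht : t ∈ Ioo (0 : ℝ) 1) (hts : t < s)
    {x y : EuclideanSpace ℝ (Fin d)} (h : Linked u s t x y) (x' : EuclideanSpace ℝ (Fin d)) :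
    u s x' ≤ u s x +
      ⟪(Real.sinc (2 * dist x y) / ((t - s) * (1 - 2 * (t - s) * u t y))) • (y - x), x' - x⟫ +
      1 / (2 * (s - t) * (1 - 2 * (t - s) * u t y)) * ‖x' - x‖ ^ 2 := by
  have hR : 0 < 1 - 2 * (t - s) * u t y := by
    have := hu.one_add_pos ht hs y
    linarith
  have hst : 0 < s - t := by linarith
  have h1 := hu.cosSq_le t ht s hs hts x' y
  have h2 := cosSq_ge h.1 x'
  rw [← h.2] at h2
  rw [inner_smul_left, ← neg_sub x y, inner_neg_left, ← neg_sub s t] at *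
  simp only [RCLike.conj_to_real]
  generalize 2 * dist x y = θ at *
  generalize ⟪x - y, x' - x⟫ = i at *
  generalize ‖x' - x‖ ^ 2 = n at *
  generalize u s x' = a' at *
  generalize u s x = a at *
  generalize u t y = b at *
  generalize Real.sinc θ = c at *
  set R := 1 - 2 * (-(s - t)) * b with hRdef
  have h3 : (1 + 2 * -(s - t) * a) * R - 2 * c * i - n ≤ (1 - 2 * (s - t) * a') * R := by
    refine h2.trans (h1.trans_eq ?_)
    rw [hRdef]; ring
  have h4 : a + c / (-(s - t) * R) * -i + 1 / (2 * (s - t) * R) * n - a' =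
      ((1 - 2 * (s - t) * a') * R - ((1 + 2 * -(s - t) * a) * R - 2 * c * i - n)) /
        (2 * (s - t) * R) := by
    field_simp; ring
  have h5 : 0 ≤ ((1 - 2 * (s - t) * a') * R - ((1 + 2 * -(s - t) * a) * R - 2 * c * i - n)) /
        (2 * (s - t) * R) := div_nonneg (by linarith) (by positivity)
  linarith

/-- Semiconcavity, obtained from an optimal point at time s/2. The constant is invariant under `s ↦
1 - s`, so the reversed flow has the same one. -/
lemma IsFlow.exists_le_quadratic {u : ℝ → EuclideanSpace ℝ (Fin d) → ℝ} (hu : IsFlow u) {s : ℝ}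
    (hs : s ∈ Ioo (0 : ℝ) 1) (x : EuclideanSpace ℝ (Fin d)) :
    ∃ g, ∀ x', u s x' ≤ u s x + ⟪g, x' - x⟫ + 1 / (s * (1 - s)) * ‖x' - x‖ ^ 2 := by
  have ht : s / 2 ∈ Ioo (0 : ℝ) 1 := ⟨by linarith [hs.1], by linarith [hs.1, hs.2]⟩
  have hts : s / 2 < s := by linarith [hs.1]
  obtain ⟨y, hy, hy'⟩ := hu.exists_eq _ ht s hs hts x
  have hL : Linked u s (s / 2) x y := ⟨hy, by rw [← hy']; ring⟩
  refine ⟨(Real.sinc (2 * dist x y) / ((s / 2 - s) * (1 - 2 * (s / 2 - s) * u (s / 2) y))) •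
    (y - x), fun x' => (hu.le_quadratic hs ht hts hL x').trans ?_⟩
  have h0 := hs.1
  have h1 : 0 < 1 - s := by linarith [hs.2]
  have h2 := hu.ge _ ht y
  have h3 : -1 / (1 - s / 2) ≤ 2 * u (s / 2) y := by
    have : -1 / (1 - s / 2) = 2 * (-1 / (2 * (1 - s / 2))) := by
      have : 1 - s / 2 ≠ 0 := by linarith
      field_simp
    linarith
  have h4 : -1 ≤ u (s / 2) y * 2 * (1 - s / 2) := by
    rw [div_le_iff₀ (by linarith)] at h3
    linarith
  have h5 : 1 - s ≤ 1 - 2 * (s / 2 - s) * u (s / 2) y := by nlinarith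
  gcongr
  linarith

namespace IsPair

variable {u v : ℝ → EuclideanSpace ℝ (Fin d) → ℝ}

lemma swap (h : IsPair u v) : IsPair v u :=
  ⟨h.right, h.left, fun t ht x => by
    have := h.nonneg (1 - t) (one_sub_mem ht) x
    rwa [sub_sub_cancel, add_comm] at this⟩

lemma mem_touch_swap {t : ℝ} {x : EuclideanSpace ℝ (Fin d)} :
    x ∈ touch v u (1 - t) ↔ x ∈ touch u v t := by
  simp only [touch, Set.mem_ofPred_eq, sub_sub_cancel, add_comm]

lemma right_eq {t : ℝ} {x : EuclideanSpace ℝ (Fin d)} (hx : x ∈ touch u v t) :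
    v (1 - t) x = -u t x := by
  have : u t x + v (1 - t) x = 0 := hx
  linarith

lemma linked_swap {s t : ℝ} {x y : EuclideanSpace ℝ (Fin d)} (hx : x ∈ touch u v s)
    (hy : y ∈ touch u v t) : Linked v (1 - s) (1 - t) x y ↔ Linked u s t x y := by
  have e : 1 - t - (1 - s) = -(t - s) := by ring
  unfold Linked
  rw [right_eq hx, right_eq hy, e]
  simp only [mul_neg, neg_mul, neg_neg]

/-- Since `v` agrees with `-u` at `x`, comparing its product inequality with the equality for `u`
gives u_t(y) ≤ -v_{1-t}(y), the reverse of the ordering. -/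
lemma mem_touch_of_linked_of_lt (h : IsPair u v) {s t : ℝ} (hs : s ∈ Ioo (0 : ℝ) 1)
    (ht : t ∈ Ioo (0 : ℝ) 1) (hts : t < s) {x y : EuclideanSpace ℝ (Fin d)}
    (hx : x ∈ touch u v s) (hL : Linked u s t x y) : y ∈ touch u v t := by
  have h1 := h.right.cosSq_le (1 - s) (one_sub_mem hs) (1 - t) (one_sub_mem ht) (by linarith) y x
  rw [right_eq hx, cosSq_comm, ← hL.2] at h1
  have hP := h.left.one_add_pos hs ht x
  have h3 : 1 - t - (1 - s) = s - t := by ring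
  rw [h3] at h1
  have h4 : (1 + 2 * (t - s) * u s x) * (1 - 2 * (t - s) * u t y) ≤
      (1 + 2 * (t - s) * u s x) * (1 - 2 * (s - t) * v (1 - t) y) := by linarith
  have h5 := le_of_mul_le_mul_left h4 hP
  have h6 : 0 < s - t := by linarith
  have h7 : u t y ≤ -v (1 - t) y := by
    refine le_of_mul_le_mul_left (a := 2 * (s - t)) ?_ (by linarith)
    linarith
  refine le_antisymm ?_ (h.nonneg t ht y)
  linarith

/-- The upper paraboloid is the semiconcavity of `u`. The lower one comes from `u ≥ -v`, with
equality at `x`, and the semiconcavity of `v`. Both touch at `x`, so their slopes agree. -/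
lemma exists_quadratic_bound (h : IsPair u v) {s : ℝ} (hs : s ∈ Ioo (0 : ℝ) 1)
    {x : EuclideanSpace ℝ (Fin d)} (hx : x ∈ touch u v s) :
    ∃ g, ∀ x', |u s x' - u s x - ⟪g, x' - x⟫| ≤ 1 / (s * (1 - s)) * ‖x' - x‖ ^ 2 := by
  obtain ⟨g₁, h₁⟩ := h.left.exists_le_quadratic hs x
  obtain ⟨g₂, h₂⟩ := h.right.exists_le_quadratic (one_sub_mem hs) x
  rw [right_eq hx, sub_sub_cancel, mul_comm (1 - s)] at h₂
  have h₃ : ∀ x', u s x + ⟪-g₂, x' - x⟫ - 1 / (s * (1 - s)) * ‖x' - x‖ ^ 2 ≤ u s x' := by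
    intro x'
    have := h₂ x'
    have := h.nonneg s hs x'
    rw [inner_neg_left]
    linarith
  have he := eq_of_quadratic_bounds h₁ h₃
  refine ⟨g₁, fun x' => ?_⟩
  rw [abs_le]
  have a := h₁ x'
  have b := h₃ x'
  rw [← he] at b
  constructor <;> linarith

lemma hasGradientAt (h : IsPair u v) {s : ℝ} (hs : s ∈ Ioo (0 : ℝ) 1)
    {x : EuclideanSpace ℝ (Fin d)} (hx : x ∈ touch u v s) :
    HasGradientAt (u s) (gradient (u s) x) x := by
  obtain ⟨g, hg⟩ := h.exists_quadratic_bound hs hx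
  have := hasGradientAt_of_quadratic_bound hg
  rwa [this.gradient]

lemma quadratic_bound (h : IsPair u v) {s : ℝ} (hs : s ∈ Ioo (0 : ℝ) 1)
    {x : EuclideanSpace ℝ (Fin d)} (hx : x ∈ touch u v s) (x' : EuclideanSpace ℝ (Fin d)) :
    |u s x' - u s x - ⟪gradient (u s) x, x' - x⟫| ≤ 1 / (s * (1 - s)) * ‖x' - x‖ ^ 2 := by
  obtain ⟨g, hg⟩ := h.exists_quadratic_bound hs hx
  rw [(hasGradientAt_of_quadratic_bound hg).gradient]
  exact hg x'

lemma gradient_swap (h : IsPair u v) {s : ℝ} (hs : s ∈ Ioo (0 : ℝ) 1)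
    {x : EuclideanSpace ℝ (Fin d)} (hx : x ∈ touch u v s) :
    gradient (v (1 - s)) x = -gradient (u s) x := by
  obtain ⟨g, hg⟩ := h.left.exists_le_quadratic hs x
  have h1 := h.swap.quadratic_bound (one_sub_mem hs) (mem_touch_swap.mpr hx)
  have h2 := h.quadratic_bound hs hx
  rw [right_eq hx, sub_sub_cancel, mul_comm (1 - s)] at h1
  have : gradient (u s) x = -gradient (v (1 - s)) x := by
    refine eq_of_quadratic_bounds (f := u s) (x := x) (K := 1 / (s * (1 - s)))
      (fun x' => by linarith [(abs_le.mp (h2 x')).2]) fun x' => ?_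
    have := (abs_le.mp (h1 x')).2
    have := h.nonneg s hs x'
    rw [inner_neg_left]
    linarith
  rw [this, neg_neg]

/-- The upper paraboloid built from the optimal point `y` touches `u s` at `x`, so its slope is the
gradient. -/
lemma gradient_eq_of_lt (h : IsPair u v) {s t : ℝ} (hs : s ∈ Ioo (0 : ℝ) 1)
    (ht : t ∈ Ioo (0 : ℝ) 1) (hts : t < s) {x y : EuclideanSpace ℝ (Fin d)}
    (hx : x ∈ touch u v s) (hL : Linked u s t x y) :
    gradient (u s) x =
      (Real.sinc (2 * dist x y) / ((t - s) * (1 - 2 * (t - s) * u t y))) • (y - x) := by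
  symm
  set K₁ := 1 / (2 * (s - t) * (1 - 2 * (t - s) * u t y))
  set K₂ := 1 / (s * (1 - s))
  refine eq_of_quadratic_bounds (f := u s) (x := x) (K := max K₁ K₂) (fun x' => ?_) fun x' => ?_
  · refine (h.left.le_quadratic hs ht hts hL x').trans ?_
    gcongr
    exact le_max_left _ _
  · have h1 := (abs_le.mp (h.quadratic_bound hs hx x')).1
    have h2 : K₂ * ‖x' - x‖ ^ 2 ≤ max K₁ K₂ * ‖x' - x‖ ^ 2 := by
      gcongr; exact le_max_right _ _
    linarith

lemma gradient_eq (h : IsPair u v) {s t : ℝ} (hs : s ∈ Ioo (0 : ℝ) 1)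
    (ht : t ∈ Ioo (0 : ℝ) 1) (hts : t ≠ s) {x y : EuclideanSpace ℝ (Fin d)}
    (hx : x ∈ touch u v s) (hy : y ∈ touch u v t) (hL : Linked u s t x y) :
    gradient (u s) x =
      (Real.sinc (2 * dist x y) / ((t - s) * (1 - 2 * (t - s) * u t y))) • (y - x) := by
  rcases hts.lt_or_gt with hlt | hlt
  · exact h.gradient_eq_of_lt hs ht hlt hx hL
  · have := h.swap.gradient_eq_of_lt (one_sub_mem hs) (one_sub_mem ht) (by linarith)
      (mem_touch_swap.mpr hx) ((linked_swap hx hy).mpr hL)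
    rw [h.gradient_swap hs hx, right_eq hy] at this
    rw [← neg_neg (gradient (u s) x), this, ← neg_smul]
    congr 1
    have e : 1 - t - (1 - s) = -(t - s) := by ring
    rw [e]
    simp only [mul_neg, neg_mul, neg_neg, div_neg]

lemma isClosed_touch (h : IsPair u v) {s : ℝ} (hs : s ∈ Ioo (0 : ℝ) 1) :
    IsClosed (touch u v s) :=
  isClosed_eq ((h.left.continuous s hs).add (h.right.continuous _ (one_sub_mem hs)))
    continuous_const

end IsPair

/-! ### Closed formulas for the optimal curves -/

/-- The square of the dilation factor along the curve starting with the value `z.1` of the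
potential and its gradient `z.2`. -/
def quad (z : ℝ × EuclideanSpace ℝ (Fin d)) (τ : ℝ) : ℝ :=
  (1 + 2 * τ * z.1) ^ 2 + τ ^ 2 * ‖z.2‖ ^ 2

/-- The displacement along the curve with initial data `z`. -/
def travel (z : ℝ × EuclideanSpace ℝ (Fin d)) (τ : ℝ) : EuclideanSpace ℝ (Fin d) :=
  ∫ σ in (0 : ℝ)..τ, (quad z σ)⁻¹ • z.2

@[simp] lemma quad_zero (z : ℝ × EuclideanSpace ℝ (Fin d)) : quad z 0 = 1 := by simp [quad]

@[simp] lemma travel_zero (z : ℝ × EuclideanSpace ℝ (Fin d)) : travel z 0 = 0 := by simp [travel]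

lemma quad_pos {z : ℝ × EuclideanSpace ℝ (Fin d)} {τ : ℝ} (h : 0 < 1 + 2 * τ * z.1) :
    0 < quad z τ := by
  unfold quad; positivity

lemma one_add_pos_of_mem_uIcc {p τ σ : ℝ} (h : 0 < 1 + 2 * τ * p) (hσ : σ ∈ uIcc 0 τ) :
    0 < 1 + 2 * σ * p := by
  rcases Set.mem_uIcc.mp hσ with ⟨h1, h2⟩ | ⟨h1, h2⟩
  · rcases le_total 0 p with hp | hp
    · positivity
    · nlinarith
  · rcases le_total 0 p with hp | hp
    · nlinarith
    · nlinarith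

lemma continuous_quad (z : ℝ × EuclideanSpace ℝ (Fin d)) : Continuous (quad z) := by
  unfold quad; fun_prop

lemma continuousOn_quad_inv {z : ℝ × EuclideanSpace ℝ (Fin d)} {τ : ℝ}
    (h : 0 < 1 + 2 * τ * z.1) : ContinuousOn (fun σ => (quad z σ)⁻¹) (uIcc 0 τ) :=
  (continuous_quad z).continuousOn.inv₀ fun _ hσ => (quad_pos (one_add_pos_of_mem_uIcc h hσ)).ne'

/-- Solves the gradient relation for the displacement `w`. The two relations give tan‖w‖ =
τγ/(1+2τp) with γ the signed length of `g`, and the derivative of arctan(σγ/(1+2σp)) in σ is γ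
divided by `quad`. The integral form also covers g = 0 and can be differentiated in the jet. -/
lemma eq_travel {p τ R : ℝ} {g w : EuclideanSpace ℝ (Fin d)} (hτ : τ ≠ 0)
    (hP : 0 < 1 + 2 * τ * p) (hw : ‖w‖ < Real.pi / 2) (hR : (1 + 2 * τ * p) * R = Real.cos ‖w‖ ^ 2)
    (hg : g = (Real.sinc (2 * ‖w‖) / (τ * R)) • w) :
    w = travel (p, g) τ ∧ R = (1 + 2 * τ * p) / quad (p, g) τ := by
  have hcos : 0 < Real.cos ‖w‖ :=
    Real.cos_pos_of_mem_Ioo ⟨by linarith [norm_nonneg w, Real.pi_pos], hw⟩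
  have hRpos : 0 < R := by
    refine pos_of_mul_pos_right (a := 1 + 2 * τ * p) ?_ hP.le
    rw [hR]; positivity
  have hs : Real.sinc (2 * ‖w‖) * ‖w‖ = Real.sin ‖w‖ * Real.cos ‖w‖ := by
    have := sinc_mul_self (2 * ‖w‖)
    rw [Real.sin_two_mul] at this
    linarith
  -- The component of `g` along `w`; it is nonpositive when τ < 0.
  set γ := Real.sinc (2 * ‖w‖) / (τ * R) * ‖w‖ with hγ
  have hτγ : τ * γ = Real.sin ‖w‖ * Real.cos ‖w‖ / R := by
    rw [hγ, ← hs]; field_simp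
  have hn : ‖g‖ ^ 2 = γ ^ 2 := by
    rw [hg, norm_smul, hγ, mul_pow, mul_pow, Real.norm_eq_abs, sq_abs]
  have hPR : 1 + 2 * τ * p = Real.cos ‖w‖ ^ 2 / R := by
    rw [eq_div_iff hRpos.ne', hR]
  constructor
  · by_cases hw0 : w = 0
    · have : g = 0 := by rw [hg, hw0, smul_zero]
      simp [travel, this, hw0]
    have hint : ∫ σ in (0 : ℝ)..τ, (quad (p, g) σ)⁻¹ * γ = ‖w‖ := by
      have hderiv : ∀ σ ∈ uIcc 0 τ, HasDerivAt
          (fun σ => Real.arctan (σ * γ / (1 + 2 * σ * p))) ((quad (p, g) σ)⁻¹ * γ) σ := by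
        intro σ hσ
        have h0 := one_add_pos_of_mem_uIcc hP hσ
        have h1 : HasDerivAt (fun σ : ℝ => σ * γ) γ σ := by
          simpa using (hasDerivAt_id σ).mul_const γ
        have h2 : HasDerivAt (fun σ : ℝ => 1 + 2 * σ * p) (2 * p) σ := by
          simpa using (((hasDerivAt_id σ).const_mul 2).mul_const p).const_add 1
        have h3 := (h1.div h2 h0.ne').arctan
        refine h3.congr_deriv ?_
        have h4 : quad (p, g) σ = (1 + 2 * σ * p) ^ 2 + (σ * γ) ^ 2 := by
          rw [quad, hn]; ring
        have h5 : 0 < (1 + 2 * σ * p) ^ 2 + (σ * γ) ^ 2 := by positivity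
        rw [h4]
        simp only [Pi.div_apply]
        rw [show γ * (1 + 2 * σ * p) - σ * γ * (2 * p) = γ by ring]
        generalize 1 + 2 * σ * p = D at *
        field_simp
      rw [intervalIntegral.integral_eq_sub_of_hasDerivAt hderiv]
      · have h6 : τ * γ / (1 + 2 * τ * p) = Real.tan ‖w‖ := by
          rw [hτγ, hPR, Real.tan_eq_sin_div_cos]
          field_simp
        rw [h6, Real.arctan_tan (by linarith [norm_nonneg w, Real.pi_pos]) hw]
        simp
      · exact ((continuousOn_quad_inv hP).mul continuousOn_const).intervalIntegrable
    have hw1 : ‖w‖ ≠ 0 := norm_ne_zero_iff.mpr hw0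
    rw [intervalIntegral.integral_mul_const, hγ, ← mul_assoc] at hint
    have h7 := mul_right_cancel₀ hw1 (hint.trans (one_mul _).symm)
    rw [travel, intervalIntegral.integral_smul_const]
    change w = (∫ σ in (0 : ℝ)..τ, (quad (p, g) σ)⁻¹) • g
    calc w = ((∫ σ in (0 : ℝ)..τ, (quad (p, g) σ)⁻¹) *
          (Real.sinc (2 * ‖w‖) / (τ * R))) • w := by rw [h7, one_smul]
      _ = _ := by rw [mul_smul, ← hg]
  · have h4 : quad (p, g) τ = Real.cos ‖w‖ ^ 2 / R ^ 2 := by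
      have : quad (p, g) τ = (1 + 2 * τ * p) ^ 2 + (τ * γ) ^ 2 := by
        rw [quad, hn]; ring
      rw [this, hPR, hτγ]
      have := Real.sin_sq_add_cos_sq ‖w‖
      field_simp
      linear_combination this
    rw [h4, hPR]
    field_simp

/-- The value of the potential and its gradient. -/
def jet (f : EuclideanSpace ℝ (Fin d) → ℝ) (x : EuclideanSpace ℝ (Fin d)) :
    ℝ × EuclideanSpace ℝ (Fin d) :=
  (f x, gradient f x)

/-- The explicit formula for the transport map of a pair. -/
def trans (u : ℝ → EuclideanSpace ℝ (Fin d) → ℝ) (s t : ℝ) (x : EuclideanSpace ℝ (Fin d)) :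
    EuclideanSpace ℝ (Fin d) :=
  x + travel (jet (u s) x) (t - s)

@[simp] lemma trans_self (u : ℝ → EuclideanSpace ℝ (Fin d) → ℝ) (s : ℝ)
    (x : EuclideanSpace ℝ (Fin d)) : trans u s s x = x := by simp [trans]

lemma Linked.refl (u : ℝ → EuclideanSpace ℝ (Fin d) → ℝ) (s : ℝ) (x : EuclideanSpace ℝ (Fin d)) :
    Linked u s s x x := ⟨by simp [Real.pi_pos], by simp [cosSq_self]⟩

namespace IsPair

variable {u v : ℝ → EuclideanSpace ℝ (Fin d) → ℝ} {s t : ℝ} {x y : EuclideanSpace ℝ (Fin d)}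

lemma exists_linked (h : IsPair u v) (hs : s ∈ Ioo (0 : ℝ) 1) (ht : t ∈ Ioo (0 : ℝ) 1)
    (hx : x ∈ touch u v s) : ∃ y ∈ touch u v t, Linked u s t x y := by
  have key : ∀ {u v : ℝ → EuclideanSpace ℝ (Fin d) → ℝ} {s t : ℝ}, IsPair u v →
      s ∈ Ioo (0 : ℝ) 1 → t ∈ Ioo (0 : ℝ) 1 → x ∈ touch u v s → t < s →
      ∃ y ∈ touch u v t, Linked u s t x y := by
    intro u v s t h hs ht hx hts
    obtain ⟨y, hy, hy'⟩ := h.left.exists_eq t ht s hs hts x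
    have hL : Linked u s t x y := ⟨hy, by rw [← hy']; ring⟩
    exact ⟨y, h.mem_touch_of_linked_of_lt hs ht hts hx hL, hL⟩
  rcases lt_trichotomy t s with hts | rfl | hts
  · exact key h hs ht hx hts
  · exact ⟨x, hx, Linked.refl u t x⟩
  · obtain ⟨y, hy, hL⟩ := key h.swap (one_sub_mem hs) (one_sub_mem ht) (mem_touch_swap.mpr hx)
      (by linarith)
    have hy' := mem_touch_swap.mp hy
    exact ⟨y, hy', (linked_swap hx hy').mp hL⟩

/-- Determines a linked contact point from the jet at `x` alone; this is the source of uniqueness.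
-/
lemma linked_aux (h : IsPair u v) (hs : s ∈ Ioo (0 : ℝ) 1) (ht : t ∈ Ioo (0 : ℝ) 1) (hne : t ≠ s)
    (hx : x ∈ touch u v s) (hy : y ∈ touch u v t) (hL : Linked u s t x y) :
    y - x = travel (jet (u s) x) (t - s) ∧
      1 - 2 * (t - s) * u t y = (1 + 2 * (t - s) * u s x) / quad (jet (u s) x) (t - s) := by
  have hg := h.gradient_eq hs ht hne hx hy hL
  have hc := hL.2
  rw [cosSq_of_lt hL.1] at hc
  have hd : dist x y = ‖y - x‖ := by rw [dist_comm, dist_eq_norm]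
  have hlt := hL.1
  rw [hd] at hg hc hlt
  exact eq_travel (sub_ne_zero.mpr hne) (h.left.one_add_pos hs ht x) hlt hc hg

lemma eq_trans (h : IsPair u v) (hs : s ∈ Ioo (0 : ℝ) 1) (ht : t ∈ Ioo (0 : ℝ) 1) (hne : t ≠ s)
    (hx : x ∈ touch u v s) (hy : y ∈ touch u v t) (hL : Linked u s t x y) :
    y = trans u s t x := by
  rw [trans, ← (h.linked_aux hs ht hne hx hy hL).1]; abel

/-- Some contact point is linked to `x`, and any such point equals `trans u s t x`. -/
lemma trans_spec (h : IsPair u v) (hs : s ∈ Ioo (0 : ℝ) 1) (ht : t ∈ Ioo (0 : ℝ) 1)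
    (hx : x ∈ touch u v s) : trans u s t x ∈ touch u v t ∧ Linked u s t x (trans u s t x) := by
  by_cases hne : t = s
  · subst hne
    rw [trans_self]
    exact ⟨hx, Linked.refl u t x⟩
  obtain ⟨y, hy, hL⟩ := h.exists_linked hs ht hx
  rw [← h.eq_trans hs ht hne hx hy hL]
  exact ⟨hy, hL⟩

lemma trans_mem (h : IsPair u v) (hs : s ∈ Ioo (0 : ℝ) 1) (ht : t ∈ Ioo (0 : ℝ) 1)
    (hx : x ∈ touch u v s) : trans u s t x ∈ touch u v t :=
  (h.trans_spec hs ht hx).1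

lemma trans_trans (h : IsPair u v) (hs : s ∈ Ioo (0 : ℝ) 1) (ht : t ∈ Ioo (0 : ℝ) 1)
    (hx : x ∈ touch u v s) : trans u t s (trans u s t x) = x := by
  by_cases hne : t = s
  · subst hne; simp
  obtain ⟨hy, hL⟩ := h.trans_spec hs ht hx
  exact (h.eq_trans ht hs (Ne.symm hne) hy hx hL.symm).symm

lemma quad_jet_pos (h : IsPair u v) (hs : s ∈ Ioo (0 : ℝ) 1) (ht : t ∈ Ioo (0 : ℝ) 1)
    (x : EuclideanSpace ℝ (Fin d)) : 0 < quad (jet (u s) x) (t - s) :=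
  quad_pos (h.left.one_add_pos hs ht x)

lemma one_sub_trans (h : IsPair u v) (hs : s ∈ Ioo (0 : ℝ) 1) (ht : t ∈ Ioo (0 : ℝ) 1)
    (hx : x ∈ touch u v s) : 1 - 2 * (t - s) * u t (trans u s t x) =
      (1 + 2 * (t - s) * u s x) / quad (jet (u s) x) (t - s) := by
  by_cases hne : t = s
  · subst hne; simp
  obtain ⟨hy, hL⟩ := h.trans_spec hs ht hx
  exact (h.linked_aux hs ht hne hx hy hL).2

lemma apply_trans (h : IsPair u v) (hs : s ∈ Ioo (0 : ℝ) 1) (ht : t ∈ Ioo (0 : ℝ) 1)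
    (hx : x ∈ touch u v s) : u t (trans u s t x) =
      (2 * u s x * (1 + 2 * (t - s) * u s x) + (t - s) * ‖gradient (u s) x‖ ^ 2) /
        (2 * quad (jet (u s) x) (t - s)) := by
  by_cases hne : t = s
  · subst hne; simp
  have h1 := h.one_sub_trans hs ht hx
  have hq := h.quad_jet_pos hs ht x
  have hne' := sub_ne_zero.mpr hne
  rw [eq_div_iff hq.ne'] at h1
  rw [eq_div_iff (by positivity)]
  refine mul_left_cancel₀ hne' ?_
  have h2 : quad (jet (u s) x) (t - s) = (1 + 2 * (t - s) * u s x) ^ 2 +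
    (t - s) ^ 2 * ‖gradient (u s) x‖ ^ 2 := rfl
  rw [h2] at h1 ⊢
  linear_combination -h1

/-- A linked pair can be read from either end, so `gradient_eq` gives both gradients as multiples of
the same displacement; `one_sub_trans` yields the ratio. -/
lemma gradient_trans (h : IsPair u v) (hs : s ∈ Ioo (0 : ℝ) 1) (ht : t ∈ Ioo (0 : ℝ) 1)
    (hx : x ∈ touch u v s) : gradient (u t) (trans u s t x) =
      (quad (jet (u s) x) (t - s))⁻¹ • gradient (u s) x := by
  by_cases hne : t = s
  · subst hne; simp
  obtain ⟨hy, hL⟩ := h.trans_spec hs ht hx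
  have h1 := h.one_sub_trans hs ht hx
  have hq := h.quad_jet_pos hs ht x
  have hP := h.left.one_add_pos hs ht x
  have hne' := sub_ne_zero.mpr hne
  have hne'' := sub_ne_zero.mpr (Ne.symm hne)
  rw [h.gradient_eq ht hs (Ne.symm hne) hy hx hL.symm, h.gradient_eq hs ht hne hx hy hL, h1,
    smul_smul, ← neg_sub (trans u s t x) x, smul_neg, ← neg_smul, dist_comm,
    show 1 - 2 * (s - t) * u s x = 1 + 2 * (t - s) * u s x by ring, ← neg_sub t s]
  congr 1
  field_simp

end IsPair

/-! ### Derivatives of the closed formulas in time and in the jet -/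

/-- The derivative of `quad z` in time. -/
def quadDot (z : ℝ × EuclideanSpace ℝ (Fin d)) (τ : ℝ) : ℝ :=
  2 * (2 * z.1 * (1 + 2 * τ * z.1) + τ * ‖z.2‖ ^ 2)

/-- The differential of `quad · τ`. -/
def quadDeriv (z : ℝ × EuclideanSpace ℝ (Fin d)) (τ : ℝ) :
    (ℝ × EuclideanSpace ℝ (Fin d)) →L[ℝ] ℝ :=
  (4 * τ * (1 + 2 * τ * z.1)) • ContinuousLinearMap.fst ℝ ℝ (EuclideanSpace ℝ (Fin d)) +
    (2 * τ ^ 2) • (innerSL ℝ z.2).comp (ContinuousLinearMap.snd ℝ ℝ (EuclideanSpace ℝ (Fin d)))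

/-- The mixed derivative of `quad`. -/
def quadDerivDot (z : ℝ × EuclideanSpace ℝ (Fin d)) (τ : ℝ) :
    (ℝ × EuclideanSpace ℝ (Fin d)) →L[ℝ] ℝ :=
  (4 + 16 * τ * z.1) • ContinuousLinearMap.fst ℝ ℝ (EuclideanSpace ℝ (Fin d)) +
    (4 * τ) • (innerSL ℝ z.2).comp (ContinuousLinearMap.snd ℝ ℝ (EuclideanSpace ℝ (Fin d)))

/-- The differential of the velocity `z ↦ (quad z τ)⁻¹ • z.2`. -/
def velocityDeriv (z : ℝ × EuclideanSpace ℝ (Fin d)) (τ : ℝ) :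
    (ℝ × EuclideanSpace ℝ (Fin d)) →L[ℝ] EuclideanSpace ℝ (Fin d) :=
  (quad z τ)⁻¹ • ContinuousLinearMap.snd ℝ ℝ (EuclideanSpace ℝ (Fin d)) -
    (quad z τ ^ 2)⁻¹ • (quadDeriv z τ).smulRight z.2

lemma hasDerivAt_quad (z : ℝ × EuclideanSpace ℝ (Fin d)) (τ : ℝ) :
    HasDerivAt (quad z) (quadDot z τ) τ := by
  have h2 : HasDerivAt (fun σ : ℝ => 1 + 2 * σ * z.1) (2 * z.1) τ := by
    simpa using (((hasDerivAt_id τ).const_mul 2).mul_const z.1).const_add 1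
  have h3 := (h2.pow 2).add (((hasDerivAt_id τ).pow 2).mul_const (‖z.2‖ ^ 2))
  refine HasDerivAt.congr_deriv h3 ?_
  unfold quadDot
  simp
  ring

lemma hasFDerivAt_quad (z : ℝ × EuclideanSpace ℝ (Fin d)) (τ : ℝ) :
    HasFDerivAt (fun z => quad z τ) (quadDeriv z τ) z := by
  have h1 : HasFDerivAt (fun z : ℝ × EuclideanSpace ℝ (Fin d) => 1 + 2 * τ * z.1)
      ((2 * τ) • ContinuousLinearMap.fst ℝ ℝ (EuclideanSpace ℝ (Fin d))) z :=
    (hasFDerivAt_fst.const_mul (2 * τ)).const_add 1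
  have h2 := (h1.pow 2).add
    ((hasFDerivAt_snd (𝕜 := ℝ) (E := ℝ) (F := EuclideanSpace ℝ (Fin d)) (p := z)).norm_sq.const_mul
      (τ ^ 2))
  refine HasFDerivAt.congr_fderiv h2 ?_
  ext w <;> simp [quadDeriv] <;> ring

lemma hasFDerivAt_velocity {z : ℝ × EuclideanSpace ℝ (Fin d)} {τ : ℝ} (h : quad z τ ≠ 0) :
    HasFDerivAt (fun z => (quad z τ)⁻¹ • z.2) (velocityDeriv z τ) z := by
  have h1 : HasFDerivAt (fun z => (quad z τ)⁻¹) (-(quad z τ ^ 2)⁻¹ • quadDeriv z τ) z :=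
    (hasDerivAt_inv h).comp_hasFDerivAt z (hasFDerivAt_quad z τ)
  refine (h1.smul hasFDerivAt_snd).congr_fderiv ?_
  ext w <;> simp [velocityDeriv, mul_smul]
  ring

lemma continuousOn_velocityDeriv :
    ContinuousOn (fun w : (ℝ × EuclideanSpace ℝ (Fin d)) × ℝ => velocityDeriv w.1 w.2)
      {w | quad w.1 w.2 ≠ 0} := by
  rw [continuousOn_clm_apply]
  intro w
  have hq : Continuous fun w : (ℝ × EuclideanSpace ℝ (Fin d)) × ℝ => quad w.1 w.2 := by
    unfold quad; fun_prop
  simp only [velocityDeriv, quadDeriv, sub_apply,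
    smul_apply, ContinuousLinearMap.smulRight_apply,
    add_apply, ContinuousLinearMap.comp_apply, innerSL_apply_apply,
    ContinuousLinearMap.coe_fst', ContinuousLinearMap.coe_snd', smul_eq_mul]
  refine ContinuousOn.sub (ContinuousOn.smul (hq.continuousOn.inv₀ fun _ h => h)
    continuousOn_const) (ContinuousOn.smul ((hq.pow 2).continuousOn.inv₀ fun _ h =>
      pow_ne_zero 2 h) ?_)
  exact Continuous.continuousOn (by fun_prop)

lemma isOpen_times (p : ℝ) : IsOpen {σ : ℝ | 0 < 1 + 2 * σ * p} :=
  isOpen_lt continuous_const (by fun_prop)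

lemma hasDerivAt_integral_of_continuousOn {G : Type*} [NormedAddCommGroup G] [NormedSpace ℝ G]
    [CompleteSpace G] {f : ℝ → G} {p τ : ℝ} (h : 0 < 1 + 2 * τ * p)
    (hf : ContinuousOn f {σ : ℝ | 0 < 1 + 2 * σ * p}) :
    HasDerivAt (fun τ => ∫ σ in (0 : ℝ)..τ, f σ) (f τ) τ := by
  refine intervalIntegral.integral_hasDerivAt_right
    (hf.mono fun σ hσ => one_add_pos_of_mem_uIcc h hσ).intervalIntegrable
    (hf.stronglyMeasurableAtFilter (isOpen_times p) τ h)
    (hf.continuousAt ((isOpen_times p).mem_nhds h))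

lemma hasDerivAt_travel {z : ℝ × EuclideanSpace ℝ (Fin d)} {τ : ℝ} (h : 0 < 1 + 2 * τ * z.1) :
    HasDerivAt (travel z) ((quad z τ)⁻¹ • z.2) τ :=
  hasDerivAt_integral_of_continuousOn (f := fun σ => (quad z σ)⁻¹ • z.2) h
    (ContinuousOn.smul ((continuous_quad z).continuousOn.inv₀ fun _ hσ => (quad_pos hσ).ne')
      continuousOn_const)

lemma continuousOn_velocityDeriv_time (z : ℝ × EuclideanSpace ℝ (Fin d)) :
    ContinuousOn (velocityDeriv z) {σ : ℝ | 0 < 1 + 2 * σ * z.1} :=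
  continuousOn_velocityDeriv.comp (f := fun σ => (z, σ)) (by fun_prop)
    fun _ hσ => (quad_pos hσ).ne'

lemma hasDerivAt_integral_velocityDeriv {z : ℝ × EuclideanSpace ℝ (Fin d)} {τ : ℝ}
    (h : 0 < 1 + 2 * τ * z.1) :
    HasDerivAt (fun τ => ∫ σ in (0 : ℝ)..τ, velocityDeriv z σ) (velocityDeriv z τ) τ :=
  hasDerivAt_integral_of_continuousOn h (continuousOn_velocityDeriv_time z)

lemma exists_velocityDeriv_bound {K : Set (ℝ × EuclideanSpace ℝ (Fin d))} (hK : IsCompact K)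
    {a b : ℝ} (h : ∀ z ∈ K, ∀ σ ∈ Icc a b, 0 < 1 + 2 * σ * z.1) :
    ∃ C, 0 ≤ C ∧ ∀ z ∈ K, ∀ σ ∈ Icc a b, ‖velocityDeriv z σ‖ ≤ C := by
  have h1 := (hK.prod (isCompact_Icc (a := a) (b := b))).exists_bound_of_continuousOn
    (continuousOn_velocityDeriv.mono (fun w hw => (quad_pos (h w.1 hw.1 w.2 hw.2)).ne'))
  obtain ⟨C, hC⟩ := h1
  exact ⟨max C 0, le_max_right _ _, fun z hz σ hσ => (hC (z, σ) ⟨hz, hσ⟩).trans (le_max_left _ _)⟩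

/-- Differentiation under the integral. Positivity of 1+2τp persists on a closed ball of jets and,
being affine in time with value 1 at 0, for all intermediate times. Compactness then bounds the
integrand's differential. -/
lemma hasFDerivAt_travel {z : ℝ × EuclideanSpace ℝ (Fin d)} {τ : ℝ} (h : 0 < 1 + 2 * τ * z.1) :
    HasFDerivAt (fun z => travel z τ) (∫ σ in (0 : ℝ)..τ, velocityDeriv z σ) z := by
  have hopen : IsOpen {z : ℝ × EuclideanSpace ℝ (Fin d) | 0 < 1 + 2 * τ * z.1} :=
    isOpen_lt continuous_const (by fun_prop)
  obtain ⟨ε, hε, hball⟩ := Metric.nhds_basis_closedBall.mem_iff.mp (hopen.mem_nhds h)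
  have hpos : ∀ z' ∈ Metric.closedBall z ε, ∀ σ ∈ uIcc 0 τ, 0 < 1 + 2 * σ * z'.1 :=
    fun z' hz' σ hσ => one_add_pos_of_mem_uIcc (hball hz') hσ
  obtain ⟨C, -, hC⟩ := exists_velocityDeriv_bound (isCompact_closedBall z ε) hpos
  have hcont : ∀ z' ∈ Metric.closedBall z ε,
      ContinuousOn (fun σ => (quad z' σ)⁻¹ • z'.2) (uIcc 0 τ) := fun z' hz' =>
    (continuousOn_quad_inv (hball hz')).smul continuousOn_const
  refine intervalIntegral.hasFDerivAt_integral_of_dominated_of_fderiv_le (bound := fun _ => C)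
    (Metric.closedBall_mem_nhds z hε) ?_ (hcont z (Metric.mem_closedBall_self hε.le)).intervalIntegrable
    ?_ ?_ intervalIntegrable_const ?_
  · filter_upwards [Metric.closedBall_mem_nhds z hε] with z' hz'
    exact ((hcont z' hz').mono uIoc_subset_uIcc).aestronglyMeasurable measurableSet_uIoc
  · exact ((continuousOn_velocityDeriv_time z).mono fun σ hσ =>
      one_add_pos_of_mem_uIcc h (uIoc_subset_uIcc hσ)).aestronglyMeasurable measurableSet_uIoc
  · exact Eventually.of_forall fun σ hσ z' hz' => hC z' hz' σ (uIoc_subset_uIcc hσ)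
  · exact Eventually.of_forall fun σ hσ z' hz' =>
      hasFDerivAt_velocity (quad_pos (hpos z' hz' σ (uIoc_subset_uIcc hσ))).ne'

lemma hasDerivAt_velocity {z : ℝ × EuclideanSpace ℝ (Fin d)} {τ : ℝ} (h : quad z τ ≠ 0) :
    HasDerivAt (fun τ => (quad z τ)⁻¹ • z.2) (-(quadDot z τ / quad z τ ^ 2) • z.2) τ := by
  refine (((hasDerivAt_quad z τ).inv h).smul_const z.2).congr_deriv ?_
  rw [neg_div]

lemma hasDerivAt_quadDeriv (z : ℝ × EuclideanSpace ℝ (Fin d)) (τ : ℝ) :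
    HasDerivAt (quadDeriv z) (quadDerivDot z τ) τ := by
  have h1 : HasDerivAt (fun τ : ℝ => 4 * τ * (1 + 2 * τ * z.1)) (4 + 16 * τ * z.1) τ := by
    have h2 : HasDerivAt (fun σ : ℝ => 1 + 2 * σ * z.1) (2 * z.1) τ := by
      simpa using (((hasDerivAt_id τ).const_mul 2).mul_const z.1).const_add 1
    refine (((hasDerivAt_id τ).const_mul 4).mul h2).congr_deriv ?_
    simp; ring
  have h3 : HasDerivAt (fun τ : ℝ => 2 * τ ^ 2) (4 * τ) τ := by
    refine (((hasDerivAt_id τ).pow 2).const_mul 2).congr_deriv ?_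
    simp; ring
  exact (h1.smul_const _).add (h3.smul_const
    ((innerSL ℝ z.2).comp (ContinuousLinearMap.snd ℝ ℝ (EuclideanSpace ℝ (Fin d)))))

lemma hasDerivAt_velocityDeriv {z : ℝ × EuclideanSpace ℝ (Fin d)} {τ : ℝ} (h : quad z τ ≠ 0) :
    HasDerivAt (velocityDeriv z)
      (-(quadDot z τ / quad z τ ^ 2) • ContinuousLinearMap.snd ℝ ℝ (EuclideanSpace ℝ (Fin d)) +
        ((2 * quadDot z τ / quad z τ ^ 3) • (quadDeriv z τ).smulRight z.2 -
        (quad z τ ^ 2)⁻¹ • (quadDerivDot z τ).smulRight z.2)) τ := by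
  have h1 := ((hasDerivAt_quad z τ).inv h).smul_const
    (ContinuousLinearMap.snd ℝ ℝ (EuclideanSpace ℝ (Fin d)))
  have h2 := (((hasDerivAt_quad z τ).pow 2).inv (pow_ne_zero 2 h))
  have h3 : HasDerivAt (fun τ => (quadDeriv z τ).smulRight z.2)
      ((quadDerivDot z τ).smulRight z.2) τ :=
    (((ContinuousLinearMap.smulRightL ℝ (ℝ × EuclideanSpace ℝ (Fin d))
      (EuclideanSpace ℝ (Fin d))).flip z.2).hasFDerivAt (x := quadDeriv z τ)).comp_hasDerivAt τ
      (hasDerivAt_quadDeriv z τ)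
  refine (h1.sub (h2.smul h3)).congr_deriv ?_
  simp only [Pi.inv_apply, Pi.pow_apply]
  rw [sub_eq_add_neg, neg_add, neg_div, ← neg_smul, ← neg_smul, add_comm (_ • _) (_ • _)]
  have e : -(-((2 : ℕ) * quad z τ ^ (2 - 1) * quadDot z τ) / (quad z τ ^ 2) ^ 2) =
      2 * quadDot z τ / quad z τ ^ 3 := by
    norm_num
    field_simp
  rw [e, neg_smul (quad z τ ^ 2)⁻¹, ← sub_eq_add_neg]

lemma hasDerivAt_sqrt_quad {z : ℝ × EuclideanSpace ℝ (Fin d)} {τ : ℝ} (h : 0 < quad z τ) :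
    HasDerivAt (fun τ => √(quad z τ)) (quadDot z τ / (2 * √(quad z τ))) τ :=
  (hasDerivAt_quad z τ).sqrt h.ne'

lemma hasDerivAt_deriv_sqrt_quad {z : ℝ × EuclideanSpace ℝ (Fin d)} {τ : ℝ} (h : 0 < quad z τ) :
    HasDerivAt (fun τ => quadDot z τ / (2 * √(quad z τ)))
      (‖z.2‖ ^ 2 / (quad z τ ^ 2) * √(quad z τ)) τ := by
  have h1 : HasDerivAt (quadDot z) (2 * (4 * z.1 ^ 2 + ‖z.2‖ ^ 2)) τ := by
    have h2 : HasDerivAt (fun σ : ℝ => 1 + 2 * σ * z.1) (2 * z.1) τ := by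
      simpa using (((hasDerivAt_id τ).const_mul 2).mul_const z.1).const_add 1
    refine (((h2.const_mul (2 * z.1)).add
      ((hasDerivAt_id τ).mul_const (‖z.2‖ ^ 2))).const_mul 2).congr_deriv ?_
    ring
  have hs : 0 < √(quad z τ) := Real.sqrt_pos.mpr h
  refine (h1.div ((hasDerivAt_sqrt_quad h).const_mul 2) (by positivity)).congr_deriv ?_
  have h3 := Real.sq_sqrt h.le
  have h4 : quad z τ = (1 + 2 * τ * z.1) ^ 2 + τ ^ 2 * ‖z.2‖ ^ 2 := rfl
  have h5 : quadDot z τ = 2 * (2 * z.1 * (1 + 2 * τ * z.1) + τ * ‖z.2‖ ^ 2) := rfl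
  -- Since `quad z` is a quadratic polynomial with leading coefficient 4p² + ‖g‖², this is the
  -- constancy of its discriminant -4‖g‖².
  have h6 : 4 * (4 * z.1 ^ 2 + ‖z.2‖ ^ 2) * quad z τ - quadDot z τ ^ 2 = 4 * ‖z.2‖ ^ 2 := by
    rw [h4, h5]; ring
  generalize quadDot z τ = b at *
  generalize √(quad z τ) = r at *
  rw [← h3] at h6 ⊢
  field_simp
  linear_combination h6

/-! ### Differentiation along a set at its density points -/

lemma IsDensityPoint.eventually_nonempty {S : Set (EuclideanSpace ℝ (Fin d))}
    {z : EuclideanSpace ℝ (Fin d)} (h : IsDensityPoint S z) (w : EuclideanSpace ℝ (Fin d)) {ε : ℝ}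
    (hε : 0 < ε) : ∀ᶠ r in 𝓝[>] (0 : ℝ), ∃ a ∈ S, dist a (z + r • w) ≤ ε * r := by
  have hball : ∀ r : ℝ, 0 < r → Metric.closedBall z r =ᵐ[volume] Metric.ball z r := by
    intro r hr
    rw [ae_eq_set, Metric.closedBall_sdiff_ball]
    refine ⟨Measure.addHaar_sphere_of_ne_zero volume z hr.ne', ?_⟩
    rw [sdiff_eq_empty.mpr Metric.ball_subset_closedBall, measure_empty]
  have h1 : Tendsto (fun r => volume (S ∩ Metric.closedBall z r) / volume (Metric.closedBall z r))
      (𝓝[>] 0) (𝓝 1) := by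
    refine Tendsto.congr' ?_ h
    filter_upwards [self_mem_nhdsWithin] with r hr
    rw [measure_congr (hball r hr), measure_congr (ae_eq_set_inter (ae_eq_refl S) (hball r hr))]
  have h2 := Measure.eventually_nonempty_inter_smul_of_density_one volume S z h1
    (Metric.closedBall w ε) Metric.isClosed_closedBall.measurableSet
    (Metric.measure_closedBall_pos volume w hε).ne'
  filter_upwards [h2, self_mem_nhdsWithin] with r hr hr0
  obtain ⟨a, haS, ha⟩ := hr
  refine ⟨a, haS, ?_⟩
  rw [singleton_add] at ha
  obtain ⟨b, hb, rfl⟩ := ha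
  obtain ⟨c, hc, rfl⟩ := hb
  simp only
  rw [dist_add_left, dist_smul₀, Real.norm_of_nonneg (le_of_lt hr0), mul_comm]
  exact mul_le_mul_of_nonneg_right hc (le_of_lt hr0)

lemma IsDensityPoint.mem {S : Set (EuclideanSpace ℝ (Fin d))} {z : EuclideanSpace ℝ (Fin d)}
    (h : IsDensityPoint S z) (hS : IsClosed S) : z ∈ S := by
  rw [← hS.closure_eq, Metric.mem_closure_iff]
  intro ε hε
  obtain ⟨r, ⟨a, haS, ha⟩, hr0, hr⟩ := ((h.eventually_nonempty 0 one_pos).and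
    (Ioo_mem_nhdsGT hε)).exists
  refine ⟨a, haS, ?_⟩
  rw [smul_zero, add_zero, one_mul, dist_comm] at ha
  exact ha.trans_lt hr

/-- The increments lead to points of `S` nearest to z + r w; by density their distance to z + r w is
o(r). Thus every direction is tangent to `S` at `z`. -/
lemma IsDensityPoint.exists_tendsto {S : Set (EuclideanSpace ℝ (Fin d))}
    {z : EuclideanSpace ℝ (Fin d)} (h : IsDensityPoint S z) (hS : IsClosed S)
    (w : EuclideanSpace ℝ (Fin d)) :
    ∃ a : ℝ → EuclideanSpace ℝ (Fin d), (∀ r, z + a r ∈ S) ∧ Tendsto a (𝓝[>] 0) (𝓝 0) ∧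
      Tendsto (fun r => r⁻¹ • a r) (𝓝[>] 0) (𝓝 w) := by
  have hne : S.Nonempty := ⟨z, h.mem hS⟩
  choose b hbS hb using fun r : ℝ => hS.exists_infDist_eq_dist hne (z + r • w)
  have hlim : Tendsto (fun r => r⁻¹ • (b r - z)) (𝓝[>] 0) (𝓝 w) := by
    rw [Metric.tendsto_nhds]
    intro ε hε
    filter_upwards [h.eventually_nonempty w (half_pos hε), self_mem_nhdsWithin] with r hr hr0
    obtain ⟨a, haS, ha⟩ := hr
    have hr0' : (0 : ℝ) < r := hr0
    have h1 : dist (b r) (z + r • w) ≤ ε / 2 * r := by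
      rw [dist_comm, ← hb r]
      refine (Metric.infDist_le_dist_of_mem haS).trans ?_
      rwa [dist_comm]
    have h2 : r⁻¹ • (b r - z) - w = r⁻¹ • (b r - (z + r • w)) := by
      rw [← sub_sub, smul_sub _ _ (r • w), inv_smul_smul₀ hr0'.ne']
    rw [dist_eq_norm, h2, norm_smul, ← dist_eq_norm, norm_inv, Real.norm_of_nonneg hr0'.le,
      inv_mul_lt_iff₀ hr0']
    nlinarith
  refine ⟨fun r => b r - z, fun r => by simpa using hbS r, ?_, hlim⟩
  have h3 : Tendsto (fun r : ℝ => r) (𝓝[>] 0) (𝓝 0) := tendsto_id.mono_left nhdsWithin_le_nhds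
  have h4 := h3.smul hlim
  rw [zero_smul] at h4
  refine h4.congr' ?_
  filter_upwards [self_mem_nhdsWithin] with r hr
  exact smul_inv_smul₀ (ne_of_gt hr) _

lemma IsDensityPoint.uniqueDiffWithinAt {S : Set (EuclideanSpace ℝ (Fin d))}
    {z : EuclideanSpace ℝ (Fin d)} (h : IsDensityPoint S z) (hS : IsClosed S) :
    UniqueDiffWithinAt ℝ S z := by
  refine ⟨?_, subset_closure (h.mem hS)⟩
  have : tangentConeAt ℝ S z = univ := by
    refine eq_univ_of_forall fun w => ?_
    obtain ⟨a, haS, ha0, ha⟩ := h.exists_tendsto hS w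
    exact mem_tangentConeAt_of_seq (𝓝[>] 0) (fun r => r⁻¹) a ha0 (Eventually.of_forall haS) ha
  rw [this, Submodule.span_univ]
  exact dense_univ

/-- A map that is bounded below along a set is bounded below by its differential at a density
point. -/
lemma IsDensityPoint.le_norm_apply {S : Set (EuclideanSpace ℝ (Fin d))}
    {z : EuclideanSpace ℝ (Fin d)} (h : IsDensityPoint S z) (hS : IsClosed S)
    {F : EuclideanSpace ℝ (Fin d) → EuclideanSpace ℝ (Fin d)}
    {A : EuclideanSpace ℝ (Fin d) →L[ℝ] EuclideanSpace ℝ (Fin d)}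
    (hF : HasFDerivWithinAt F A S z) {L : ℝ} (hL : ∀ x ∈ S, ‖x - z‖ ≤ L * ‖F x - F z‖)
    (w : EuclideanSpace ℝ (Fin d)) : ‖w‖ ≤ L * ‖A w‖ := by
  obtain ⟨a, haS, ha0, ha⟩ := h.exists_tendsto hS w
  have h1 := hF.lim ha0 (Eventually.of_forall haS) ha
  refine le_of_tendsto_of_tendsto' ha.norm (h1.norm.const_mul L) fun r => ?_
  rw [norm_smul, norm_smul, mul_left_comm]
  have := hL _ (haS r)
  rw [add_sub_cancel_left] at this
  gcongr

/-- The differential of a gradient along a set is symmetric at density points, if the function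
has uniform quadratic bounds along the set. -/
lemma IsDensityPoint.inner_symm {S : Set (EuclideanSpace ℝ (Fin d))}
    {z : EuclideanSpace ℝ (Fin d)} (h : IsDensityPoint S z) (hS : IsClosed S)
    {f : EuclideanSpace ℝ (Fin d) → ℝ} {G : EuclideanSpace ℝ (Fin d) → EuclideanSpace ℝ (Fin d)}
    {K : ℝ} (hf : ∀ x ∈ S, ∀ x', |f x' - f x - ⟪G x, x' - x⟫| ≤ K * ‖x' - x‖ ^ 2)
    {H : EuclideanSpace ℝ (Fin d) →L[ℝ] EuclideanSpace ℝ (Fin d)}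
    (hG : HasFDerivWithinAt G H S z) (v w : EuclideanSpace ℝ (Fin d)) : ⟪H v, w⟫ = ⟪H w, v⟫ := by
  have hz := h.mem hS
  -- Second-order difference quotients of `f` at `z`. A limit `F` along an ultrafilter exists for
  -- all directions at once, without extracting subsequences.
  let φ : ℝ → EuclideanSpace ℝ (Fin d) → ℝ := fun r w =>
    (f (z + r • w) - f z - r * ⟪G z, w⟫) / r ^ 2
  let U : Ultrafilter ℝ := Ultrafilter.of (𝓝[>] (0 : ℝ))
  have hU : (U : Filter ℝ) ≤ 𝓝[>] 0 := Ultrafilter.of_le _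
  have hUpos : ∀ᶠ r in (U : Filter ℝ), 0 < r := hU self_mem_nhdsWithin
  have hlim : ∀ w, ∃ l, Tendsto (fun r => φ r w) U (𝓝 l) := by
    intro w
    have hb : ∀ᶠ r in (U : Filter ℝ), φ r w ∈ Icc (-(K * ‖w‖ ^ 2)) (K * ‖w‖ ^ 2) := by
      filter_upwards [hUpos] with r hr
      rw [mem_Icc, ← abs_le]
      have := hf z hz (z + r • w)
      rw [add_sub_cancel_left, inner_smul_right, norm_smul, Real.norm_of_nonneg hr.le] at this
      simp only [φ]
      rw [abs_div, abs_of_pos (by positivity : 0 < r ^ 2), div_le_iff₀ (by positivity)]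
      refine this.trans_eq (by ring)
    obtain ⟨l, -, hl⟩ := (isCompact_Icc (a := -(K * ‖w‖ ^ 2)) (b := K * ‖w‖ ^ 2)).ultrafilter_le_nhds'
      (U.map fun r => φ r w) hb
    exact ⟨l, hl⟩
  choose F hF using hlim
  -- Applying the quadratic bounds of `f` at points of `S` near z + r w shows that `F` has gradient
  -- `H w` at every `w`. Thus `F` is twice differentiable with second derivative `H`, which is
  -- therefore symmetric.
  have key : ∀ w w', |F w' - F w - ⟪H w, w' - w⟫| ≤ K * ‖w' - w‖ ^ 2 := by
    intro w w'
    obtain ⟨a, haS, ha0, ha⟩ := h.exists_tendsto hS w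
    have h1 := (hG.lim ha0 (Eventually.of_forall haS) ha).mono_left hU
    have ha' := ha.mono_left hU
    have hl : Tendsto (fun r => |φ r w' - φ r w - ⟪r⁻¹ • (G (z + a r) - G z), w' - w⟫|) U
        (𝓝 |F w' - F w - ⟪H w, w' - w⟫|) :=
      (((hF w').sub (hF w)).sub (h1.inner tendsto_const_nhds)).abs
    have hr : Tendsto (fun r => K * ‖w' - r⁻¹ • a r‖ ^ 2 + K * ‖w - r⁻¹ • a r‖ ^ 2) U
        (𝓝 (K * ‖w' - w‖ ^ 2 + K * ‖w - w‖ ^ 2)) :=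
      (((tendsto_const_nhds.sub ha').norm.pow 2).const_mul K).add
        (((tendsto_const_nhds.sub ha').norm.pow 2).const_mul K)
    rw [sub_self w, norm_zero, zero_pow two_ne_zero, mul_zero, add_zero] at hr
    refine le_of_tendsto_of_tendsto hl hr ?_
    filter_upwards [hUpos] with r hr0
    have e : ∀ w : EuclideanSpace ℝ (Fin d), z + r • w - (z + a r) = r • (w - r⁻¹ • a r) := by
      intro w
      rw [smul_sub, smul_inv_smul₀ hr0.ne']; abel
    have b1 := hf _ (haS r) (z + r • w')
    have b2 := hf _ (haS r) (z + r • w)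
    rw [e, norm_smul, Real.norm_of_nonneg hr0.le, inner_smul_right, mul_pow, mul_left_comm] at b1 b2
    have e2 : φ r w' - φ r w - ⟪r⁻¹ • (G (z + a r) - G z), w' - w⟫ =
        ((f (z + r • w') - f (z + a r) - r * ⟪G (z + a r), w' - r⁻¹ • a r⟫) -
        (f (z + r • w) - f (z + a r) - r * ⟪G (z + a r), w - r⁻¹ • a r⟫)) / r ^ 2 := by
      simp only [φ, inner_smul_left, inner_sub_left, inner_sub_right, RCLike.conj_to_real]
      field_simp
      ring
    rw [e2, abs_div, abs_of_pos (by positivity : 0 < r ^ 2), div_le_iff₀ (by positivity)]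
    refine (abs_sub _ _).trans ((add_le_add b1 b2).trans_eq (by ring))
  let D : EuclideanSpace ℝ (Fin d) →L[ℝ] EuclideanSpace ℝ (Fin d) →L[ℝ] ℝ :=
    LinearMap.toContinuousLinearMap
      { toFun := fun w => innerSL ℝ (H w)
        map_add' := fun a b => by simp
        map_smul' := fun c a => by ext; simp }
  have hD : ∀ a b, D a b = ⟪H a, b⟫ := fun a b => rfl
  have hF' : ∀ w, HasFDerivAt F (D w) w := fun w =>
    (hasGradientAt_of_quadratic_bound (key w)).hasFDerivAt
  have := second_derivative_symmetric hF' (D.hasFDerivAt (x := 0)) v w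
  rwa [hD, hD] at this

/-- For images only upper bounds of volumes are at hand, so density is restated as smallness of the
complement. -/
lemma isDensityPoint_iff_compl {S : Set (EuclideanSpace ℝ (Fin d))} (hS : MeasurableSet S)
    {z : EuclideanSpace ℝ (Fin d)} : IsDensityPoint S z ↔
      Tendsto (fun r : ℝ => volume (Sᶜ ∩ Metric.ball z r) / volume (Metric.ball z r))
        (𝓝[>] (0 : ℝ)) (𝓝 0) := by
  have hsum : ∀ r : ℝ, 0 < r → volume (S ∩ Metric.ball z r) / volume (Metric.ball z r) +
      volume (Sᶜ ∩ Metric.ball z r) / volume (Metric.ball z r) = 1 := by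
    intro r hr
    rw [← ENNReal.add_div, inter_comm S, inter_comm Sᶜ, ← Set.sdiff_eq,
      measure_inter_add_sdiff _ hS]
    exact ENNReal.div_self (Metric.measure_ball_pos volume z hr).ne' measure_ball_lt_top.ne
  have hfin : ∀ r : ℝ, 0 < r → volume (S ∩ Metric.ball z r) / volume (Metric.ball z r) ≠ ⊤ ∧
      volume (Sᶜ ∩ Metric.ball z r) / volume (Metric.ball z r) ≠ ⊤ := by
    intro r hr
    rw [← ENNReal.add_ne_top, hsum r hr]
    exact ENNReal.one_ne_top
  constructor
  · intro h
    have h1 := ENNReal.Tendsto.sub (tendsto_const_nhds (x := (1 : ℝ≥0∞))) h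
      (Or.inl ENNReal.one_ne_top)
    rw [tsub_self] at h1
    refine h1.congr' ?_
    filter_upwards [self_mem_nhdsWithin] with r hr
    rw [← hsum r hr, ENNReal.add_sub_cancel_left (hfin r hr).1]
  · intro h
    have h1 := ENNReal.Tendsto.sub (tendsto_const_nhds (x := (1 : ℝ≥0∞))) h
      (Or.inl ENNReal.one_ne_top)
    rw [tsub_zero] at h1
    refine h1.congr' ?_
    filter_upwards [self_mem_nhdsWithin] with r hr
    rw [← hsum r hr, ENNReal.add_sub_cancel_right (hfin r hr).2]

open scoped NNReal in
-- Lebesgue measure is a multiple of the d-dimensional Hausdorff measure, for which the bound is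
-- immediate.
lemma exists_volume_image_le {K : ℝ≥0} {F : EuclideanSpace ℝ (Fin d) → EuclideanSpace ℝ (Fin d)}
    (hF : LipschitzWith K F) (S : Set (EuclideanSpace ℝ (Fin d))) :
    volume (F '' S) ≤ (K : ℝ≥0∞) ^ d * volume S := by
  have h1 := hF.hausdorffMeasure_image_le
    (d := (Module.finrank ℝ (EuclideanSpace ℝ (Fin d)) : ℝ)) (Nat.cast_nonneg _) S
  have h2 : (volume : Measure (EuclideanSpace ℝ (Fin d))) =
      Measure.addHaarScalarFactor volume
        (Measure.hausdorffMeasure (Module.finrank ℝ (EuclideanSpace ℝ (Fin d)))) •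
        Measure.hausdorffMeasure (Module.finrank ℝ (EuclideanSpace ℝ (Fin d))) :=
    Measure.isAddLeftInvariant_eq_smul _ _
  have h3 : (K : ℝ≥0∞) ^ (Module.finrank ℝ (EuclideanSpace ℝ (Fin d)) : ℝ) = (K : ℝ≥0∞) ^ d := by
    rw [finrank_euclideanSpace_fin, ENNReal.rpow_natCast]
  rw [h3] at h1
  rw [h2, Measure.smul_apply, Measure.smul_apply, ENNReal.smul_def, ENNReal.smul_def, smul_eq_mul,
    smul_eq_mul, mul_left_comm]
  gcongr

open scoped NNReal in
/-- Density points are preserved by bi-Lipschitz bijections. -/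
lemma IsDensityPoint.image {S S' : Set (EuclideanSpace ℝ (Fin d))} (hS : IsClosed S)
    (hS' : IsClosed S') {z : EuclideanSpace ℝ (Fin d)} (h : IsDensityPoint S z) {K L : ℝ≥0}
    {F : EuclideanSpace ℝ (Fin d) → EuclideanSpace ℝ (Fin d)} (hF : LipschitzWith K F)
    (hF' : AntilipschitzWith L F) (hsurj : Function.Surjective F) (hmaps : ∀ x ∈ S, F x ∈ S') :
    IsDensityPoint S' (F z) := by
  rw [isDensityPoint_iff_compl hS.measurableSet] at h
  rw [isDensityPoint_iff_compl hS'.measurableSet]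
  set M : ℝ≥0 := L + 1
  have hM : (0 : ℝ) < M := by positivity
  have hscale : Tendsto (fun r : ℝ => (M : ℝ) * r) (𝓝[>] 0) (𝓝[>] 0) := by
    refine tendsto_nhdsWithin_iff.mpr ⟨?_, ?_⟩
    · have : Tendsto (fun r : ℝ => (M : ℝ) * r) (𝓝 0) (𝓝 (M * 0)) :=
        tendsto_id.const_mul _
      rw [mul_zero] at this
      exact this.mono_left nhdsWithin_le_nhds
    · filter_upwards [self_mem_nhdsWithin] with r hr
      exact mul_pos hM hr
  have h1 := ENNReal.Tendsto.const_mul (a := (K : ℝ≥0∞) ^ d * ENNReal.ofReal ((M : ℝ) ^ d))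
    (h.comp hscale) (Or.inr (ENNReal.mul_ne_top (ENNReal.pow_ne_top ENNReal.coe_ne_top)
      ENNReal.ofReal_ne_top))
  rw [mul_zero] at h1
  refine tendsto_of_tendsto_of_tendsto_of_le_of_le' tendsto_const_nhds h1
    (Eventually.of_forall fun _ => zero_le) ?_
  filter_upwards [self_mem_nhdsWithin] with r hr
  have hr0 : (0 : ℝ) < r := hr
  -- Surjectivity gives a preimage; it is outside `S` since `F` maps `S` into `S'`, and near `z` by
  -- the antilipschitz bound. Taking L + 1 for the radius factor keeps it positive.
  have hsub : S'ᶜ ∩ Metric.ball (F z) r ⊆ F '' (Sᶜ ∩ Metric.ball z (M * r)) := by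
    rintro w ⟨hw, hwr⟩
    obtain ⟨x, rfl⟩ := hsurj w
    refine ⟨x, ⟨fun hx => hw (hmaps x hx), ?_⟩, rfl⟩
    rw [Metric.mem_ball] at hwr ⊢
    refine (hF'.le_mul_dist x z).trans_lt ?_
    have h2 : (L : ℝ) * dist (F x) (F z) ≤ L * r := by gcongr
    have h3 : (M : ℝ) = L + 1 := by simp [M]
    rw [h3]
    linarith
  have hvol : volume (Metric.ball z (M * r)) =
      ENNReal.ofReal ((M : ℝ) ^ d) * volume (Metric.ball (F z) r) := by
    have h4 := Measure.addHaar_ball_mul_of_pos volume z hM r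
    rw [finrank_euclideanSpace_fin] at h4
    rw [h4, Measure.addHaar_ball_center volume (F z) r]
  have hM0 : ENNReal.ofReal ((M : ℝ) ^ d) ≠ 0 := by
    rw [Ne, ENNReal.ofReal_eq_zero, not_le]; positivity
  calc volume (S'ᶜ ∩ Metric.ball (F z) r) / volume (Metric.ball (F z) r)
      ≤ (K : ℝ≥0∞) ^ d * volume (Sᶜ ∩ Metric.ball z (M * r)) / volume (Metric.ball (F z) r) := by
        gcongr
        exact (measure_mono hsub).trans (exists_volume_image_le hF _)
    _ = _ := by
        simp only [Function.comp]
        rw [hvol, mul_assoc, ← mul_div_assoc (ENNReal.ofReal _),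
          ENNReal.mul_div_mul_left _ _ hM0 ENNReal.ofReal_ne_top, mul_div_assoc]

open scoped NNReal

/-! ### Lipschitz estimates from two-sided quadratic bounds -/

section Quadratic

variable {S : Set (EuclideanSpace ℝ (Fin d))} {f : EuclideanSpace ℝ (Fin d) → ℝ}
  {G : EuclideanSpace ℝ (Fin d) → EuclideanSpace ℝ (Fin d)} {K M : ℝ}

/-- Test at x' + h with `h` along G x' - G x and of length D = ‖x' - x‖. The three quadratic errors
are KD², 4KD² and KD², whence the constant 6. -/
lemma norm_sub_le_of_quadratic_bound
    (hf : ∀ x ∈ S, ∀ x', |f x' - f x - ⟪G x, x' - x⟫| ≤ K * ‖x' - x‖ ^ 2)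
    {x x' : EuclideanSpace ℝ (Fin d)} (hx : x ∈ S) (hx' : x' ∈ S) :
    ‖G x' - G x‖ ≤ 6 * K * ‖x' - x‖ := by
  rcases eq_or_ne x' x with rfl | hne
  · simp
  by_cases hG : G x' - G x = 0
  · have h1 := (abs_nonneg _).trans (hf x hx x')
    have h2 : 0 < ‖x' - x‖ := norm_pos_iff.mpr (sub_ne_zero.mpr hne)
    have h3 : 0 ≤ K := nonneg_of_mul_nonneg_left h1 (by positivity)
    rw [hG, norm_zero]; positivity
  have hD : 0 < ‖x' - x‖ := norm_pos_iff.mpr (sub_ne_zero.mpr hne)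
  have hΔ : 0 < ‖G x' - G x‖ := norm_pos_iff.mpr hG
  set h := (‖x' - x‖ / ‖G x' - G x‖) • (G x' - G x) with hh
  have hn : ‖h‖ = ‖x' - x‖ := by
    rw [hh, norm_smul, Real.norm_of_nonneg (by positivity), div_mul_cancel₀ _ hΔ.ne']
  have hi : ⟪G x' - G x, h⟫ = ‖x' - x‖ * ‖G x' - G x‖ := by
    rw [hh, inner_smul_right, real_inner_self_eq_norm_sq]
    field_simp
  have b1 := (abs_le.mp (hf x' hx' (x' + h))).1
  have b2 := (abs_le.mp (hf x hx (x' + h))).2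
  have b3 := (abs_le.mp (hf x hx x')).1
  have hK : 0 ≤ K := nonneg_of_mul_nonneg_left ((abs_nonneg _).trans (hf x hx x')) (by positivity)
  rw [add_sub_cancel_left, hn] at b1
  have e1 : x' + h - x = (x' - x) + h := by abel
  have h4 : ‖x' + h - x‖ ≤ 2 * ‖x' - x‖ := by
    rw [e1]; exact (norm_add_le _ _).trans_eq (by rw [hn]; ring)
  have h5 : K * ‖x' + h - x‖ ^ 2 ≤ K * (2 * ‖x' - x‖) ^ 2 := by gcongr
  have h6 : ⟪G x, x' + h - x⟫ = ⟪G x, x' - x⟫ + ⟪G x, h⟫ := by rw [e1, inner_add_right]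
  rw [inner_sub_left] at hi
  refine le_of_mul_le_mul_left (a := ‖x' - x‖) ?_ hD
  nlinarith

/-- A unit step along `G x` changes `f` by at least ‖G x‖ - K and by at most 2M. -/
lemma norm_le_of_quadratic_bound
    (hf : ∀ x ∈ S, ∀ x', |f x' - f x - ⟪G x, x' - x⟫| ≤ K * ‖x' - x‖ ^ 2)
    (hM : ∀ x, |f x| ≤ M) (hK : 0 ≤ K) {x : EuclideanSpace ℝ (Fin d)} (hx : x ∈ S) :
    ‖G x‖ ≤ 2 * M + K := by
  by_cases hG : G x = 0
  · have := (abs_nonneg _).trans (hM x)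
    rw [hG, norm_zero]; positivity
  have hpos : 0 < ‖G x‖ := norm_pos_iff.mpr hG
  have h1 := (abs_le.mp (hf x hx (x + (‖G x‖)⁻¹ • G x))).1
  rw [add_sub_cancel_left, inner_smul_right, real_inner_self_eq_norm_sq, norm_smul, norm_inv,
    norm_norm, inv_mul_cancel₀ hpos.ne'] at h1
  have h2 : ‖G x‖⁻¹ * ‖G x‖ ^ 2 = ‖G x‖ := by field_simp
  have h3 := (abs_le.mp (hM (x + (‖G x‖)⁻¹ • G x))).2
  have h4 := (abs_le.mp (hM x)).1
  rw [h2] at h1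
  linarith

lemma abs_sub_le_of_quadratic_bound
    (hf : ∀ x ∈ S, ∀ x', |f x' - f x - ⟪G x, x' - x⟫| ≤ K * ‖x' - x‖ ^ 2)
    (hM : ∀ x, |f x| ≤ M) (hK : 0 ≤ K) {x : EuclideanSpace ℝ (Fin d)} (hx : x ∈ S)
    (x' : EuclideanSpace ℝ (Fin d)) :
    |f x' - f x| ≤ (2 * M + 2 * K) * ‖x' - x‖ := by
  have hM0 := (abs_nonneg _).trans (hM x)
  rcases le_total ‖x' - x‖ 1 with h | h
  · have h1 := hf x hx x'
    have h2 : |⟪G x, x' - x⟫| ≤ (2 * M + K) * ‖x' - x‖ :=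
      (abs_real_inner_le_norm _ _).trans (by gcongr; exact norm_le_of_quadratic_bound hf hM hK hx)
    have h3 : K * ‖x' - x‖ ^ 2 ≤ K * ‖x' - x‖ := by
      gcongr; exact pow_le_of_le_one (norm_nonneg _) h two_ne_zero
    have h4 : |f x' - f x| ≤ |f x' - f x - ⟪G x, x' - x⟫| + |⟪G x, x' - x⟫| := by
      simpa using abs_add_le (f x' - f x - ⟪G x, x' - x⟫) ⟪G x, x' - x⟫
    linarith
  · have h1 : |f x' - f x| ≤ M + M := (abs_sub _ _).trans (add_le_add (hM _) (hM _))
    nlinarith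

end Quadratic

/-! ### Flow property of the transport and invariance of density points -/

lemma exists_travel_lipschitz {𝒦 : Set (ℝ × EuclideanSpace ℝ (Fin d))} (hc : IsCompact 𝒦)
    (hconv : Convex ℝ 𝒦) {a b : ℝ} (h0 : (0 : ℝ) ∈ Icc a b)
    (hpos : ∀ z ∈ 𝒦, ∀ σ ∈ Icc a b, 0 < 1 + 2 * σ * z.1) :
    ∃ C, 0 ≤ C ∧ ∀ τ ∈ Icc a b, ∀ z ∈ 𝒦, ∀ z' ∈ 𝒦,
      ‖travel z' τ - travel z τ‖ ≤ C * |τ| * ‖z' - z‖ := by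
  obtain ⟨C, hC0, hC⟩ := exists_velocityDeriv_bound hc hpos
  refine ⟨C, hC0, fun τ hτ z hz z' hz' => ?_⟩
  refine hconv.norm_image_sub_le_of_norm_hasFDerivWithin_le (𝕜 := ℝ)
    (fun w hw => (hasFDerivAt_travel (hpos w hw τ hτ)).hasFDerivWithinAt) (fun w hw => ?_) hz hz'
  have := intervalIntegral.norm_integral_le_of_norm_le_const (a := 0) (b := τ)
    (f := velocityDeriv w) (C := C) fun σ hσ =>
      hC w hw σ (uIcc_subset_Icc h0 hτ (uIoc_subset_uIcc hσ))
  rwa [sub_zero] at this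

lemma one_add_pos_of_mem_Icc {s t p : ℝ} (hs : s ∈ Ioo (0 : ℝ) 1) (ht : t ∈ Ioo (0 : ℝ) 1)
    (hp : p ∈ Icc (-1 / (2 * (1 - s))) (1 / (2 * s))) : 0 < 1 + 2 * (t - s) * p := by
  rcases lt_trichotomy t s with h | h | h
  · have := one_sub_realCost_pos ht hs h hp.2
    linarith
  · simp [h]
  · exact one_add_realCost_pos hs ht h hp.1

/-- Restarting at time ρ replaces the jet by (Q'/(4Q), g/Q) and renormalizes Q to be 1 there. The
discriminant identity makes the leading coefficients match. -/
lemma quad_shift (z : ℝ × EuclideanSpace ℝ (Fin d)) {ρ : ℝ} (h : quad z ρ ≠ 0) (σ : ℝ) :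
    quad (quadDot z ρ / (4 * quad z ρ), (quad z ρ)⁻¹ • z.2) σ * quad z ρ = quad z (ρ + σ) := by
  have h1 : ‖(quad z ρ)⁻¹ • z.2‖ ^ 2 = ‖z.2‖ ^ 2 / quad z ρ ^ 2 := by
    rw [norm_smul, mul_pow, norm_inv, Real.norm_eq_abs, inv_pow, sq_abs]; ring
  have h4 : quad z ρ = (1 + 2 * ρ * z.1) ^ 2 + ρ ^ 2 * ‖z.2‖ ^ 2 := rfl
  have h5 : quadDot z ρ = 2 * (2 * z.1 * (1 + 2 * ρ * z.1) + ρ * ‖z.2‖ ^ 2) := rfl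
  have h6 : 4 * (4 * z.1 ^ 2 + ‖z.2‖ ^ 2) * quad z ρ - quadDot z ρ ^ 2 = 4 * ‖z.2‖ ^ 2 := by
    rw [h4, h5]; ring
  have h7 : quad z (ρ + σ) =
      quad z ρ + σ * quadDot z ρ + σ ^ 2 * (4 * z.1 ^ 2 + ‖z.2‖ ^ 2) := by
    rw [h4, h5, quad]; ring
  rw [h7, quad]
  simp only
  rw [h1]
  generalize quad z ρ = Q at *
  generalize quadDot z ρ = b at *
  field_simp
  linear_combination -(4 * σ ^ 2) * h6

lemma travel_add {z : ℝ × EuclideanSpace ℝ (Fin d)} {ρ σ : ℝ} (hρ : 0 < 1 + 2 * ρ * z.1)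
    (hσ : 0 < 1 + 2 * (ρ + σ) * z.1) :
    travel z (ρ + σ) = travel z ρ +
      travel (quadDot z ρ / (4 * quad z ρ), (quad z ρ)⁻¹ • z.2) σ := by
  have hint : ∀ τ, 0 < 1 + 2 * τ * z.1 →
      IntervalIntegrable (fun σ => (quad z σ)⁻¹ • z.2) volume 0 τ := fun τ hτ =>
    ((continuousOn_quad_inv hτ).smul continuousOn_const).intervalIntegrable
  rw [← sub_eq_iff_eq_add', travel, travel,
    intervalIntegral.integral_interval_sub_left (hint _ hσ) (hint _ hρ), travel]
  simp only [smul_smul, ← mul_inv, quad_shift z (quad_pos hρ).ne']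
  rw [intervalIntegral.integral_comp_add_left (fun w => (quad z w)⁻¹ • z.2), add_zero]

namespace IsPair

variable {u v : ℝ → EuclideanSpace ℝ (Fin d) → ℝ} {s t : ℝ} {x y : EuclideanSpace ℝ (Fin d)}

/-- The jet at the transported point is the restarted jet of `quad_shift`, which is what makes the
transport maps compose. -/
lemma jet_trans (h : IsPair u v) (hs : s ∈ Ioo (0 : ℝ) 1) (ht : t ∈ Ioo (0 : ℝ) 1)
    (hx : x ∈ touch u v s) : jet (u t) (trans u s t x) =
      (quadDot (jet (u s) x) (t - s) / (4 * quad (jet (u s) x) (t - s)),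
        (quad (jet (u s) x) (t - s))⁻¹ • (jet (u s) x).2) := by
  rw [jet, h.apply_trans hs ht hx, h.gradient_trans hs ht hx]
  congr 1
  have := h.quad_jet_pos hs ht x
  unfold quadDot
  simp only [jet]
  field_simp
  ring

lemma trans_comp (h : IsPair u v) (hs : s ∈ Ioo (0 : ℝ) 1) (ht : t ∈ Ioo (0 : ℝ) 1) {r : ℝ}
    (hr : r ∈ Ioo (0 : ℝ) 1) (hx : x ∈ touch u v s) :
    trans u r t (trans u s r x) = trans u s t x := by
  have h1 := h.left.one_add_pos hs ht x
  have e : t - s = (r - s) + (t - r) := by ring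
  rw [e] at h1
  rw [trans, h.jet_trans hs hr hx, trans, trans, e,
    travel_add (z := jet (u s) x) (h.left.one_add_pos hs hr x) h1, add_assoc]

lemma abs_le (h : IsPair u v) {a b : ℝ} (ha : 0 < a) (hb : b < 1) (hs : s ∈ Icc a b)
    (x : EuclideanSpace ℝ (Fin d)) : |u s x| ≤ 1 / (2 * a) + 1 / (2 * (1 - b)) := by
  have hs' : s ∈ Ioo (0 : ℝ) 1 := ⟨ha.trans_le hs.1, hs.2.trans_lt hb⟩
  have h1 := h.left.ge s hs' x
  have h2 := h.left.le s hs' x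
  have hb' : 0 < 1 - b := by linarith
  have h3 : 1 / (2 * s) ≤ 1 / (2 * a) := by gcongr; exact hs.1
  have h4 : 1 / (2 * (1 - s)) ≤ 1 / (2 * (1 - b)) := by gcongr; exact hs.2
  have h5 : 0 < 1 / (2 * a) := by positivity
  have h6 : 0 < 1 / (2 * (1 - b)) := by positivity
  rw [neg_div] at h1
  rw [_root_.abs_le]
  constructor <;> linarith

lemma quadratic_bound_of_mem (h : IsPair u v) {a b : ℝ} (ha : 0 < a) (hb : b < 1)
    (hs : s ∈ Icc a b) : ∀ x ∈ touch u v s, ∀ x',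
      |u s x' - u s x - ⟪gradient (u s) x, x' - x⟫| ≤ 1 / (a * (1 - b)) * ‖x' - x‖ ^ 2 := by
  intro x hx x'
  have hs' : s ∈ Ioo (0 : ℝ) 1 := ⟨ha.trans_le hs.1, hs.2.trans_lt hb⟩
  refine (h.quadratic_bound hs' hx x').trans ?_
  have hb' : 0 < 1 - b := by linarith
  have := hs.1
  have := hs.2
  have := hs'.1
  gcongr

lemma exists_jet_bounds (h : IsPair u v) {a b : ℝ} (ha : 0 < a) (hb : b < 1) :
    ∃ R Λ : ℝ, 0 < R ∧ 0 ≤ Λ ∧ ∀ s ∈ Icc a b, ∀ x ∈ touch u v s,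
      |u s x| ≤ R ∧ ‖gradient (u s) x‖ ≤ R ∧
      ∀ x' ∈ touch u v s, ‖jet (u s) x' - jet (u s) x‖ ≤ Λ * ‖x' - x‖ := by
  have hb' : 0 < 1 - b := by linarith
  set M := 1 / (2 * a) + 1 / (2 * (1 - b)) with hM
  set K := 1 / (a * (1 - b)) with hK
  have hM0 : 0 < M := by positivity
  have hK0 : 0 < K := by positivity
  refine ⟨2 * M + K, 2 * M + 6 * K, by positivity, by positivity, fun s hs x hx => ?_⟩
  have hq := h.quadratic_bound_of_mem ha hb hs
  have hm := h.abs_le ha hb hs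
  refine ⟨(hm x).trans (by linarith), norm_le_of_quadratic_bound hq hm hK0.le hx, fun x' hx' => ?_⟩
  rw [Prod.norm_def]
  refine max_le ?_ ?_
  · refine (abs_sub_le_of_quadratic_bound hq hm hK0.le hx x').trans ?_
    gcongr; linarith
  · refine (norm_sub_le_of_quadratic_bound hq hx hx').trans ?_
    gcongr; linarith

lemma exists_trans_lipschitz (h : IsPair u v) (hs : s ∈ Ioo (0 : ℝ) 1) (ht : t ∈ Ioo (0 : ℝ) 1) :
    ∃ L : ℝ, 0 ≤ L ∧ ∀ x ∈ touch u v s, ∀ x' ∈ touch u v s,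
      ‖trans u s t x' - trans u s t x‖ ≤ L * ‖x' - x‖ := by
  obtain ⟨R, Λ, hR, hΛ, hb⟩ := h.exists_jet_bounds hs.1 hs.2
  have hpos : ∀ z ∈ (Icc (-1 / (2 * (1 - s))) (1 / (2 * s))) ×ˢ
      Metric.closedBall (0 : EuclideanSpace ℝ (Fin d)) R,
      ∀ σ ∈ Icc (min 0 (t - s)) (max 0 (t - s)), 0 < 1 + 2 * σ * z.1 := fun z hz σ hσ =>
    one_add_pos_of_mem_uIcc (one_add_pos_of_mem_Icc hs ht hz.1) hσ
  obtain ⟨C, hC0, hC⟩ := exists_travel_lipschitz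
    (isCompact_Icc.prod (isCompact_closedBall _ _)) ((convex_Icc _ _).prod (convex_closedBall _ _))
    ⟨min_le_left _ _, le_max_left _ _⟩ hpos
  have hmem : ∀ x ∈ touch u v s, jet (u s) x ∈ (Icc (-1 / (2 * (1 - s))) (1 / (2 * s))) ×ˢ
      Metric.closedBall (0 : EuclideanSpace ℝ (Fin d)) R := fun x hx =>
    ⟨⟨h.left.ge s hs x, h.left.le s hs x⟩, by
      rw [mem_closedBall_zero_iff]; exact (hb s ⟨le_rfl, le_rfl⟩ x hx).2.1⟩
  refine ⟨1 + C * |t - s| * Λ, by positivity, fun x hx x' hx' => ?_⟩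
  have h1 := hC (t - s) ⟨min_le_right _ _, le_max_right _ _⟩ _ (hmem x hx) _ (hmem x' hx')
  have h2 := (hb s ⟨le_rfl, le_rfl⟩ x hx).2.2 x' hx'
  have h3 : trans u s t x' - trans u s t x =
      (x' - x) + (travel (jet (u s) x') (t - s) - travel (jet (u s) x) (t - s)) := by
    unfold trans; abel
  rw [h3]
  refine (norm_add_le _ _).trans ?_
  have h4 : C * |t - s| * ‖jet (u s) x' - jet (u s) x‖ ≤ C * |t - s| * (Λ * ‖x' - x‖) := by gcongr
  linarith

/-- For close times, the transport maps extend to bi-Lipschitz bijections of the whole space. -/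
lemma exists_extension (h : IsPair u v) {a b : ℝ} (ha : 0 < a) (hb : b < 1) :
    ∃ ε : ℝ, 0 < ε ∧ ∀ s ∈ Icc a b, ∀ t, |t - s| ≤ ε →
      ∃ F : EuclideanSpace ℝ (Fin d) → EuclideanSpace ℝ (Fin d), LipschitzWith 2 F ∧
        AntilipschitzWith 2 F ∧ Function.Surjective F ∧ ∀ x ∈ touch u v s, F x = trans u s t x := by
  obtain ⟨R, Λ, hR, hΛ, hbd⟩ := h.exists_jet_bounds ha hb
  have hpos : ∀ z ∈ (Icc (-R) R) ×ˢ Metric.closedBall (0 : EuclideanSpace ℝ (Fin d)) R,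
      ∀ σ ∈ Icc (-(1 / (4 * R))) (1 / (4 * R)), 0 < 1 + 2 * σ * z.1 := by
    intro z hz σ hσ
    have h1 : |σ| ≤ 1 / (4 * R) := _root_.abs_le.mpr hσ
    have h2 : |z.1| ≤ R := _root_.abs_le.mpr hz.1
    have h3 : |σ * z.1| ≤ 1 / 4 := by
      rw [abs_mul]
      calc |σ| * |z.1| ≤ 1 / (4 * R) * R := by gcongr
        _ = 1 / 4 := by field_simp
    have := (_root_.abs_le.mp h3).1
    linarith
  have hR4 : 0 < 1 / (4 * R) := by positivity
  obtain ⟨C, hC0, hC⟩ := exists_travel_lipschitz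
    (isCompact_Icc.prod (isCompact_closedBall _ _)) ((convex_Icc _ _).prod (convex_closedBall _ _))
    ⟨by linarith, hR4.le⟩ hpos
  set c := lipschitzExtensionConstant (EuclideanSpace ℝ (Fin d)) with hc
  have hc0 : (0 : ℝ) < c := lipschitzExtensionConstant_pos _
  -- The first bound keeps 1+2σp positive. The second makes the displacement at most 1/2-Lipschitz
  -- after the extension has cost the factor `c`; its Lipschitz constant C|t-s|Λ is proportional to
  -- the time step.
  refine ⟨min (1 / (4 * R)) (1 / (2 * c * (C * Λ + 1))), by positivity, fun s hs t hst => ?_⟩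
  have hτ : t - s ∈ Icc (-(1 / (4 * R))) (1 / (4 * R)) :=
    _root_.abs_le.mp (hst.trans (min_le_left _ _))
  have hmem : ∀ x ∈ touch u v s, jet (u s) x ∈ (Icc (-R) R) ×ˢ
      Metric.closedBall (0 : EuclideanSpace ℝ (Fin d)) R := fun x hx =>
    ⟨_root_.abs_le.mp (hbd s hs x hx).1, by
      rw [mem_closedBall_zero_iff]; exact (hbd s hs x hx).2.1⟩
  have hLip : LipschitzOnWith (Real.toNNReal (C * |t - s| * Λ))
      (fun x => travel (jet (u s) x) (t - s)) (touch u v s) := by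
    refine LipschitzOnWith.of_dist_le_mul fun x' hx' x hx => ?_
    rw [dist_eq_norm, dist_eq_norm, Real.coe_toNNReal _ (by positivity), mul_assoc]
    refine (hC (t - s) hτ _ (hmem x hx) _ (hmem x' hx')).trans ?_
    gcongr
    exact (hbd s hs x hx).2.2 x' hx'
  obtain ⟨g, hg, hgeq⟩ := hLip.extend_finite_dimension
  have hhalf : LipschitzWith (1 / 2) g := by
    refine hg.weaken ?_
    rw [← NNReal.coe_le_coe, NNReal.coe_mul, Real.coe_toNNReal _ (by positivity), ← hc]
    have h1 : |t - s| ≤ 1 / (2 * c * (C * Λ + 1)) := hst.trans (min_le_right _ _)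
    have h2 : C * |t - s| * Λ ≤ C * (1 / (2 * c * (C * Λ + 1))) * Λ := by gcongr
    calc (c : ℝ) * (C * |t - s| * Λ) ≤ c * (C * (1 / (2 * c * (C * Λ + 1))) * Λ) := by gcongr
      _ = 1 / 2 * (C * Λ / (C * Λ + 1)) := by field_simp
      _ ≤ 1 / 2 * 1 := by
        gcongr
        rw [div_le_one (by positivity)]
        linarith
      _ = ((1 / 2 : ℝ≥0) : ℝ) := by norm_num
  have hgn : ∀ x y, ‖g x - g y‖ ≤ 1 / 2 * ‖x - y‖ := fun x y => by
    have := hhalf.norm_sub_le x y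
    simpa using this
  refine ⟨fun x => x + g x, ?_, ?_, ?_, fun x hx => ?_⟩
  · refine LipschitzWith.of_dist_le_mul fun x y => ?_
    rw [dist_eq_norm, dist_eq_norm, add_sub_add_comm]
    refine (norm_add_le _ _).trans ?_
    have := hgn x y
    have := norm_nonneg (x - y)
    norm_num
    linarith
  · refine AntilipschitzWith.of_le_mul_dist fun x y => ?_
    rw [dist_eq_norm, dist_eq_norm, add_sub_add_comm]
    have h1 := hgn x y
    have h2 := norm_sub_le (x - y + (g x - g y)) (g x - g y)
    rw [add_sub_cancel_right] at h2
    norm_num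
    linarith
  · intro w
    -- A solution of x + g x = w is a fixed point of the contraction x ↦ w - g x.
    have hcontr : ContractingWith (1 / 2) fun x => w - g x := by
      refine ⟨by rw [← NNReal.coe_lt_coe]; norm_num, LipschitzWith.of_dist_le_mul fun x y => ?_⟩
      rw [dist_sub_left]
      exact hhalf.dist_le_mul x y
    refine ⟨hcontr.fixedPoint, ?_⟩
    have := hcontr.fixedPoint_isFixedPt
    exact (eq_add_of_sub_eq this).symm
  · simp only [trans]
    rw [← hgeq hx]

/-- The extension to a bijection exists only for short times, so the interval is cut into `N` equal
steps, each at most ε, which compose by `trans_comp`. The step ε is uniform on the compact interval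
between `s` and `t`. -/
lemma isDensityPoint_trans (h : IsPair u v) (hs : s ∈ Ioo (0 : ℝ) 1) (ht : t ∈ Ioo (0 : ℝ) 1)
    (hy : IsDensityPoint (touch u v s) y) : IsDensityPoint (touch u v t) (trans u s t y) := by
  have hyS := hy.mem (h.isClosed_touch hs)
  obtain ⟨ε, hε, hF⟩ := h.exists_extension (lt_min hs.1 ht.1) (max_lt hs.2 ht.2)
  obtain ⟨N, hN⟩ := exists_nat_gt (|t - s| / ε)
  have hN0 : (0 : ℝ) < N := (by positivity : 0 ≤ |t - s| / ε).trans_lt hN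
  have hmem : ∀ k : ℕ, k ≤ N → s + k / N * (t - s) ∈ Icc (min s t) (max s t) := by
    intro k hk
    have h1 : (k : ℝ) / N ≤ 1 := by
      rw [div_le_one hN0]; exact_mod_cast hk
    have h2 : (0 : ℝ) ≤ k / N := by positivity
    rcases le_total s t with hst | hst
    · rw [min_eq_left hst, max_eq_right hst]
      constructor <;> nlinarith
    · rw [min_eq_right hst, max_eq_left hst]
      constructor <;> nlinarith
  have hIoo : ∀ k : ℕ, k ≤ N → s + k / N * (t - s) ∈ Ioo (0 : ℝ) 1 := fun k hk =>
    ⟨(lt_min hs.1 ht.1).trans_le (hmem k hk).1, (hmem k hk).2.trans_lt (max_lt hs.2 ht.2)⟩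
  have key : ∀ k : ℕ, k ≤ N → IsDensityPoint (touch u v (s + k / N * (t - s)))
      (trans u s (s + k / N * (t - s)) y) := by
    intro k
    induction k with
    | zero => intro _; simpa using hy
    | succ k ih =>
      intro hk
      have hk' : k ≤ N := by omega
      have hstep : |s + (k + 1 : ℕ) / N * (t - s) - (s + k / N * (t - s))| ≤ ε := by
        have : s + (k + 1 : ℕ) / N * (t - s) - (s + k / N * (t - s)) = (t - s) / N := by
          push_cast; field_simp; ring
        rw [this, abs_div, abs_of_pos hN0, div_le_iff₀ hN0]
        rw [div_lt_iff₀ hε] at hN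
        linarith
      obtain ⟨F, hF1, hF2, hF3, hF4⟩ := hF _ (hmem k hk') _ hstep
      have h1 := (ih hk').image (h.isClosed_touch (hIoo k hk'))
        (h.isClosed_touch (hIoo (k + 1) hk)) hF1 hF2 hF3 fun x hx => by
          rw [hF4 x hx]; exact h.trans_mem (hIoo k hk') (hIoo (k + 1) hk) hx
      rwa [hF4 _ (h.trans_mem hs (hIoo k hk') hyS),
        h.trans_comp hs (hIoo (k + 1) hk) (hIoo k hk') hyS] at h1
  have := key N le_rfl
  rwa [div_self hN0.ne', one_mul, add_sub_cancel] at this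

end IsPair

/-! ### Jacobi's formula and traces -/

lemma det_eq_sum (A : EuclideanSpace ℝ (Fin d) →L[ℝ] EuclideanSpace ℝ (Fin d)) :
    A.det = ∑ σ : Equiv.Perm (Fin d), ((Equiv.Perm.sign σ : ℤ) : ℝ) *
      ∏ i, A (EuclideanSpace.single i 1) (σ i) := by
  rw [ContinuousLinearMap.det,
    ← LinearMap.det_toMatrix (EuclideanSpace.basisFun (Fin d) ℝ).toBasis, Matrix.det_apply']
  simp [LinearMap.toMatrix_apply]

lemma differentiable_det : Differentiable ℝ
    fun A : EuclideanSpace ℝ (Fin d) →L[ℝ] EuclideanSpace ℝ (Fin d) => A.det := by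
  simp only [det_eq_sum]
  refine Differentiable.fun_sum fun σ _ => ?_
  have h : Differentiable ℝ fun A : EuclideanSpace ℝ (Fin d) →L[ℝ] EuclideanSpace ℝ (Fin d) =>
      ∏ i, A (EuclideanSpace.single i 1) (σ i) :=
    fun A => (HasFDerivAt.finsetProd fun i _ =>
      (((EuclideanSpace.proj (𝕜 := ℝ) (σ i)).comp (ContinuousLinearMap.apply ℝ
        (EuclideanSpace ℝ (Fin d)) (EuclideanSpace.single i (1 : ℝ)))).hasFDerivAt (x := A))).differentiableAt
  exact h.const_mul _

/-- The determinant of 1 + rN is a polynomial in r whose linear coefficient is the trace of N. -/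
lemma fderiv_det_one (N : EuclideanSpace ℝ (Fin d) →L[ℝ] EuclideanSpace ℝ (Fin d)) :
    fderiv ℝ (fun A : EuclideanSpace ℝ (Fin d) →L[ℝ] EuclideanSpace ℝ (Fin d) => A.det) 1 N =
      LinearMap.trace ℝ (EuclideanSpace ℝ (Fin d)) N := by
  have h1 : HasDerivAt (fun r : ℝ => (1 + r • N).det)
      (fderiv ℝ (fun A : EuclideanSpace ℝ (Fin d) →L[ℝ] EuclideanSpace ℝ (Fin d) => A.det) 1 N)
      0 := by
    have h2 : HasDerivAt (fun r : ℝ => 1 + r • N) N 0 := by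
      simpa using ((hasDerivAt_id (0 : ℝ)).smul_const N).const_add 1
    exact (differentiable_det (d := d) 1).hasFDerivAt.comp_hasDerivAt_of_eq 0 h2
      (by rw [zero_smul ℝ N, add_zero])
  set b := (EuclideanSpace.basisFun (Fin d) ℝ).toBasis
  obtain ⟨p, hp⟩ : ∃ p : Polynomial ℝ, ∀ r : ℝ, (1 + r • N).det =
      1 + LinearMap.trace ℝ (EuclideanSpace ℝ (Fin d)) N * r + p.eval r * r ^ 2 := by
    refine ⟨(Matrix.det (1 + (Polynomial.X : Polynomial ℝ) •
      ((LinearMap.toMatrix b b N).map Polynomial.C))).divX.divX, fun r => ?_⟩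
    rw [LinearMap.trace_eq_matrix_trace ℝ b, ← Matrix.det_one_add_smul, ContinuousLinearMap.det,
      ← LinearMap.det_toMatrix b]
    congr 1
    ext i j
    simp [LinearMap.toMatrix_apply, Matrix.one_apply, b]
  have h4 : HasDerivAt (fun r : ℝ => (1 + r • N).det)
      (LinearMap.trace ℝ (EuclideanSpace ℝ (Fin d)) N) 0 := by
    simp only [hp]
    have h5 := (((hasDerivAt_id (0 : ℝ)).const_mul
      (LinearMap.trace ℝ (EuclideanSpace ℝ (Fin d)) N)).const_add 1).add
      ((p.hasDerivAt 0).mul ((hasDerivAt_id (0 : ℝ)).pow 2))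
    refine h5.congr_deriv ?_
    simp
  exact h1.unique h4

/-- Jacobi's formula. -/
lemma hasDerivAt_det {B : ℝ → EuclideanSpace ℝ (Fin d) →L[ℝ] EuclideanSpace ℝ (Fin d)}
    {N : EuclideanSpace ℝ (Fin d) →L[ℝ] EuclideanSpace ℝ (Fin d)} {t : ℝ}
    (hB : HasDerivAt B (N.comp (B t)) t) (hu : IsUnit (B t)) :
    HasDerivAt (fun r => (B r).det)
      (LinearMap.trace ℝ (EuclideanSpace ℝ (Fin d)) N * (B t).det) t := by
  obtain ⟨U, hU⟩ := hu
  have h1 : HasDerivAt (fun r => B r * (U⁻¹ : (EuclideanSpace ℝ (Fin d) →L[ℝ]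
      EuclideanSpace ℝ (Fin d))ˣ).val) N t := by
    have h2 := hB.mul_const (U⁻¹ : (EuclideanSpace ℝ (Fin d) →L[ℝ] EuclideanSpace ℝ (Fin d))ˣ).val
    refine h2.congr_deriv ?_
    rw [← ContinuousLinearMap.mul_def, mul_assoc, ← hU, Units.mul_inv, mul_one]
  have h3 := (differentiable_det (d := d) (B t * (U⁻¹ : (EuclideanSpace ℝ (Fin d) →L[ℝ]
      EuclideanSpace ℝ (Fin d))ˣ).val)).hasFDerivAt.comp_hasDerivAt t h1
  have h4 : B t * (U⁻¹ : (EuclideanSpace ℝ (Fin d) →L[ℝ] EuclideanSpace ℝ (Fin d))ˣ).val = 1 := by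
    rw [← hU, Units.mul_inv]
  rw [h4, fderiv_det_one] at h3
  refine (h3.mul_const (B t).det).congr_of_eventuallyEq (Eventually.of_forall fun r => ?_)
  simp only [Function.comp]
  rw [ContinuousLinearMap.det, ContinuousLinearMap.det, ContinuousLinearMap.det, ← LinearMap.det_comp,
    ← ContinuousLinearMap.toLinearMap_comp, ← ContinuousLinearMap.mul_def, mul_assoc]
  conv_rhs => rw [← hU, Units.inv_mul, mul_one]

lemma trace_tensorSq (g : EuclideanSpace ℝ (Fin d)) :
    LinearMap.trace ℝ (EuclideanSpace ℝ (Fin d)) (tensorSq g) = ‖g‖ ^ 2 := by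
  rw [LinearMap.trace_eq_sum_inner _ (EuclideanSpace.basisFun (Fin d) ℝ), EuclideanSpace.norm_sq_eq]
  refine Finset.sum_congr rfl fun i _ => ?_
  simp [tensorSq, inner_smul_right, EuclideanSpace.inner_single_left,
    EuclideanSpace.inner_single_right, sq]

lemma trace_comp_self {A : EuclideanSpace ℝ (Fin d) →L[ℝ] EuclideanSpace ℝ (Fin d)}
    (hA : ∀ v w, ⟪A v, w⟫ = ⟪A w, v⟫) :
    LinearMap.trace ℝ (EuclideanSpace ℝ (Fin d)) (A.comp A) = normSqHS A := by
  rw [LinearMap.trace_eq_sum_inner _ (EuclideanSpace.basisFun (Fin d) ℝ), normSqHS,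
    Finset.sum_comm]
  refine Finset.sum_congr rfl fun i _ => ?_
  rw [← EuclideanSpace.real_norm_sq_eq, ← real_inner_self_eq_norm_sq]
  simp only [EuclideanSpace.basisFun_apply]
  rw [hA (EuclideanSpace.single i 1), real_inner_comm]
  rfl

/-! ### Second-order regularity and the Riccati equation -/

lemma hasFDerivAt_quadDot (z : ℝ × EuclideanSpace ℝ (Fin d)) (τ : ℝ) :
    HasFDerivAt (fun z => quadDot z τ) (quadDerivDot z τ) z := by
  have h1 : HasFDerivAt (fun z : ℝ × EuclideanSpace ℝ (Fin d) => 1 + 2 * τ * z.1)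
      ((2 * τ) • ContinuousLinearMap.fst ℝ ℝ (EuclideanSpace ℝ (Fin d))) z :=
    (hasFDerivAt_fst.const_mul (2 * τ)).const_add 1
  have h2 : HasFDerivAt (fun z : ℝ × EuclideanSpace ℝ (Fin d) => 2 * z.1)
      ((2 : ℝ) • ContinuousLinearMap.fst ℝ ℝ (EuclideanSpace ℝ (Fin d))) z :=
    hasFDerivAt_fst.const_mul 2
  have h3 := ((h2.mul h1).add
    ((hasFDerivAt_snd (𝕜 := ℝ) (E := ℝ) (F := EuclideanSpace ℝ (Fin d)) (p := z)).norm_sq.const_mul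
      τ)).const_mul 2
  refine HasFDerivAt.congr_fderiv h3 ?_
  ext w <;> simp [quadDerivDot] <;> ring

/-- The points of density of the contact set at which the gradient is differentiable. -/
def regular (u v : ℝ → EuclideanSpace ℝ (Fin d) → ℝ) (t : ℝ) : Set (EuclideanSpace ℝ (Fin d)) :=
  {x | IsDensityPoint (touch u v t) x ∧
    DifferentiableWithinAt ℝ (gradient (u t)) (touch u v t) x}

/-- The differential of the gradient along the contact set. -/
def hess (u v : ℝ → EuclideanSpace ℝ (Fin d) → ℝ) (t : ℝ) (z : EuclideanSpace ℝ (Fin d)) :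
    EuclideanSpace ℝ (Fin d) →L[ℝ] EuclideanSpace ℝ (Fin d) :=
  fderivWithin ℝ (gradient (u t)) (touch u v t) z

/-- The differential of the jet along the contact set. -/
def jetDeriv (u v : ℝ → EuclideanSpace ℝ (Fin d) → ℝ) (s : ℝ) (y : EuclideanSpace ℝ (Fin d)) :
    EuclideanSpace ℝ (Fin d) →L[ℝ] ℝ × EuclideanSpace ℝ (Fin d) :=
  (innerSL ℝ (gradient (u s) y)).prod (hess u v s y)

/-- The differential of the transport map along the contact set. -/
def transDeriv (u v : ℝ → EuclideanSpace ℝ (Fin d) → ℝ) (s : ℝ) (y : EuclideanSpace ℝ (Fin d))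
    (t : ℝ) : EuclideanSpace ℝ (Fin d) →L[ℝ] EuclideanSpace ℝ (Fin d) :=
  ContinuousLinearMap.id ℝ _ +
    (∫ σ in (0 : ℝ)..(t - s), velocityDeriv (jet (u s) y) σ).comp (jetDeriv u v s y)

/-- Product rule for H = Ḃ B⁻¹ with Ḃ = H B and B̈ = A B, the operator equations to be used with `U`
in the role of B. -/
lemma mul_inv_add_mul_neg_inv {R : Type*} [Ring R] (U : Rˣ) (A H : R) :
    (A * U) * (U⁻¹ : Rˣ) + (H * U) * -((U⁻¹ : Rˣ) * (H * U) * (U⁻¹ : Rˣ)) = A - H * H := by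
  simp [mul_assoc, sub_eq_add_neg]

namespace IsPair

variable {u v : ℝ → EuclideanSpace ℝ (Fin d) → ℝ} {s t : ℝ} {y : EuclideanSpace ℝ (Fin d)}

lemma mem_of_regular (h : IsPair u v) (hs : s ∈ Ioo (0 : ℝ) 1) (hy : y ∈ regular u v s) :
    y ∈ touch u v s :=
  hy.1.mem (h.isClosed_touch hs)

lemma hasFDerivWithinAt_jet (h : IsPair u v) (hs : s ∈ Ioo (0 : ℝ) 1) (hy : y ∈ regular u v s) :
    HasFDerivWithinAt (jet (u s)) (jetDeriv u v s y) (touch u v s) y := by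
  have h1 : HasFDerivAt (u s) (innerSL ℝ (gradient (u s) y)) y :=
    (h.hasGradientAt hs (h.mem_of_regular hs hy)).hasFDerivAt
  exact h1.hasFDerivWithinAt.prodMk hy.2.hasFDerivWithinAt

lemma hasFDerivWithinAt_trans (h : IsPair u v) (hs : s ∈ Ioo (0 : ℝ) 1) (ht : t ∈ Ioo (0 : ℝ) 1)
    (hy : y ∈ regular u v s) :
    HasFDerivWithinAt (trans u s t) (transDeriv u v s y t) (touch u v s) y := by
  have h1 := hasFDerivAt_travel (z := jet (u s) y) (h.left.one_add_pos hs ht y)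
  exact (hasFDerivWithinAt_id y _).add
    (h1.comp_hasFDerivWithinAt y (h.hasFDerivWithinAt_jet hs hy))

lemma hasDerivAt_transDeriv (h : IsPair u v) (hs : s ∈ Ioo (0 : ℝ) 1) (ht : t ∈ Ioo (0 : ℝ) 1) :
    HasDerivAt (transDeriv u v s y)
      ((velocityDeriv (jet (u s) y) (t - s)).comp (jetDeriv u v s y)) t := by
  have h1 := hasDerivAt_integral_velocityDeriv (z := jet (u s) y) (h.left.one_add_pos hs ht y)
  have h2 := h1.comp_sub_const t s
  exact (h2.clm_comp (hasDerivAt_const t (jetDeriv u v s y))).const_add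
    (ContinuousLinearMap.id ℝ _) |>.congr_deriv (by simp)

/-- On the contact sets the transport has the Lipschitz inverse `trans u t s`, and lower bounds pass
to the differential at a density point. -/
lemma exists_norm_le_transDeriv (h : IsPair u v) (hs : s ∈ Ioo (0 : ℝ) 1)
    (ht : t ∈ Ioo (0 : ℝ) 1) (hy : y ∈ regular u v s) :
    ∃ L : ℝ, ∀ w, ‖w‖ ≤ L * ‖transDeriv u v s y t w‖ := by
  obtain ⟨L, -, hL⟩ := h.exists_trans_lipschitz ht hs
  have hyS := h.mem_of_regular hs hy
  refine ⟨L, hy.1.le_norm_apply (h.isClosed_touch hs) (h.hasFDerivWithinAt_trans hs ht hy)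
    fun x hx => ?_⟩
  have := hL _ (h.trans_mem hs ht hyS) _ (h.trans_mem hs ht hx)
  rwa [h.trans_trans hs ht hyS, h.trans_trans hs ht hx] at this

lemma exists_equiv (h : IsPair u v) (hs : s ∈ Ioo (0 : ℝ) 1) (ht : t ∈ Ioo (0 : ℝ) 1)
    (hy : y ∈ regular u v s) :
    ∃ e : EuclideanSpace ℝ (Fin d) ≃L[ℝ] EuclideanSpace ℝ (Fin d),
      (e : EuclideanSpace ℝ (Fin d) →L[ℝ] EuclideanSpace ℝ (Fin d)) = transDeriv u v s y t := by
  obtain ⟨L, hL⟩ := h.exists_norm_le_transDeriv hs ht hy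
  have hinj : Function.Injective (transDeriv u v s y t : EuclideanSpace ℝ (Fin d) →ₗ[ℝ]
      EuclideanSpace ℝ (Fin d)) := by
    rw [← LinearMap.ker_eq_bot, LinearMap.ker_eq_bot']
    intro w hw
    have := hL w
    rw [ContinuousLinearMap.coe_coe] at hw
    rw [hw, norm_zero, mul_zero] at this
    exact norm_le_zero_iff.mp this
  refine ⟨(LinearEquiv.ofInjectiveEndo _ hinj).toContinuousLinearEquiv, ?_⟩
  ext w : 1
  rfl

lemma hasFDerivWithinAt_trans_symm (h : IsPair u v) (hs : s ∈ Ioo (0 : ℝ) 1)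
    (ht : t ∈ Ioo (0 : ℝ) 1) (hy : y ∈ regular u v s)
    {e : EuclideanSpace ℝ (Fin d) ≃L[ℝ] EuclideanSpace ℝ (Fin d)}
    (he : (e : EuclideanSpace ℝ (Fin d) →L[ℝ] EuclideanSpace ℝ (Fin d)) = transDeriv u v s y t) :
    HasFDerivWithinAt (trans u t s)
      (e.symm : EuclideanSpace ℝ (Fin d) →L[ℝ] EuclideanSpace ℝ (Fin d)) (touch u v t)
      (trans u s t y) := by
  have hyS := h.mem_of_regular hs hy
  have hmem := h.trans_mem hs ht hyS
  obtain ⟨L, hL0, hL⟩ := h.exists_trans_lipschitz ht hs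
  refine HasFDerivWithinAt.of_local_left_inverse (f := trans u s t) (t := touch u v s) ?_ ?_ hmem ?_
  · refine tendsto_nhdsWithin_iff.mpr ⟨?_, ?_⟩
    · have hcont : ContinuousOn (trans u t s) (touch u v t) := by
        refine (LipschitzOnWith.of_dist_le_mul (K := Real.toNNReal L) fun x hx x' hx' => ?_).continuousOn
        rw [dist_eq_norm, dist_eq_norm, Real.coe_toNNReal _ hL0]
        exact hL _ hx' _ hx
      exact hcont _ hmem
    · filter_upwards [self_mem_nhdsWithin] with x hx
      exact h.trans_mem ht hs hx
  · rw [he, h.trans_trans hs ht hyS]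
    exact h.hasFDerivWithinAt_trans hs ht hy
  · filter_upwards [self_mem_nhdsWithin] with x hx
    exact h.trans_trans ht hs hx

/-- On the contact set the gradient at time `t` is the closed velocity formula in the jet at time
`s`, composed with the inverse transport; the chain rule applies. -/
lemma hasFDerivWithinAt_gradient (h : IsPair u v) (hs : s ∈ Ioo (0 : ℝ) 1)
    (ht : t ∈ Ioo (0 : ℝ) 1) (hy : y ∈ regular u v s)
    {e : EuclideanSpace ℝ (Fin d) ≃L[ℝ] EuclideanSpace ℝ (Fin d)}
    (he : (e : EuclideanSpace ℝ (Fin d) →L[ℝ] EuclideanSpace ℝ (Fin d)) = transDeriv u v s y t) :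
    HasFDerivWithinAt (gradient (u t))
      (((velocityDeriv (jet (u s) y) (t - s)).comp (jetDeriv u v s y)).comp
        (e.symm : EuclideanSpace ℝ (Fin d) →L[ℝ] EuclideanSpace ℝ (Fin d))) (touch u v t)
      (trans u s t y) := by
  have hyS := h.mem_of_regular hs hy
  have h1 := h.hasFDerivWithinAt_trans_symm hs ht hy he
  have h2 : HasFDerivWithinAt (fun x => (quad (jet (u s) x) (t - s))⁻¹ • (jet (u s) x).2)
      ((velocityDeriv (jet (u s) y) (t - s)).comp (jetDeriv u v s y)) (touch u v s) y :=
    (hasFDerivAt_velocity (h.quad_jet_pos hs ht y).ne').comp_hasFDerivWithinAt y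
      (h.hasFDerivWithinAt_jet hs hy)
  have h2' : HasFDerivWithinAt (fun x => (quad (jet (u s) x) (t - s))⁻¹ • (jet (u s) x).2)
      ((velocityDeriv (jet (u s) y) (t - s)).comp (jetDeriv u v s y)) (touch u v s)
      (trans u t s (trans u s t y)) := by
    rw [h.trans_trans hs ht hyS]
    exact h2
  have h3 := h2'.comp (trans u s t y) h1 (fun x hx => h.trans_mem ht hs hx)
  have key : ∀ x ∈ touch u v t, gradient (u t) x =
      ((fun x => (quad (jet (u s) x) (t - s))⁻¹ • (jet (u s) x).2) ∘ trans u t s) x := by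
    intro x hx
    have := h.gradient_trans hs ht (h.trans_mem ht hs hx)
    rwa [h.trans_trans ht hs hx] at this
  exact h3.congr key (key _ (h.trans_mem hs ht hyS))

lemma trans_mem_regular (h : IsPair u v) (hs : s ∈ Ioo (0 : ℝ) 1) (ht : t ∈ Ioo (0 : ℝ) 1)
    (hy : y ∈ regular u v s) : trans u s t y ∈ regular u v t := by
  obtain ⟨e, he⟩ := h.exists_equiv hs ht hy
  exact ⟨h.isDensityPoint_trans hs ht hy.1,
    (h.hasFDerivWithinAt_gradient hs ht hy he).differentiableWithinAt⟩

lemma hess_trans (h : IsPair u v) (hs : s ∈ Ioo (0 : ℝ) 1) (ht : t ∈ Ioo (0 : ℝ) 1)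
    (hy : y ∈ regular u v s)
    {e : EuclideanSpace ℝ (Fin d) ≃L[ℝ] EuclideanSpace ℝ (Fin d)}
    (he : (e : EuclideanSpace ℝ (Fin d) →L[ℝ] EuclideanSpace ℝ (Fin d)) = transDeriv u v s y t) :
    hess u v t (trans u s t y) =
      ((velocityDeriv (jet (u s) y) (t - s)).comp (jetDeriv u v s y)).comp
        (e.symm : EuclideanSpace ℝ (Fin d) →L[ℝ] EuclideanSpace ℝ (Fin d)) :=
  (h.hasFDerivWithinAt_gradient hs ht hy he).fderivWithin
    ((h.isDensityPoint_trans hs ht hy.1).uniqueDiffWithinAt (h.isClosed_touch ht))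

/-- By `hasDerivAt_transDeriv` the right side is the time derivative of the transport differential,
so this is the first-order equation Ḃ = H B. -/
lemma hess_comp_transDeriv (h : IsPair u v) (hs : s ∈ Ioo (0 : ℝ) 1) (ht : t ∈ Ioo (0 : ℝ) 1)
    (hy : y ∈ regular u v s) :
    (hess u v t (trans u s t y)).comp (transDeriv u v s y t) =
      (velocityDeriv (jet (u s) y) (t - s)).comp (jetDeriv u v s y) := by
  obtain ⟨e, he⟩ := h.exists_equiv hs ht hy
  rw [h.hess_trans hs ht hy he, ← he]
  ext w : 1
  simp

lemma isUnit_transDeriv (h : IsPair u v) (hs : s ∈ Ioo (0 : ℝ) 1) (ht : t ∈ Ioo (0 : ℝ) 1)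
    (hy : y ∈ regular u v s) : IsUnit (transDeriv u v s y t) := by
  obtain ⟨e, he⟩ := h.exists_equiv hs ht hy
  rw [← he]
  exact (ContinuousLinearEquiv.toUnit e).isUnit

/-- The differential of `u t` along the transport. -/
lemma inner_gradient_transDeriv (h : IsPair u v) (hs : s ∈ Ioo (0 : ℝ) 1)
    (ht : t ∈ Ioo (0 : ℝ) 1) (hy : y ∈ regular u v s) (w : EuclideanSpace ℝ (Fin d)) :
    ⟪gradient (u t) (trans u s t y), transDeriv u v s y t w⟫ =
      quadDerivDot (jet (u s) y) (t - s) (jetDeriv u v s y w) / (4 * quad (jet (u s) y) (t - s)) -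
        quadDot (jet (u s) y) (t - s) * quadDeriv (jet (u s) y) (t - s) (jetDeriv u v s y w) /
          (4 * quad (jet (u s) y) (t - s) ^ 2) := by
  have hyS := h.mem_of_regular hs hy
  have hq := h.quad_jet_pos hs ht y
  have h1 : HasFDerivAt (u t) (innerSL ℝ (gradient (u t) (trans u s t y))) (trans u s t y) :=
    (h.hasGradientAt ht (h.trans_mem hs ht hyS)).hasFDerivAt
  have h2 := h1.comp_hasFDerivWithinAt y (h.hasFDerivWithinAt_trans hs ht hy)
  have h3 := (hasFDerivAt_quadDot (jet (u s) y) (t - s)).comp_hasFDerivWithinAt y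
    (h.hasFDerivWithinAt_jet hs hy)
  have h4 : HasFDerivAt (fun z => (4 * quad z (t - s))⁻¹) _ (jet (u s) y) :=
    (hasDerivAt_inv (by positivity)).comp_hasFDerivAt (jet (u s) y)
      ((hasFDerivAt_quad (jet (u s) y) (t - s)).const_mul 4)
  have h5 := h3.mul (h4.comp_hasFDerivWithinAt y (h.hasFDerivWithinAt_jet hs hy))
  have key : ∀ x ∈ touch u v s, (u t ∘ trans u s t) x =
      ((fun z => quadDot z (t - s)) ∘ jet (u s)) x *
        ((fun z => (4 * quad z (t - s))⁻¹) ∘ jet (u s)) x := by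
    intro x hx
    have := congrArg Prod.fst (h.jet_trans hs ht hx)
    simpa [jet, div_eq_mul_inv] using this
  -- Two formulas for the same map along the contact set; uniqueness of derivatives at a density
  -- point equates their differentials.
  have h6 := h2.congr (fun x hx => (key x hx).symm) (key y hyS).symm
  have h7 := (hy.1.uniqueDiffWithinAt (h.isClosed_touch hs)).eq h6 h5
  have h8 := congrArg (fun A => A w) h7
  simp only [ContinuousLinearMap.comp_apply, innerSL_apply_apply, add_apply, smul_apply,
    Function.comp_apply, smul_eq_mul] at h8
  rw [h8]
  field_simp
  ring

/-- The differential in the starting point of T̈ = -4 ξ ∇ξ: the tensor term comes from ξ, the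
Hessian term from ∇ξ. Both are matched with the explicit time derivative of `velocityDeriv`. -/
lemma hasDerivAt_deriv_transDeriv (h : IsPair u v) (hs : s ∈ Ioo (0 : ℝ) 1)
    (ht : t ∈ Ioo (0 : ℝ) 1) (hy : y ∈ regular u v s) :
    HasDerivAt (fun t => (velocityDeriv (jet (u s) y) (t - s)).comp (jetDeriv u v s y))
      (-(4 : ℝ) • (tensorSq (gradient (u t) (trans u s t y)) +
        u t (trans u s t y) • hess u v t (trans u s t y)).comp (transDeriv u v s y t)) t := by
  have hyS := h.mem_of_regular hs hy
  have hq := h.quad_jet_pos hs ht y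
  have h1 := (hasDerivAt_velocityDeriv (z := jet (u s) y) hq.ne').comp_sub_const t s
  refine (h1.clm_comp (hasDerivAt_const t (jetDeriv u v s y))).congr_deriv ?_
  have hj := h.jet_trans hs ht hyS
  have hu : u t (trans u s t y) =
    quadDot (jet (u s) y) (t - s) / (4 * quad (jet (u s) y) (t - s)) := congrArg Prod.fst hj
  have hg : gradient (u t) (trans u s t y) =
    (quad (jet (u s) y) (t - s))⁻¹ • (jet (u s) y).2 := congrArg Prod.snd hj
  ext w : 1
  have hc := congrArg (fun A => A w) (h.hess_comp_transDeriv hs ht hy)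
  have hi := h.inner_gradient_transDeriv hs ht hy w
  simp only [ContinuousLinearMap.comp_apply, add_apply, smul_apply, sub_apply, tensorSq,
    ContinuousLinearMap.smulRight_apply, innerSL_apply_apply, ContinuousLinearMap.comp_zero,
    add_zero, velocityDeriv, ContinuousLinearMap.coe_snd'] at hc ⊢
  rw [hc, hi, hu, hg]
  generalize jetDeriv u v s y w = m
  generalize quadDerivDot (jet (u s) y) (t - s) m = a
  generalize quadDeriv (jet (u s) y) (t - s) m = b
  generalize quadDot (jet (u s) y) (t - s) = c
  generalize quad (jet (u s) y) (t - s) = Q at *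
  generalize (jet (u s) y).2 = g
  simp only [smul_sub, smul_add, smul_smul, neg_smul]
  match_scalars
  · field_simp
  · field_simp
    ring

lemma inner_hess_symm (h : IsPair u v) (hs : s ∈ Ioo (0 : ℝ) 1) (hy : y ∈ regular u v s)
    (a b : EuclideanSpace ℝ (Fin d)) : ⟪hess u v s y a, b⟫ = ⟪hess u v s y b, a⟫ :=
  hy.1.inner_symm (h.isClosed_touch hs) (fun _ hx => h.quadratic_bound hs hx)
    hy.2.hasFDerivWithinAt a b

lemma transDeriv_self : transDeriv u v s y s = ContinuousLinearMap.id ℝ _ := by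
  simp [transDeriv]

lemma det_transDeriv_pos (h : IsPair u v) (hs : s ∈ Ioo (0 : ℝ) 1) (ht : t ∈ Ioo (0 : ℝ) 1)
    (hy : y ∈ regular u v s) : 0 < (transDeriv u v s y t).det := by
  have hcont : ContinuousOn (fun t => (transDeriv u v s y t).det) (Ioo (0 : ℝ) 1) := fun r hr =>
    ((differentiable_det _).continuousAt.comp
      (h.hasDerivAt_transDeriv hs hr).continuousAt).continuousWithinAt
  have hne : ∀ r ∈ Ioo (0 : ℝ) 1, (transDeriv u v s y r).det ≠ 0 := fun r hr => by
    obtain ⟨e, he⟩ := h.exists_equiv hs hr hy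
    rw [← he]
    exact (LinearEquiv.isUnit_det' e.toLinearEquiv).ne_zero
  by_contra hneg
  have h0 : (0 : ℝ) ∈ uIcc ((transDeriv u v s y t).det) ((transDeriv u v s y s).det) := by
    rw [transDeriv_self]
    have : (ContinuousLinearMap.id ℝ (EuclideanSpace ℝ (Fin d))).det = 1 := LinearMap.det_id
    rw [this]
    exact Icc_subset_uIcc ⟨not_lt.mp hneg, zero_le_one⟩
  have hsub : uIcc t s ⊆ Ioo (0 : ℝ) 1 := (ordConnected_Ioo).uIcc_subset ht hs
  obtain ⟨r, hr, hr0⟩ := intermediate_value_uIcc (hcont.mono hsub) h0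
  exact hne r (hsub hr) hr0

lemma hasDerivAt_det_transDeriv (h : IsPair u v) (hs : s ∈ Ioo (0 : ℝ) 1)
    (ht : t ∈ Ioo (0 : ℝ) 1) (hy : y ∈ regular u v s) :
    HasDerivAt (fun t => (transDeriv u v s y t).det)
      (LinearMap.trace ℝ _ (hess u v t (trans u s t y) : EuclideanSpace ℝ (Fin d) →ₗ[ℝ]
        EuclideanSpace ℝ (Fin d)) * (transDeriv u v s y t).det) t := by
  refine hasDerivAt_det ?_ (h.isUnit_transDeriv hs ht hy)
  rw [h.hess_comp_transDeriv hs ht hy]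
  exact h.hasDerivAt_transDeriv hs ht

lemma hasDerivAt_hess_trans (h : IsPair u v) (hs : s ∈ Ioo (0 : ℝ) 1)
    (ht : t ∈ Ioo (0 : ℝ) 1) (hy : y ∈ regular u v s) :
    HasDerivAt (fun t => hess u v t (trans u s t y))
      (-(4 : ℝ) • (tensorSq (gradient (u t) (trans u s t y)) +
        u t (trans u s t y) • hess u v t (trans u s t y)) -
        (hess u v t (trans u s t y)).comp (hess u v t (trans u s t y))) t := by
  have hev : (fun t => (velocityDeriv (jet (u s) y) (t - s)).comp (jetDeriv u v s y) *
      Ring.inverse (transDeriv u v s y t)) =ᶠ[𝓝 t] fun t => hess u v t (trans u s t y) := by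
    filter_upwards [isOpen_Ioo.mem_nhds ht] with r hr
    rw [← h.hess_comp_transDeriv hs hr hy, ← ContinuousLinearMap.mul_def, mul_assoc,
      Ring.mul_inverse_cancel _ (h.isUnit_transDeriv hs hr hy), mul_one]
  refine HasDerivAt.congr_of_eventuallyEq ?_ hev.symm
  obtain ⟨U, hU⟩ := h.isUnit_transDeriv hs ht hy
  have h1 := hasFDerivAt_ringInverse (𝕜 := ℝ) U
  rw [hU] at h1
  have h2 := h1.comp_hasDerivAt t (h.hasDerivAt_transDeriv (y := y) hs ht)
  refine ((h.hasDerivAt_deriv_transDeriv hs ht hy).mul h2).congr_deriv ?_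
  rw [← h.hess_comp_transDeriv hs ht hy, Function.comp_apply, ← hU, Ring.inverse_unit]
  rw [← ContinuousLinearMap.smul_comp]
  exact mul_inv_add_mul_neg_inv U _ _

lemma hasDerivAt_deriv_det_transDeriv (h : IsPair u v) (hs : s ∈ Ioo (0 : ℝ) 1)
    (ht : t ∈ Ioo (0 : ℝ) 1) (hy : y ∈ regular u v s) :
    HasDerivAt (fun t => LinearMap.trace ℝ _ (hess u v t (trans u s t y) :
        EuclideanSpace ℝ (Fin d) →ₗ[ℝ] EuclideanSpace ℝ (Fin d)) * (transDeriv u v s y t).det)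
      ((LinearMap.trace ℝ _ (hess u v t (trans u s t y) : EuclideanSpace ℝ (Fin d) →ₗ[ℝ]
          EuclideanSpace ℝ (Fin d)) ^ 2 - normSqHS (hess u v t (trans u s t y)) -
        4 * ‖gradient (u t) (trans u s t y)‖ ^ 2 -
        4 * u t (trans u s t y) * LinearMap.trace ℝ _ (hess u v t (trans u s t y) :
          EuclideanSpace ℝ (Fin d) →ₗ[ℝ] EuclideanSpace ℝ (Fin d))) *
        (transDeriv u v s y t).det) t := by
  let tr : (EuclideanSpace ℝ (Fin d) →L[ℝ] EuclideanSpace ℝ (Fin d)) →L[ℝ] ℝ :=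
    LinearMap.toContinuousLinearMap
      ((LinearMap.trace ℝ (EuclideanSpace ℝ (Fin d))).comp (ContinuousLinearMap.coeLM ℝ))
  have htr : ∀ A, tr A = LinearMap.trace ℝ (EuclideanSpace ℝ (Fin d)) A := fun A => rfl
  simp only [← htr]
  have h1 := tr.hasFDerivAt.comp_hasDerivAt t (h.hasDerivAt_hess_trans hs ht hy)
  have h2 := h1.mul (h.hasDerivAt_det_transDeriv hs ht hy)
  simp only [← htr] at h2
  refine h2.congr_deriv ?_
  rw [map_sub, map_smul, map_add, map_smul, htr (tensorSq _), trace_tensorSq, htr (_ ∘SL _),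
    trace_comp_self (h.inner_hess_symm ht (h.trans_mem_regular hs ht hy))]
  simp only [Function.comp_apply, smul_eq_mul]
  ring

end IsPair

lemma isFlow_pot {ξ : EuclideanSpace ℝ (Fin d) → EReal}
    (hξ : ∀ x, ((-1 / 2 : ℝ) : EReal) ≤ ξ x) : IsFlow (pot ξ) where
  ge _ ht := pot_ge hξ ht
  le _ ht := pot_le hξ ht
  continuous _ ht := continuous_pot hξ ht
  cosSq_le _ ht _ hs hts := cosSq_le_pot_mul hξ ht hs hts
  exists_eq _ ht _ hs hts := exists_pot_mul_eq hξ ht hs hts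

namespace IsPair

variable {u v : ℝ → EuclideanSpace ℝ (Fin d) → ℝ} {s t : ℝ} {x y : EuclideanSpace ℝ (Fin d)}

lemma eq_trans_of_linked_of_lt (h : IsPair u v) (hs : s ∈ Ioo (0 : ℝ) 1)
    (ht : t ∈ Ioo (0 : ℝ) 1) (hts : t < s) (hx : x ∈ touch u v s) :
    Linked u s t x y ↔ y = trans u s t x :=
  ⟨fun hL => h.eq_trans hs ht hts.ne hx (h.mem_touch_of_linked_of_lt hs ht hts hx hL) hL,
    fun hy => hy ▸ (h.trans_spec hs ht hx).2⟩

lemma trans_swap (h : IsPair u v) (hs : s ∈ Ioo (0 : ℝ) 1) (ht : t ∈ Ioo (0 : ℝ) 1)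
    (hx : x ∈ touch u v s) : trans v (1 - s) (1 - t) x = trans u s t x := by
  by_cases hne : t = s
  · subst hne; simp
  obtain ⟨hy, hL⟩ := h.trans_spec hs ht hx
  refine (h.swap.eq_trans (one_sub_mem hs) (one_sub_mem ht) (fun h' => hne (by linarith))
    (mem_touch_swap.mpr hx) (mem_touch_swap.mpr hy) ((linked_swap hx hy).mpr hL)).symm

lemma minimizers_eq_singleton (h : IsPair u v) (hs : s ∈ Ioo (0 : ℝ) 1)
    (ht : t ∈ Ioo (0 : ℝ) 1) (hts : t < s) (hx : x ∈ touch u v s)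
    {f : EuclideanSpace ℝ (Fin d) → EReal} (hf : ∀ y, f y = (u t y : EReal)) :
    minimizers (s - t) f x = {trans u s t x} := by
  rw [minimizers_eq (sub_pos.mpr hts) hf (fun y => h.left.one_add_pos ht hs y) (p := u s x)
    (h.left.cosSq_le t ht s hs hts x) (h.left.exists_eq t ht s hs hts x)]
  ext y
  rw [mem_singleton_iff, ← h.eq_trans_of_linked_of_lt hs ht hts hx]
  refine and_congr_right fun _ => ?_
  rw [show 1 - 2 * (s - t) * u s x = 1 + 2 * (t - s) * u s x by ring,
    show 1 + 2 * (s - t) * u t y = 1 - 2 * (t - s) * u t y by ring]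

lemma hasDerivAt_trans (h : IsPair u v) (hs : s ∈ Ioo (0 : ℝ) 1) (ht : t ∈ Ioo (0 : ℝ) 1)
    (hx : x ∈ touch u v s) :
    HasDerivAt (fun t => trans u s t x) (gradient (u t) (trans u s t x)) t := by
  rw [h.gradient_trans hs ht hx]
  exact ((hasDerivAt_travel (z := jet (u s) x) (h.left.one_add_pos hs ht x)).comp_sub_const
    t s).const_add x

lemma hasDerivAt_gradient_trans (h : IsPair u v) (hs : s ∈ Ioo (0 : ℝ) 1)
    (ht : t ∈ Ioo (0 : ℝ) 1) (hx : x ∈ touch u v s) :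
    HasDerivAt (fun t => gradient (u t) (trans u s t x))
      (-(4 * u t (trans u s t x)) • gradient (u t) (trans u s t x)) t := by
  have hq := h.quad_jet_pos hs ht x
  have h1 := (hasDerivAt_velocity (z := jet (u s) x) hq.ne').comp_sub_const t s
  have hj := h.jet_trans hs ht hx
  have hu : u t (trans u s t x) = quadDot (jet (u s) x) (t - s) /
    (4 * quad (jet (u s) x) (t - s)) := congrArg Prod.fst hj
  have hev : (fun t => gradient (u t) (trans u s t x)) =ᶠ[𝓝 t]
      fun t => (quad (jet (u s) x) (t - s))⁻¹ • (jet (u s) x).2 := by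
    filter_upwards [isOpen_Ioo.mem_nhds ht] with r hr using h.gradient_trans hs hr hx
  refine (h1.congr_of_eventuallyEq hev).congr_deriv ?_
  rw [h.gradient_trans hs ht hx, hu, smul_smul]
  congr 1
  field_simp

lemma hasDerivAt_sqrt_quad_jet (h : IsPair u v) (hs : s ∈ Ioo (0 : ℝ) 1)
    (ht : t ∈ Ioo (0 : ℝ) 1) (hx : x ∈ touch u v s) :
    HasDerivAt (fun t => √(quad (jet (u s) x) (t - s)))
      (2 * u t (trans u s t x) * √(quad (jet (u s) x) (t - s))) t := by
  have hq := h.quad_jet_pos hs ht x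
  refine ((hasDerivAt_sqrt_quad hq).comp_sub_const t s).congr_deriv ?_
  have hu : u t (trans u s t x) = quadDot (jet (u s) x) (t - s) /
    (4 * quad (jet (u s) x) (t - s)) := congrArg Prod.fst (h.jet_trans hs ht hx)
  rw [hu]
  have h2 := Real.sq_sqrt hq.le
  have h3 := Real.sqrt_pos.mpr hq
  generalize √(quad (jet (u s) x) (t - s)) = r at *
  rw [← h2]
  field_simp
  norm_num

lemma hasDerivAt_deriv_sqrt_quad_jet (h : IsPair u v) (hs : s ∈ Ioo (0 : ℝ) 1)
    (ht : t ∈ Ioo (0 : ℝ) 1) (hx : x ∈ touch u v s) :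
    HasDerivAt (fun t => 2 * u t (trans u s t x) * √(quad (jet (u s) x) (t - s)))
      (‖gradient (u t) (trans u s t x)‖ ^ 2 * √(quad (jet (u s) x) (t - s))) t := by
  have hq := h.quad_jet_pos hs ht x
  have h1 := (hasDerivAt_deriv_sqrt_quad hq).comp_sub_const t s
  have hev : (fun t => 2 * u t (trans u s t x) * √(quad (jet (u s) x) (t - s))) =ᶠ[𝓝 t]
      fun t => quadDot (jet (u s) x) (t - s) / (2 * √(quad (jet (u s) x) (t - s))) := by
    filter_upwards [isOpen_Ioo.mem_nhds ht] with r hr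
    exact (h.hasDerivAt_sqrt_quad_jet hs hr hx).unique
      ((hasDerivAt_sqrt_quad (h.quad_jet_pos hs hr x)).comp_sub_const r s)
  refine (h1.congr_of_eventuallyEq hev).congr_deriv ?_
  rw [h.gradient_trans hs ht hx, norm_smul, norm_inv, Real.norm_of_nonneg hq.le]
  simp only [jet]
  ring

end IsPair

section Concrete

variable {ξ₀ η₁ : EuclideanSpace ℝ (Fin d) → EReal}

/-- The time reversal of the backward solution. -/
def coPot (η₁ : EuclideanSpace ℝ (Fin d) → EReal) : ℝ → EuclideanSpace ℝ (Fin d) → ℝ :=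
  pot fun y => -η₁ y

lemma isPair_pot (hξ : ∀ x, ((-1 / 2 : ℝ) : EReal) ≤ ξ₀ x)
    (hη : ∀ x, η₁ x ≤ ((1 / 2 : ℝ) : EReal)) (hle : ∀ x, η₁ x ≤ hopfLax 1 ξ₀ x) :
    IsPair (pot ξ₀) (coPot η₁) :=
  ⟨isFlow_pot hξ, isFlow_pot (neg_ge_of_le_half hη), fun _ ht => pot_add_pot_nonneg hξ hη hle ht⟩

lemma neg_backward_eq_coe (hη : ∀ x, η₁ x ≤ ((1 / 2 : ℝ) : EReal)) {t : ℝ}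
    (ht : t ∈ Ioo (0 : ℝ) 1) (x : EuclideanSpace ℝ (Fin d)) :
    -backward η₁ t x = (coPot η₁ (1 - t) x : EReal) :=
  (neg_neg _).trans (forward_eq_coe (neg_ge_of_le_half hη) (one_sub_mem ht) x)

lemma contactSet_eq_touch (hξ : ∀ x, ((-1 / 2 : ℝ) : EReal) ≤ ξ₀ x)
    (hη : ∀ x, η₁ x ≤ ((1 / 2 : ℝ) : EReal)) {t : ℝ} (ht : t ∈ Ioo (0 : ℝ) 1) :
    contactSet ξ₀ η₁ t = touch (pot ξ₀) (coPot η₁) t := by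
  ext x
  change backward η₁ t x = forward ξ₀ t x ↔ pot ξ₀ t x + coPot η₁ (1 - t) x = 0
  rw [← neg_neg (backward η₁ t x), neg_backward_eq_coe hη ht, forward_eq_coe hξ ht,
    ← EReal.coe_neg, EReal.coe_eq_coe_iff, neg_eq_iff_add_eq_zero, add_comm]

variable (hξ : ∀ x, ((-1 / 2 : ℝ) : EReal) ≤ ξ₀ x) (hη : ∀ x, η₁ x ≤ ((1 / 2 : ℝ) : EReal))
  (hle : ∀ x, η₁ x ≤ hopfLax 1 ξ₀ x) {s t : ℝ} {x y : EuclideanSpace ℝ (Fin d)}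
include hξ hη

lemma regularSet_eq_regular (ht : t ∈ Ioo (0 : ℝ) 1) :
    regularSet ξ₀ η₁ t = regular (pot ξ₀) (coPot η₁) t := by
  rw [regularSet, contactSet_eq_touch hξ hη ht, regular]

lemma hessian_eq_hess (ht : t ∈ Ioo (0 : ℝ) 1) :
    hessian ξ₀ η₁ t = hess (pot ξ₀) (coPot η₁) t := by
  ext z : 1
  rw [hessian, contactSet_eq_touch hξ hη ht, hess]

include hle

lemma transportSet_eq_singleton (hs : s ∈ Ioo (0 : ℝ) 1) (ht : t ∈ Ioo (0 : ℝ) 1)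
    (hx : x ∈ touch (pot ξ₀) (coPot η₁) s) :
    transportSet ξ₀ η₁ s t x = {trans (pot ξ₀) s t x} := by
  have h := isPair_pot hξ hη hle
  unfold transportSet
  rcases lt_trichotomy t s with hts | hts | hts
  · rw [if_pos hts.le]
    exact h.minimizers_eq_singleton hs ht hts hx (forward_eq_coe hξ ht)
  · subst hts
    simp [minimizers]
  · rw [if_neg hts.not_ge, ← h.trans_swap hs ht hx,
      ← h.swap.minimizers_eq_singleton (one_sub_mem hs) (one_sub_mem ht) (by linarith)
        (IsPair.mem_touch_swap.mpr hx) (neg_backward_eq_coe hη ht)]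
    congr 1
    ring

lemma transportMap_eq_trans (hs : s ∈ Ioo (0 : ℝ) 1) (ht : t ∈ Ioo (0 : ℝ) 1)
    (hx : x ∈ touch (pot ξ₀) (coPot η₁) s) :
    transportMap ξ₀ η₁ s t x = trans (pot ξ₀) s t x := by
  have h := transportSet_eq_singleton hξ hη hle hs ht hx
  have hne : (transportSet ξ₀ η₁ s t x).Nonempty := h ▸ singleton_nonempty _
  rw [transportMap, dif_pos hne]
  exact h.subset hne.choose_spec

lemma dilation_eq_sqrt_quad (hs : s ∈ Ioo (0 : ℝ) 1) (ht : t ∈ Ioo (0 : ℝ) 1)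
    (hx : x ∈ touch (pot ξ₀) (coPot η₁) s) :
    dilation ξ₀ η₁ s t x = √(quad (jet (pot ξ₀ s) x) (t - s)) := by
  have h := isPair_pot hξ hη hle
  rw [dilation, transportMap_eq_trans hξ hη hle hs ht hx, h.one_sub_trans hs ht hx,
    div_div_cancel₀ (h.left.one_add_pos hs ht x).ne']

lemma hasFDerivWithinAt_transportMap (hs : s ∈ Ioo (0 : ℝ) 1) (ht : t ∈ Ioo (0 : ℝ) 1)
    (hy : y ∈ regular (pot ξ₀) (coPot η₁) s) :
    HasFDerivWithinAt (transportMap ξ₀ η₁ s t) (transDeriv (pot ξ₀) (coPot η₁) s y t)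
      (contactSet ξ₀ η₁ s) y := by
  have h := isPair_pot hξ hη hle
  rw [contactSet_eq_touch hξ hη hs]
  exact (h.hasFDerivWithinAt_trans hs ht hy).congr
    (fun x hx => transportMap_eq_trans hξ hη hle hs ht hx)
    (transportMap_eq_trans hξ hη hle hs ht (h.mem_of_regular hs hy))

lemma transportDeriv_eq_transDeriv (hs : s ∈ Ioo (0 : ℝ) 1) (ht : t ∈ Ioo (0 : ℝ) 1)
    (hy : y ∈ regular (pot ξ₀) (coPot η₁) s) :
    transportDeriv ξ₀ η₁ s t y = transDeriv (pot ξ₀) (coPot η₁) s y t := by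
  refine (hasFDerivWithinAt_transportMap hξ hη hle hs ht hy).fderivWithin ?_
  rw [contactSet_eq_touch hξ hη hs]
  exact hy.1.uniqueDiffWithinAt ((isPair_pot hξ hη hle).isClosed_touch hs)

end Concrete

end HK

end

theorem theorem4p6 {d : ℕ} (ξ₀ η₁ : EuclideanSpace ℝ (Fin d) → EReal)
    (hξ_lsc : LowerSemicontinuous ξ₀) (hξ_ge : ∀ x, ((-1 / 2 : ℝ) : EReal) ≤ ξ₀ x)
    (hη_usc : UpperSemicontinuous η₁) (hη_le : ∀ x, η₁ x ≤ ((1 / 2 : ℝ) : EReal))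
    (hle : ∀ x, η₁ x ≤ HK.hopfLax 1 ξ₀ x)
    (s : ℝ) (hs : s ∈ Set.Ioo (0 : ℝ) 1) :
    -- the solutions are finite at the intermediate times
    (∀ t ∈ Set.Ioo (0 : ℝ) 1, ∀ z, HK.forward ξ₀ t z ≠ ⊥ ∧ HK.forward ξ₀ t z ≠ ⊤) ∧
    -- the equations for `T` and `q`
    (∀ x ∈ HK.contactSet ξ₀ η₁ s,
      ∀ (T : ℝ → EuclideanSpace ℝ (Fin d)) (q : ℝ → ℝ),
      (∀ t, T t = HK.transportMap ξ₀ η₁ s t x) → (∀ t, q t = HK.dilation ξ₀ η₁ s t x) →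
      T s = x ∧ q s = 1 ∧
      ∀ t ∈ Set.Ioo (0 : ℝ) 1,
        HK.transportSet ξ₀ η₁ s t x = {T t} ∧
        T t ∈ HK.contactSet ξ₀ η₁ t ∧
        DifferentiableAt ℝ (HK.pot ξ₀ t) (T t) ∧
        0 < q t ∧
        HasDerivAt T (gradient (HK.pot ξ₀ t) (T t)) t ∧
        HasDerivAt (deriv T) (-(4 * HK.pot ξ₀ t (T t)) • gradient (HK.pot ξ₀ t) (T t)) t ∧
        HasDerivAt q (2 * HK.pot ξ₀ t (T t) * q t) t ∧
        HasDerivAt (deriv q) (‖gradient (HK.pot ξ₀ t) (T t)‖ ^ 2 * q t) t) ∧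
    -- the equations for `B` and `δ`
    (∀ y ∈ HK.regularSet ξ₀ η₁ s,
      ∀ (T : ℝ → EuclideanSpace ℝ (Fin d))
        (B : ℝ → (EuclideanSpace ℝ (Fin d) →L[ℝ] EuclideanSpace ℝ (Fin d))) (δ : ℝ → ℝ),
      (∀ t, T t = HK.transportMap ξ₀ η₁ s t y) → (∀ t, B t = HK.transportDeriv ξ₀ η₁ s t y) →
      (∀ t, δ t = (B t).det) →
      B s = ContinuousLinearMap.id ℝ (EuclideanSpace ℝ (Fin d)) ∧ δ s = 1 ∧
      ∀ t ∈ Set.Ioo (0 : ℝ) 1,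
        T t ∈ HK.regularSet ξ₀ η₁ t ∧
        DifferentiableWithinAt ℝ (HK.transportMap ξ₀ η₁ s t) (HK.contactSet ξ₀ η₁ s) y ∧
        0 < δ t ∧
        HasDerivAt B ((HK.hessian ξ₀ η₁ t (T t)).comp (B t)) t ∧
        HasDerivAt (deriv B)
          (-(4 : ℝ) • (HK.tensorSq (gradient (HK.pot ξ₀ t) (T t)) +
            HK.pot ξ₀ t (T t) • HK.hessian ξ₀ η₁ t (T t)).comp (B t)) t ∧
        HasDerivAt δ (HK.lap ξ₀ η₁ t (T t) * δ t) t ∧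
        DifferentiableAt ℝ (deriv δ) t ∧
        deriv (deriv δ) t / δ t =
          HK.lap ξ₀ η₁ t (T t) ^ 2 - HK.normSqHS (HK.hessian ξ₀ η₁ t (T t))
            - 4 * ‖gradient (HK.pot ξ₀ t) (T t)‖ ^ 2
            - 4 * HK.pot ξ₀ t (T t) * HK.lap ξ₀ η₁ t (T t)) := by
  have h := HK.isPair_pot hξ_ge hη_le hle
  refine ⟨fun t ht z => HK.forward_ne hξ_ge ht z, ?_, ?_⟩
  · intro x hx T q hT hq
    rw [HK.contactSet_eq_touch hξ_ge hη_le hs] at hx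
    have hT' : ∀ t ∈ Set.Ioo (0 : ℝ) 1, T t = HK.trans (HK.pot ξ₀) s t x := fun t ht =>
      (hT t).trans (HK.transportMap_eq_trans hξ_ge hη_le hle hs ht hx)
    have hq' : ∀ t ∈ Set.Ioo (0 : ℝ) 1, q t = √(HK.quad (HK.jet (HK.pot ξ₀ s) x) (t - s)) :=
      fun t ht => (hq t).trans (HK.dilation_eq_sqrt_quad hξ_ge hη_le hle hs ht hx)
    refine ⟨by rw [hT' s hs, HK.trans_self], by simp [hq' s hs], fun t ht => ?_⟩
    have hmem := isOpen_Ioo.mem_nhds ht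
    have hTe : T =ᶠ[𝓝 t] fun t => HK.trans (HK.pot ξ₀) s t x := by
      filter_upwards [hmem] with r hr using hT' r hr
    have hqe : q =ᶠ[𝓝 t] fun t => √(HK.quad (HK.jet (HK.pot ξ₀ s) x) (t - s)) := by
      filter_upwards [hmem] with r hr using hq' r hr
    have hTd : deriv T =ᶠ[𝓝 t]
        fun t => gradient (HK.pot ξ₀ t) (HK.trans (HK.pot ξ₀) s t x) := by
      filter_upwards [hTe.eventuallyEq_nhds, hmem] with r hr hr'
      rw [hr.deriv_eq, (h.hasDerivAt_trans hs hr' hx).deriv]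
    have hqd : deriv q =ᶠ[𝓝 t] fun t => 2 * HK.pot ξ₀ t (HK.trans (HK.pot ξ₀) s t x) *
        √(HK.quad (HK.jet (HK.pot ξ₀ s) x) (t - s)) := by
      filter_upwards [hqe.eventuallyEq_nhds, hmem] with r hr hr'
      rw [hr.deriv_eq, (h.hasDerivAt_sqrt_quad_jet hs hr' hx).deriv]
    have hTt := h.trans_mem hs ht hx
    rw [hT' t ht, hq' t ht, HK.contactSet_eq_touch hξ_ge hη_le ht]
    exact ⟨HK.transportSet_eq_singleton hξ_ge hη_le hle hs ht hx, hTt,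
      (h.hasGradientAt ht hTt).hasFDerivAt.differentiableAt,
      Real.sqrt_pos.mpr (h.quad_jet_pos hs ht x),
      (h.hasDerivAt_trans hs ht hx).congr_of_eventuallyEq hTe,
      (h.hasDerivAt_gradient_trans hs ht hx).congr_of_eventuallyEq hTd,
      (h.hasDerivAt_sqrt_quad_jet hs ht hx).congr_of_eventuallyEq hqe,
      (h.hasDerivAt_deriv_sqrt_quad_jet hs ht hx).congr_of_eventuallyEq hqd⟩
  · intro y hy T B δ hT hB hδ
    rw [HK.regularSet_eq_regular hξ_ge hη_le hs] at hy
    have hyS := h.mem_of_regular hs hy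
    have hT' : ∀ t ∈ Set.Ioo (0 : ℝ) 1, T t = HK.trans (HK.pot ξ₀) s t y := fun t ht =>
      (hT t).trans (HK.transportMap_eq_trans hξ_ge hη_le hle hs ht hyS)
    have hB' : ∀ t ∈ Set.Ioo (0 : ℝ) 1,
        B t = HK.transDeriv (HK.pot ξ₀) (HK.coPot η₁) s y t := fun t ht =>
      (hB t).trans (HK.transportDeriv_eq_transDeriv hξ_ge hη_le hle hs ht hy)
    have hδ' : ∀ t ∈ Set.Ioo (0 : ℝ) 1,
        δ t = (HK.transDeriv (HK.pot ξ₀) (HK.coPot η₁) s y t).det := fun t ht => by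
      rw [hδ, hB' t ht]
    have hBs : B s = ContinuousLinearMap.id ℝ (EuclideanSpace ℝ (Fin d)) := by
      rw [hB' s hs, HK.IsPair.transDeriv_self]
    refine ⟨hBs, by rw [hδ, hBs]; exact LinearMap.det_id, fun t ht => ?_⟩
    have hmem := isOpen_Ioo.mem_nhds ht
    have hBe : B =ᶠ[𝓝 t] HK.transDeriv (HK.pot ξ₀) (HK.coPot η₁) s y := by
      filter_upwards [hmem] with r hr using hB' r hr
    have hδe : δ =ᶠ[𝓝 t] fun t => (HK.transDeriv (HK.pot ξ₀) (HK.coPot η₁) s y t).det := by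
      filter_upwards [hmem] with r hr using hδ' r hr
    have hBd : deriv B =ᶠ[𝓝 t] fun t => (HK.velocityDeriv (HK.jet (HK.pot ξ₀ s) y) (t - s)).comp
        (HK.jetDeriv (HK.pot ξ₀) (HK.coPot η₁) s y) := by
      filter_upwards [hBe.eventuallyEq_nhds, hmem] with r hr hr'
      rw [hr.deriv_eq, (h.hasDerivAt_transDeriv hs hr').deriv]
    have hδd := hδe.deriv.trans <| (Filter.eventually_of_mem hmem fun r hr =>
      (h.hasDerivAt_det_transDeriv hs hr hy).deriv : _ =ᶠ[𝓝 t] _)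
    have hdd := (h.hasDerivAt_deriv_det_transDeriv hs ht hy).congr_of_eventuallyEq hδd
    have hpos := h.det_transDeriv_pos hs ht hy
    rw [hT' t ht, hB' t ht, hδ' t ht, HK.regularSet_eq_regular hξ_ge hη_le ht, HK.lap,
      HK.hessian_eq_hess hξ_ge hη_le ht, h.hess_comp_transDeriv hs ht hy]
    refine ⟨h.trans_mem_regular hs ht hy,
      (HK.hasFDerivWithinAt_transportMap hξ_ge hη_le hle hs ht hy).differentiableWithinAt, hpos,
      (h.hasDerivAt_transDeriv hs ht).congr_of_eventuallyEq hBe,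
      (h.hasDerivAt_deriv_transDeriv hs ht hy).congr_of_eventuallyEq hBd,
      (h.hasDerivAt_det_transDeriv hs ht hy).congr_of_eventuallyEq hδe, hdd.differentiableAt, ?_⟩
    rw [hdd.deriv, mul_div_cancel_right₀ _ hpos.ne']
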